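/- Let $D$ be the elliptic curve $y^2 = x^3 + 14x^2 + 196x$ over $\mathbb{Q}$. (1) The Mordell--Weil group $D(\mathbb{Q})$ has rank $2$. It is generated by the point $P_1=(0,0)$ of order $2$ together with the points $P_2=(7,-49)$ and $P_3=(16,-104)$, which are independent (that is, linearly independent over $\mathbb{Z}$; in particular, of infinite order). (2) For a nonzero point $(z,w)$ of $D$ put $$ s = -21\,\frac{(z^2+196)(z^2+56z+196)+32(z+14)(z-14)w}{z^4-896z^3-24696z^2-175616z+38416}. $$ Then $s$ is a rational function of degree $4$ on $D$, that is, $[\mathbb{Q}(D):\mathbb{Q}(s)]=4$, and each $s\in\mathbb{Q}$ arises in this way from at most $4$ (in particular, from at most $16$) nonzero points $(z,w)\in D(\mathbb{Q})$. (3) There are infinitely many genus-$2$ curves over $\mathbb{Q}$, pairwise non-isomorphic over $\mathbb{Q}$, whose Jacobians have a $\mathbb{Q}$-rational point of order $48$. -/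

import Mathlib

open Polynomial

noncomputable section

/-! ## Places, divisors and principal divisors of a function field -/

/-- A place of the function field `F` over its field of constants `K`: a discrete valuation ring
with fraction field `F` that contains `K`. These are the closed points of the smooth projective
curve over `K` with function field `F`. -/
structure Place (K F : Type*) [Field K] [Field F] [Algebra K F] where
  ring : ValuationSubring F
  isDVR : IsDiscreteValuationRing ring
  const_mem : ∀ c : K, algebraMap K F c ∈ ring

namespace Place

variable {K F : Type*} [Field K] [Field F] [Algebra K F]

/-- The normalized discrete valuation at a place: the order of vanishing of `g` at `v`. -/
def ord (v : Place K F) (g : F) : ℤ :=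
  letI := v.isDVR;
  -WithZero.log ((IsDiscreteValuationRing.maximalIdeal v.ring).valuation F g)

theorem ord_one (v : Place K F) : v.ord 1 = 0 := by
  simp [ord]

theorem ord_mul (v : Place K F) {g h : F} (hg : g ≠ 0) (hh : h ≠ 0) :
    v.ord (g * h) = v.ord g + v.ord h := by
  have := v.isDVR
  unfold ord
  rw [map_mul, WithZero.log_mul (by simpa using hg) (by simpa using hh)]
  ring

theorem ord_inv (v : Place K F) (g : F) : v.ord g⁻¹ = - v.ord g := by
  have := v.isDVR
  unfold ord
  rw [map_inv₀, WithZero.log_inv]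

/-- The image of a place under an automorphism `σ` of `F` over a subfield `k` over which `K` is
algebraic: the valuation ring `σ(A) = {g | σ⁻¹ g ∈ A}`. -/
def map {k : Type*} [Field k] [Algebra k K] [Algebra k F] [IsScalarTower k K F]
    [Algebra.IsAlgebraic k K] (σ : F ≃ₐ[k] F) (v : Place K F) : Place K F where
  ring := v.ring.comap (σ.symm : F →+* F)
  isDVR := by
    have := v.isDVR
    let e : v.ring ≃+* v.ring.comap (σ.symm : F →+* F) :=
      { toFun := fun a => ⟨σ a, by simp [ValuationSubring.mem_comap]⟩
        invFun := fun a => ⟨σ.symm a, a.2⟩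
        left_inv := fun a => by simp
        right_inv := fun a => by simp
        map_mul' := fun a b => by ext; simp
        map_add' := fun a b => by ext; simp }
    exact IsDiscreteValuationRing.RingEquivClass.isDiscreteValuationRing e
  const_mem := by
    intro c
    rw [ValuationSubring.mem_comap]
    have hc : IsIntegral k c := Algebra.IsIntegral.isIntegral c
    have h2 : IsIntegral k (σ.symm (algebraMap K F c)) :=
      (hc.map (IsScalarTower.toAlgHom k K F)).map σ.symm
    obtain ⟨p, hp, hp0⟩ := h2
    let i : k →+* v.ring := (algebraMap k F).codRestrict v.ring.toSubring (fun a => by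
      rw [IsScalarTower.algebraMap_apply k K F]
      exact v.const_mem _)
    have h3 : IsIntegral v.ring (σ.symm (algebraMap K F c)) := by
      refine ⟨p.map i, hp.map i, ?_⟩
      rw [eval₂_map]
      exact hp0
    obtain ⟨y, hy⟩ := IsIntegrallyClosed.isIntegral_iff.mp h3
    have : σ.symm (algebraMap K F c) ∈ v.ring := by
      rw [← hy]
      exact y.2
    exact this

end Place

/-- Divisors: formal integral combinations of places. -/
abbrev Divisor (K F : Type*) [Field K] [Field F] [Algebra K F] := Place K F →₀ ℤ

namespace Divisor

/-- The degree of a divisor over an algebraically closed field `K` of constants (where all places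
have degree `1`): the sum of the coefficients. -/
def degree (K F : Type*) [Field K] [Field F] [Algebra K F] : Divisor K F →+ ℤ :=
  Finsupp.liftAddHom fun _ => AddMonoidHom.id ℤ

/-- The group of principal divisors: divisors of the form `∑ᵥ ordᵥ(g) v` with `g ∈ Fˣ`. -/
def principal (K F : Type*) [Field K] [Field F] [Algebra K F] : AddSubgroup (Divisor K F) where
  carrier := {D | ∃ g : F, g ≠ 0 ∧ ∀ v, D v = v.ord g}
  zero_mem' := ⟨1, one_ne_zero, fun v => by simp [Place.ord_one]⟩
  add_mem' := by
    rintro D E ⟨g, hg, hD⟩ ⟨h, hh, hE⟩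
    exact ⟨g * h, mul_ne_zero hg hh, fun v => by
      rw [Finsupp.add_apply, hD, hE, Place.ord_mul v hg hh]⟩
  neg_mem' := by
    rintro D ⟨g, hg, hD⟩
    exact ⟨g⁻¹, inv_ne_zero hg, fun v => by rw [Finsupp.neg_apply, hD, Place.ord_inv]⟩

/-- The action on divisors of an automorphism of the function field. -/
def map {k K F : Type*} [Field k] [Field K] [Field F] [Algebra K F] [Algebra k K] [Algebra k F]
    [IsScalarTower k K F] [Algebra.IsAlgebraic k K] (σ : F ≃ₐ[k] F) :
    Divisor K F →+ Divisor K F :=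
  Finsupp.mapDomain.addMonoidHom (Place.map σ)

end Divisor

/-! ## Curves of genus two and their Jacobians -/

/-- A curve of genus two over a field `k` of characteristic zero, given by a Weierstrass equation
`y² = f(x)` where `f` is a separable polynomial of degree `5` or `6`. The curve itself is the smooth
projective curve with this affine equation. -/
structure GenusTwoCurve (k : Type*) [Field k] [CharZero k] where
  f : k[X]
  separable : f.Separable
  degree : f.natDegree = 5 ∨ f.natDegree = 6

namespace GenusTwoCurve

variable {k : Type*} [Field k] [CharZero k] (C : GenusTwoCurve k)

/-- The base change of a curve to an extension field. -/
def baseChange (K : Type*) [Field K] [CharZero K] [Algebra k K] : GenusTwoCurve K where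
  f := C.f.map (algebraMap k K)
  separable := C.separable.map
  degree := by simpa using C.degree

/-- The polynomial `Y² - f(X)`. -/
def polynomial : k[X][X] := X ^ 2 - Polynomial.C C.f

theorem irreducible_polynomial : Irreducible C.polynomial := by
  have hm : C.polynomial.Monic := monic_X_pow_sub_C _ two_ne_zero
  have hd : C.polynomial.natDegree = 2 := natDegree_X_pow_sub_C
  rw [hm.irreducible_iff_roots_eq_zero_of_degree_le_three hd.ge (by omega)]
  refine Multiset.eq_zero_of_forall_notMem fun r hr => ?_
  have h0 : r ^ 2 = C.f := by
    have := (mem_roots'.mp hr).2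
    simpa [polynomial, sub_eq_zero] using this
  have hu : IsUnit r := C.separable.squarefree r ⟨1, by rw [← h0]; ring⟩
  have h1 : C.f.natDegree = 0 := by
    rw [← h0]
    exact natDegree_eq_zero_of_isUnit (hu.pow 2)
  rcases C.degree with h | h <;> omega

/-- The coordinate ring `k[x, y] / (y² - f(x))` of the affine curve. -/
abbrev CoordinateRing : Type _ := AdjoinRoot C.polynomial

instance : IsDomain C.CoordinateRing :=
  AdjoinRoot.isDomain_of_prime C.irreducible_polynomial.prime

/-- The function field `k(C)`. -/
abbrev FunctionField : Type _ := FractionRing C.CoordinateRing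

/-- The function `x` on the curve. -/
def x : C.FunctionField :=
  algebraMap C.CoordinateRing C.FunctionField (AdjoinRoot.of C.polynomial X)

/-- The function `y` on the curve. -/
def y : C.FunctionField :=
  algebraMap C.CoordinateRing C.FunctionField (AdjoinRoot.root C.polynomial)

/-- Two curves over `k` are isomorphic over `k` if and only if their function fields are isomorphic
as extensions of `k`. -/
def IsIsomorphic (C C' : GenusTwoCurve k) : Prop :=
  Nonempty (C.FunctionField ≃ₐ[k] C'.FunctionField)

/-- The curve over the algebraic closure of `k`. -/
abbrev geometric : GenusTwoCurve (AlgebraicClosure k) := C.baseChange (AlgebraicClosure k)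

/-- The function field `k̄(C)` of the curve over the algebraic closure. -/
abbrev GeometricFunctionField : Type _ := C.geometric.FunctionField

/-- The absolute Galois group of `k`, acting on `k̄(C)`: the automorphisms of `k̄(C)` over
`k` that fix the coordinate functions `x` and `y`, and hence act through their action on `k̄`. -/
def galois : Subgroup (C.GeometricFunctionField ≃ₐ[k] C.GeometricFunctionField) where
  carrier := {σ | σ C.geometric.x = C.geometric.x ∧ σ C.geometric.y = C.geometric.y}
  one_mem' := ⟨rfl, rfl⟩
  mul_mem' := by
    rintro σ τ ⟨h1, h2⟩ ⟨h3, h4⟩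
    exact ⟨by rw [AlgEquiv.mul_apply, h3, h1], by rw [AlgEquiv.mul_apply, h4, h2]⟩
  inv_mem' := by
    rintro σ ⟨h1, h2⟩
    exact ⟨(σ.symm_apply_eq).mpr h1.symm, (σ.symm_apply_eq).mpr h2.symm⟩

/-- Divisors on the curve over the algebraic closure. -/
abbrev GeometricDivisor : Type _ := Divisor (AlgebraicClosure k) C.GeometricFunctionField

/-- The group of principal divisors on the curve over the algebraic closure. -/
abbrev principalDivisors : AddSubgroup C.GeometricDivisor :=
  Divisor.principal (AlgebraicClosure k) C.GeometricFunctionField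

/-- The divisors of degree zero over the algebraic closure whose linear equivalence class is
invariant under the Galois group. -/
def rationalClassDivisors : AddSubgroup C.GeometricDivisor where
  carrier := {D | Divisor.degree (AlgebraicClosure k) C.GeometricFunctionField D = 0 ∧
    ∀ σ ∈ C.galois, Divisor.map σ D - D ∈ C.principalDivisors}
  zero_mem' := ⟨map_zero _, fun σ _ => by
    rw [map_zero, sub_zero]
    exact zero_mem _⟩
  add_mem' := by
    rintro D E ⟨h1, h2⟩ ⟨h3, h4⟩
    refine ⟨by rw [map_add, h1, h3, add_zero], fun σ hσ => ?_⟩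
    rw [map_add, add_sub_add_comm]
    exact add_mem (h2 σ hσ) (h4 σ hσ)
  neg_mem' := by
    rintro D ⟨h1, h2⟩
    refine ⟨by rw [map_neg, h1, neg_zero], fun σ hσ => ?_⟩
    rw [map_neg, neg_sub_neg, ← neg_sub]
    exact neg_mem (h2 σ hσ)

/-- The group `J(k)` of `k`-rational points of the Jacobian `J` of the curve, namely the group
`Pic⁰(C over k̄)^{Gal(k̄/k)}` of Galois-invariant divisor classes of degree zero. -/
abbrev JacobianPoints : Type _ :=
  C.rationalClassDivisors ⧸ C.principalDivisors.addSubgroupOf C.rationalClassDivisors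

end GenusTwoCurve

/-! ## The elliptic curve `D` and the function `s` on it -/

/-- The elliptic curve `D : y² = x³ + 14 x² + 196 x` over `ℚ`. -/
def curveD : WeierstrassCurve.Affine ℚ := ⟨0, 14, 0, 196, 0⟩

/-- The point `P₁ = (0, 0)` of `D`. -/
def pointP1 : curveD.Point := .some 0 0 (by
  rw [WeierstrassCurve.Affine.nonsingular_iff, WeierstrassCurve.Affine.equation_iff]
  norm_num [curveD])

/-- The point `P₂ = (7, -49)` of `D`. -/
def pointP2 : curveD.Point := .some 7 (-49) (by
  rw [WeierstrassCurve.Affine.nonsingular_iff, WeierstrassCurve.Affine.equation_iff]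
  norm_num [curveD])

/-- The point `P₃ = (16, -104)` of `D`. -/
def pointP3 : curveD.Point := .some 16 (-104) (by
  rw [WeierstrassCurve.Affine.nonsingular_iff, WeierstrassCurve.Affine.equation_iff]
  norm_num [curveD])

/-- The denominator in the formula for `s`. -/
def sDen {F : Type*} [Field F] (z : F) : F :=
  z ^ 4 - 896 * z ^ 3 - 24696 * z ^ 2 - 175616 * z + 38416

/-- The expression for `s` in terms of the coordinates `(z, w)` of a nonzero point of `D`. -/
def sExpr {F : Type*} [Field F] (z w : F) : F :=
  -21 * (((z ^ 2 + 196) * (z ^ 2 + 56 * z + 196) + 32 * (z + 14) * (z - 14) * w) / sDen z)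

/-- The rational function `s` on `D`, as an element of the function field `ℚ(D)`. -/
def sFunction : curveD.FunctionField :=
  sExpr
    (algebraMap curveD.CoordinateRing curveD.FunctionField
      (WeierstrassCurve.Affine.CoordinateRing.mk curveD (Polynomial.C X)))
    (algebraMap curveD.CoordinateRing curveD.FunctionField
      (WeierstrassCurve.Affine.CoordinateRing.mk curveD X))

/-- The nonzero points `(z, w)` of `D(ℚ)` from which the value `s` arises. -/
def sFiber (s : ℚ) : Set curveD.Point :=
  {P | ∃ (z w : ℚ) (h : curveD.Nonsingular z w), P = .some z w h ∧ sDen z ≠ 0 ∧ s = sExpr z w}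

end

open Polynomial

noncomputable section

/-! ### Places of a function field: orders, zeros and poles. -/

namespace Place

variable {K F : Type*} [Field K] [Field F] [Algebra K F]

/-! The three claims are proved independently of one another.

Claim (1) is a 2-descent done by hand. With ω² + ω + 1 = 0 the cubic is x · N(x - 14ω), and `delta`,
sending P to x(P) - 14ω modulo squares of ℚ(ω), is a homomorphism (`isSquare_delta_add`) whose
kernel is 2D(ℚ) (`exists_add_self_of_isSquare`). Divisibility arguments in ℕ show that its image is
generated by the classes of P₁, P₂, P₃ (`exists_isSquare`). Explicit height inequalities make the
descent terminate: when P has height at least 8, one of P + T, P - T becomes 2R after possibly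
adding P₁, with T among four fixed representatives and R of smaller height than P
(`closure_eq_top`). Points of height below 8 are found by enumeration. Independence is also read off
from `delta`: an integral relation with an odd coefficient would make a nonsquare a square, and an
even relation can be halved (`eq_zero_of_zsmul_add_zsmul`).

Claim (2): put τ = z/14 + 14/z. Eliminating w from the definition of s gives an equation that is
quadratic in s and quadratic in τ (`quartic_of_eq_sExpr`). Comparing the towers ℚ(τ) ⊂ ℚ(z) ⊂ ℚ(z,
w) and ℚ(τ) ⊂ ℚ(s, τ) ⊃ ℚ(s), all of whose steps are quadratic, yields degree 4
(`finrank_adjoin_sExpr`). In z the same equation has degree at most 4, and z and s together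
determine w, which bounds the fibres.

Claim (3): a Galois-fixed function h on the curve with divisor nD, not a p-th power for any prime p
dividing n, gives a rational class of order exactly n (`exists_addOrderOf_eq`). This rests on the
facts that a function has as many zeros as poles and that a function without zeros and poles is
constant, obtained here from ramification theory over K[t]. The sextics are f = Z(Z + 256)(Z + 81)
with Z quadratic in x, so (Z(x), y) maps the curve to the elliptic curve Y² = Z(Z + 256)(Z + 81), on
which (864, 30240) has order 8. An identity f = G² + κ(Z - 864)Q² makes the pullback of this point
divisible by 2, which gives order 16 (`sixteen_dvd_ord`); an identity f = g² + cℓ³ gives order 3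
(`three_dvd_ord`). Both identities hold along a family parametrised by the genus one curve 5V² = (v²
+ 6)(v² - 2), which has infinitely many rational points by repeated doubling on an elliptic curve
(`infinite_isFamilyParameter`). An isomorphism between two members acts on the roots of the sextics
by a Möbius map, hence preserves cross ratios, and this leaves only finitely many members in each
isomorphism class (`finite_isIsomorphic`). -/

theorem valuation_le_one_iff (v : Place K F) (g : F) :
    letI := v.isDVR
    (IsDiscreteValuationRing.maximalIdeal v.ring).valuation F g ≤ 1 ↔ g ∈ v.ring := by
  have := v.isDVR
  constructor
  · intro h
    obtain ⟨a, rfl⟩ := IsDiscreteValuationRing.exists_lift_of_le_one h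
    exact a.2
  · intro h
    exact IsDedekindDomain.HeightOneSpectrum.valuation_le_one _ (⟨g, h⟩ : v.ring)

theorem ord_zero (v : Place K F) : v.ord 0 = 0 := by
  simp [ord]

theorem ord_nonneg_iff (v : Place K F) {g : F} (hg : g ≠ 0) : 0 ≤ v.ord g ↔ g ∈ v.ring := by
  have := v.isDVR
  rw [← v.valuation_le_one_iff]
  unfold ord
  rw [neg_nonneg, WithZero.log_le_iff_le_exp (by simpa using hg), WithZero.exp_zero]

theorem exists_ord_eq_one (v : Place K F) : ∃ g : F, g ≠ 0 ∧ v.ord g = 1 := by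
  have := v.isDVR
  obtain ⟨π, hπ⟩ := (IsDiscreteValuationRing.maximalIdeal v.ring).valuation_exists_uniformizer F
  refine ⟨π, ?_, ?_⟩
  · rintro rfl
    exact WithZero.exp_ne_zero (hπ.symm.trans (map_zero _))
  · unfold ord
    rw [hπ]
    simp

theorem ord_div (v : Place K F) {g h : F} (hg : g ≠ 0) (hh : h ≠ 0) :
    v.ord (g / h) = v.ord g - v.ord h := by
  rw [div_eq_mul_inv, ord_mul v hg (inv_ne_zero hh), ord_inv, sub_eq_add_neg]

theorem ord_pow (v : Place K F) {g : F} (hg : g ≠ 0) (n : ℕ) : v.ord (g ^ n) = n * v.ord g := by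
  induction n with
  | zero => simp [ord_one]
  | succ n ih => rw [pow_succ, ord_mul v (pow_ne_zero n hg) hg, ih]; push_cast; ring

theorem ord_zpow (v : Place K F) {g : F} (hg : g ≠ 0) (n : ℤ) : v.ord (g ^ n) = n * v.ord g := by
  obtain ⟨m, rfl | rfl⟩ := n.eq_nat_or_neg
  · simp [ord_pow v hg]
  · simp [ord_pow v hg, ord_inv]

theorem ord_algebraMap (v : Place K F) (c : K) : v.ord (algebraMap K F c) = 0 := by
  by_cases hc : c = 0
  · simp [hc, ord_zero]
  have h0 : algebraMap K F c ≠ 0 := by simpa using hc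
  have h1 := (v.ord_nonneg_iff h0).2 (v.const_mem c)
  have h2 := (v.ord_nonneg_iff (inv_ne_zero h0)).2 (by rw [← map_inv₀]; exact v.const_mem _)
  rw [ord_inv] at h2
  omega

theorem ord_neg (v : Place K F) (g : F) : v.ord (-g) = v.ord g := by
  have := v.isDVR
  unfold ord
  rw [Valuation.map_neg]

theorem ord_pos_iff (v : Place K F) {g : F} (hg : g ≠ 0) :
    0 < v.ord g ↔ v.ring.valuation g < 1 := by
  rw [← ValuationSubring.mem_nonunits_iff, ValuationSubring.mem_nonunits_iff_or,
    ← v.ord_nonneg_iff (inv_ne_zero hg), ord_inv]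
  simp only [hg, false_or]
  omega

theorem ord_eq_zero_iff (v : Place K F) {g : F} (hg : g ≠ 0) :
    v.ord g = 0 ↔ v.ring.valuation g = 1 := by
  have h1 := v.ord_pos_iff hg
  have h2 := v.ord_nonneg_iff hg
  rw [← ValuationSubring.valuation_le_one_iff] at h2
  rw [le_antisymm_iff, eq_iff_le_not_lt, ← h1, ← h2]
  constructor
  · rintro ⟨h3, h4⟩; exact ⟨h4, by omega⟩
  · rintro ⟨h3, h4⟩; exact ⟨by omega, h3⟩

theorem min_ord_le_ord_add (v : Place K F) {g h : F} (hg : g ≠ 0) (hh : h ≠ 0)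
    (hgh : g + h ≠ 0) : min (v.ord g) (v.ord h) ≤ v.ord (g + h) := by
  wlog hle : v.ord g ≤ v.ord h generalizing g h
  · rw [min_comm, add_comm]
    exact this hh hg (by rwa [add_comm]) (by omega)
  rw [min_eq_left hle]
  have h1 : h / g ∈ v.ring := by
    rw [← v.ord_nonneg_iff (div_ne_zero hh hg), v.ord_div hh hg]
    omega
  have h2 : g + h = g * (1 + h / g) := by field_simp
  have h3 : 1 + h / g ≠ 0 := by
    intro h3
    rw [h2, h3, mul_zero] at hgh
    exact hgh rfl
  have h4 := (v.ord_nonneg_iff h3).2 (add_mem v.ring.one_mem h1)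
  rw [h2, v.ord_mul hg h3]
  omega

/-- The normalized valuation of a place is determined by its valuation ring. -/
theorem ord_eq_neg_log (v : Place K F) (w : Valuation F (WithZero (Multiplicative ℤ)))
    (hw : Function.Surjective w) (h : ∀ g, w g ≤ 1 ↔ g ∈ v.ring) (g : F) :
    v.ord g = - WithZero.log (w g) := by
  by_cases hg : g = 0
  · simp [hg, ord_zero]
  obtain ⟨π, hπ⟩ := hw (WithZero.exp (-1))
  have hπ0 : π ≠ 0 := by
    rintro rfl
    exact WithZero.exp_ne_zero (hπ.symm.trans (map_zero _))
  have key : ∀ u : F, u ≠ 0 → w u = 1 → v.ord u = 0 := by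
    intro u hu h1
    have h2 := (v.ord_nonneg_iff hu).2 ((h u).1 h1.le)
    have h3 := (v.ord_nonneg_iff (inv_ne_zero hu)).2 ((h _).1 (by simp [h1]))
    rw [ord_inv] at h3
    omega
  -- Scaling by powers of π reduces to units of `w`, so the order is a fixed multiple of the
  -- `w`-valuation. Testing on an element of order 1 then forces the factor to be 1.
  have key2 : ∀ g : F, g ≠ 0 → v.ord g = - WithZero.log (w g) * v.ord π := by
    intro g hg
    set n := WithZero.log (w g) with hn
    have h0 : w g ≠ 0 := by simpa using hg
    have h1 : w (g * π ^ n) = 1 := by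
      rw [map_mul, map_zpow₀, hπ, ← WithZero.exp_log h0, ← hn, ← WithZero.exp_zsmul,
        ← WithZero.exp_add]
      simp
    have h2 := key _ (mul_ne_zero hg (zpow_ne_zero n hπ0)) h1
    rw [v.ord_mul hg (zpow_ne_zero n hπ0), v.ord_zpow hπ0] at h2
    linarith
  obtain ⟨τ, hτ0, hτ⟩ := v.exists_ord_eq_one
  have h1 := key2 τ hτ0
  have h2 : 0 ≤ v.ord π := (v.ord_nonneg_iff hπ0).2 ((h π).1 (by
    rw [hπ, ← WithZero.exp_zero, WithZero.exp_le_exp]; norm_num))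
  rw [hτ] at h1
  have h3 : v.ord π = 1 := Int.eq_one_of_mul_eq_one_left h2 h1.symm
  rw [key2 g hg, h3, mul_one]

theorem ext_ring {v w : Place K F} (h : v.ring = w.ring) : v = w := by
  cases v; cases w; cases h; rfl

/-- Valuation rings of places are maximal proper subrings. -/
theorem eq_of_ring_le {v w : Place K F} (h : v.ring ≤ w.ring) : v = w := by
  have hpos : ∀ g : F, g ≠ 0 → 0 < w.ord g → 0 < v.ord g := by
    intro g hg h1
    by_contra h2
    have h3 := (w.ord_nonneg_iff (inv_ne_zero hg)).2 (h ((v.ord_nonneg_iff (inv_ne_zero hg)).1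
      (by rw [ord_inv]; omega)))
    rw [ord_inv] at h3
    omega
  refine ext_ring (le_antisymm h fun g hg => ?_)
  by_cases hg0 : g = 0
  · rw [hg0]; exact v.ring.zero_mem
  rw [← v.ord_nonneg_iff hg0]
  obtain ⟨π, hπ0, hπ⟩ := w.exists_ord_eq_one
  have hg1 := (w.ord_nonneg_iff hg0).2 hg
  have h5 := hpos π hπ0 (by omega)
  by_contra hneg
  -- If g had a pole at v, the power n = ord_v(π) would make gⁿπ of order at most 0 at v, although
  -- it has positive order at w.
  have h6 := hpos (g ^ (v.ord π).toNat * π) (mul_ne_zero (pow_ne_zero _ hg0) hπ0) (by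
    rw [w.ord_mul (pow_ne_zero _ hg0) hπ0, w.ord_pow hg0, hπ]; positivity)
  rw [v.ord_mul (pow_ne_zero _ hg0) hπ0, v.ord_pow hg0, Int.toNat_of_nonneg h5.le] at h6
  nlinarith

/-- The place attached to a nonzero prime ideal of a Dedekind domain `B` containing the constants,
with fraction field `F`. -/
def ofPrime {B : Type*} [CommRing B] [IsDedekindDomain B] [Algebra B F] [IsFractionRing B F]
    [Algebra K B] [IsScalarTower K B F] (P : IsDedekindDomain.HeightOneSpectrum B) :
    Place K F where
  ring := (P.valuation F).valuationSubring
  isDVR := by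
    rw [← IsDedekindDomain.HeightOneSpectrum.valuationSubringAtPrime_eq_valuationSubring]
    exact IsLocalization.AtPrime.isDiscreteValuationRing_of_dedekind_domain B P.ne_bot _
  const_mem c := by
    rw [IsScalarTower.algebraMap_apply K B F]
    exact P.valuation_le_one _

theorem ord_ofPrime {B : Type*} [CommRing B] [IsDedekindDomain B] [Algebra B F]
    [IsFractionRing B F] [Algebra K B] [IsScalarTower K B F]
    (P : IsDedekindDomain.HeightOneSpectrum B) (g : F) :
    (ofPrime (K := K) (F := F) P).ord g = - WithZero.log (P.valuation F g) :=
  ord_eq_neg_log _ _ (P.valuation_surjective F) (fun _ => Iff.rfl) g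

theorem ofPrime_injective {B : Type*} [CommRing B] [IsDedekindDomain B] [Algebra B F]
    [IsFractionRing B F] [Algebra K B] [IsScalarTower K B F] :
    Function.Injective (ofPrime (K := K) (F := F) (B := B)) := by
  intro P Q h
  apply IsDedekindDomain.HeightOneSpectrum.eq_of_valuation_isEquiv_valuation (K := F)
  rw [Valuation.isEquiv_iff_valuationSubring]
  exact congrArg Place.ring h

/-- A place whose valuation ring contains `B` comes from a prime ideal of `B`. -/
theorem exists_ofPrime_eq {B : Type*} [CommRing B] [IsDedekindDomain B] [Algebra B F]
    [IsFractionRing B F] [Algebra K B] [IsScalarTower K B F] (v : Place K F)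
    (hB : ∀ b : B, algebraMap B F b ∈ v.ring) :
    ∃ P : IsDedekindDomain.HeightOneSpectrum B, ofPrime P = v ∧
      ∀ b : B, b ∈ P.asIdeal ↔ v.ring.valuation (algebraMap B F b) < 1 := by
  let i : B →+* v.ring := (algebraMap B F).codRestrict v.ring.toSubring hB
  let I : Ideal B := (IsLocalRing.maximalIdeal v.ring).comap i
  have hI : ∀ b : B, b ∈ I ↔ v.ring.valuation (algebraMap B F b) < 1 := fun b => by
    rw [Ideal.mem_comap, ValuationSubring.valuation_lt_one_iff]
    rfl
  -- If the centre were zero, every nonzero element of B would be a unit at v, and the order would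
  -- vanish on the whole fraction field.
  have hne : I ≠ ⊥ := by
    intro hbot
    obtain ⟨π, hπ0, hπ⟩ := v.exists_ord_eq_one
    obtain ⟨a, b, hb, rfl⟩ := IsFractionRing.div_surjective (A := B) π
    have ha0 : a ≠ 0 := by rintro rfl; simp at hπ0
    have hb0 : b ≠ 0 := nonZeroDivisors.ne_zero hb
    have key : ∀ c : B, c ≠ 0 → v.ord (algebraMap B F c) = 0 := by
      intro c hc
      have hc' : algebraMap B F c ≠ 0 := by simpa using hc
      have h1 := (v.ord_nonneg_iff hc').2 (hB c)
      have h2 : ¬ 0 < v.ord (algebraMap B F c) := by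
        rw [v.ord_pos_iff hc', ← hI, hbot]
        simpa using hc
      omega
    rw [v.ord_div (by simpa using ha0) (by simpa using hb0), key a ha0, key b hb0] at hπ
    omega
  refine ⟨⟨I, Ideal.IsPrime.comap i, hne⟩, ?_, hI⟩
  refine eq_of_ring_le fun g hg => ?_
  obtain ⟨n, d, hnd⟩ :=
    IsDedekindDomain.HeightOneSpectrum.exists_primeCompl_mul_eq_of_integer _ g hg
  have hd : v.ring.valuation (algebraMap B F d) = 1 := by
    have h1 : ¬ _ := mt (hI (d : B)).2 d.2
    exact le_antisymm ((v.ring.valuation_le_one_iff _).2 (hB _)) (not_lt.1 h1)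
  rw [← ValuationSubring.valuation_le_one_iff]
  have h2 := (v.ring.valuation_le_one_iff _).2 (hB n)
  rwa [← hnd, map_mul, hd, mul_one] at h2

set_option linter.deprecated false in
/-- Zeros of `a` counted with multiplicity: the fundamental identity for the prime `(a)`. -/
theorem exists_zeros_of_integralClosure [IsAlgClosed K] (A L B : Type*) [CommRing A]
    [IsDedekindDomain A] [Field L] [Algebra A L] [IsFractionRing A L] [Algebra L F] [Algebra A F]
    [IsScalarTower A L F] [CommRing B] [IsDedekindDomain B] [Algebra A B] [Algebra B F]
    [IsScalarTower A B F] [IsFractionRing B F] [Module.Finite A B] [IsIntegralClosure B A F]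
    [Algebra K A] [Algebra K B] [IsScalarTower K A B] [IsScalarTower K B F]
    [IsScalarTower K A F]
    (a : A) (ha : a ≠ 0) [hp : (Ideal.span {a}).IsMaximal]
    (hA : ∀ v : Place K F, 0 < v.ord (algebraMap A F a) → ∀ x : A, algebraMap A F x ∈ v.ring) 
    (hres : ∀ x : A, ∃ c : K, x - algebraMap K A c ∈ Ideal.span {a}) :
    ∃ s : Finset (Place K F), (∀ v, v ∈ s ↔ 0 < v.ord (algebraMap A F a)) ∧
      ∑ v ∈ s, v.ord (algebraMap A F a) = Module.finrank L F := by
  classical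
  have hAF : Function.Injective (algebraMap A F) := by
    rw [IsScalarTower.algebraMap_eq A L F]
    exact (algebraMap L F).injective.comp (IsFractionRing.injective A L)
  have hAB : Function.Injective (algebraMap A B) := by
    rw [IsScalarTower.algebraMap_eq A B F] at hAF
    exact Function.Injective.of_comp hAF
  have : FaithfulSMul A B := (faithfulSMul_iff_algebraMap_injective A B).2 hAB
  have : Module.IsTorsionFree A B := inferInstance
  set p : Ideal A := Ideal.span {a} with hpdef
  have hp0 : p ≠ ⊥ := by simpa [hpdef] using ha
  have hmap : p.map (algebraMap A B) = Ideal.span {algebraMap A B a} := by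
    rw [hpdef, Ideal.map_span, Set.image_singleton]
  have hB0 : algebraMap A B a ≠ 0 := by simpa using (map_ne_zero_iff _ hAB).2 ha
  have haF : algebraMap A F a ≠ 0 := (map_ne_zero_iff _ hAF).2 ha
  have key := Ideal.sum_ramification_inertia B L F hp0
  have hprime : ∀ P ∈ IsDedekindDomain.primesOverFinset p B, P.IsPrime ∧ P.LiesOver p := fun P hP =>
    (IsDedekindDomain.mem_primesOverFinset_iff hp0 _).1 hP
  have hbot : ∀ P ∈ IsDedekindDomain.primesOverFinset p B, P ≠ ⊥ := by
    intro P hP hPb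
    have := (hprime P hP).2
    have h1 : a ∈ p := Ideal.mem_span_singleton_self a
    rw [Ideal.mem_of_liesOver P p, hPb, Ideal.mem_bot] at h1
    exact hB0 h1
  let toH : {P // P ∈ IsDedekindDomain.primesOverFinset p B} →
      IsDedekindDomain.HeightOneSpectrum B :=
    fun P => ⟨P.1, (hprime P.1 P.2).1, hbot P.1 P.2⟩
  have htoH : Function.Injective fun P => ofPrime (K := K) (F := F) (toH P) := by
    intro P Q h
    have := ofPrime_injective h
    exact Subtype.ext (congrArg IsDedekindDomain.HeightOneSpectrum.asIdeal this)
  refine ⟨(IsDedekindDomain.primesOverFinset p B).attach.image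
    fun P => ofPrime (K := K) (F := F) (toH P), fun v => ?_, ?_⟩
  · simp only [Finset.mem_image, Finset.mem_attach, true_and]
    constructor
    · rintro ⟨P, rfl⟩
      rw [ord_ofPrime, IsScalarTower.algebraMap_apply A B F]
      have := (hprime P.1 P.2).2
      have h1 : algebraMap A B a ∈ (toH P).asIdeal := by
        change algebraMap A B a ∈ P.1
        rw [← Ideal.mem_of_liesOver P.1 p]
        exact Ideal.mem_span_singleton_self a
      have h2 := ((toH P).valuation_lt_one_iff_mem (K := F) _).2 h1
      rw [← WithZero.exp_zero, ← WithZero.log_lt_iff_lt_exp (by simpa using hB0)] at h2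
      simpa using h2
    · intro hv
      -- A zero of a contains A in its ring, and valuation rings are integrally closed, so it
      -- contains the integral closure as well and comes from a prime of B over (a).
      have hBv : ∀ b : B, algebraMap B F b ∈ v.ring := by
        intro b
        let i : A →+* v.ring := (algebraMap A F).codRestrict v.ring.toSubring (hA v hv)
        have hb : IsIntegral A (algebraMap B F b) :=
          (IsIntegralClosure.isIntegral_iff (A := B)).2 ⟨b, rfl⟩
        obtain ⟨f, hf, hf0⟩ := hb
        have h3 : IsIntegral v.ring (algebraMap B F b) := by
          refine ⟨f.map i, hf.map i, ?_⟩
          rw [eval₂_map]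
          exact hf0
        obtain ⟨y, hy⟩ := IsIntegrallyClosed.isIntegral_iff.mp h3
        rw [← hy]
        exact y.2
      obtain ⟨P, hPv, hP⟩ := v.exists_ofPrime_eq hBv
      have haP : algebraMap A B a ∈ P.asIdeal := by
        rw [hP, ← IsScalarTower.algebraMap_apply, ← v.ord_pos_iff haF]
        exact hv
      have hlo : P.asIdeal.LiesOver p := by
        refine ⟨hp.eq_of_le (Ideal.IsPrime.ne_top (Ideal.IsPrime.under A P.asIdeal)) ?_⟩
        rw [hpdef, Ideal.span_singleton_le_iff_mem, Ideal.mem_comap]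
        exact haP
      exact ⟨⟨P.asIdeal, (IsDedekindDomain.mem_primesOverFinset_iff hp0 _).2 ⟨P.isPrime, hlo⟩⟩,
        hPv⟩
  · rw [Finset.sum_image fun P _ Q _ h => htoH h, ← key, Nat.cast_sum,
      ← Finset.sum_attach (IsDedekindDomain.primesOverFinset p B)]
    refine Finset.sum_congr rfl fun P _ => ?_
    have hPo := (hprime P.1 P.2).2
    have hPp := (hprime P.1 P.2).1
    -- Both residue fields are algebraic over the algebraically closed K, hence equal to K; only
    -- ramification remains in the fundamental identity.
    have hine : p.inertiaDeg' P.1 = 1 := by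
      rw [Ideal.inertiaDeg'_algebraMap]
      have : Nontrivial (B ⧸ P.1) := Ideal.Quotient.nontrivial_iff.2 hPp.ne_top
      let _ : Field (A ⧸ p) := Ideal.Quotient.field p
      have hsurj : Function.Surjective (algebraMap K (A ⧸ p)) := by
        intro x
        obtain ⟨x, rfl⟩ := Ideal.Quotient.mk_surjective x
        obtain ⟨c, hc⟩ := hres x
        exact ⟨c, ((Ideal.Quotient.eq).2 hc).symm⟩
      have : Algebra.IsIntegral K (A ⧸ p) :=
        ⟨fun x => (hsurj x).choose_spec ▸ isIntegral_algebraMap⟩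
      have : Algebra.IsIntegral K (B ⧸ P.1) := Algebra.IsIntegral.trans (A ⧸ p)
      have hbij : Function.Bijective (algebraMap (A ⧸ p) (B ⧸ P.1)) := by
        refine ⟨(algebraMap (A ⧸ p) (B ⧸ P.1)).injective, ?_⟩
        have h4 := (IsAlgClosed.algebraMap_bijective_of_isIntegral (k := K) (K := B ⧸ P.1)).2
        rw [IsScalarTower.algebraMap_eq K (A ⧸ p)] at h4
        exact Function.Surjective.of_comp (g := algebraMap K (A ⧸ p)) h4
      have e := LinearEquiv.ofBijective (Algebra.linearMap (A ⧸ p) (B ⧸ P.1)) hbij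
      rw [← e.finrank_eq, Module.finrank_self]
    rw [hine, mul_one, ord_ofPrime, IsScalarTower.algebraMap_apply A B F,
      IsDedekindDomain.HeightOneSpectrum.valuation_of_algebraMap,
      IsDedekindDomain.HeightOneSpectrum.intValuation_eq_exp_neg_multiplicity _ hB0,
      WithZero.log_exp, neg_neg,
      Ideal.IsDedekindDomain.ramificationIdx'_eq_multiplicity (by rw [hmap]; simpa using hB0) hPp, hmap]

open IntermediateField IntermediateField.algebraAdjoinAdjoin in
/-- The number of zeros of `t`, counted with multiplicity, is `[F : K(t)]`. -/
theorem exists_zeros [IsAlgClosed K] [CharZero K] (t : F) (ht : Transcendental K t)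
    [FiniteDimensional K⟮t⟯ F] :
    ∃ s : Finset (Place K F), (∀ v, v ∈ s ↔ 0 < v.ord t) ∧
      ∑ v ∈ s, v.ord t = Module.finrank K⟮t⟯ F := by
  let A := Algebra.adjoin K {t}
  let e : K[X] ≃ₐ[K] A := (AlgEquiv.ofInjective (aeval t) (transcendental_iff_injective.1 ht)).trans
    (Subalgebra.equivOfEq _ _ (Algebra.adjoin_singleton_eq_range_aeval K t).symm)
  have heX : ((e X : A) : F) = t := by simp [e]
  have hPIR : IsPrincipalIdealRing A := IsPrincipalIdealRing.of_surjective e e.surjective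
  have hDed : IsDedekindDomain A := inferInstance
  have : CharZero F := charZero_of_injective_algebraMap (algebraMap K F).injective
  let B := integralClosure A F
  have : CharZero K⟮t⟯ := inferInstance
  have : Algebra.IsSeparable K⟮t⟯ F := inferInstance
  have : IsDedekindDomain B := integralClosure.isDedekindDomain A K⟮t⟯ F
  have : IsFractionRing B F := integralClosure.isFractionRing_of_finite_extension K⟮t⟯ F
  have : Module.Finite A B := IsIntegralClosure.finite A K⟮t⟯ F B
  have hres : ∀ x : A, ∃ c : K, x - algebraMap K A c ∈ Ideal.span {e X} := by
    intro x
    obtain ⟨f, rfl⟩ := e.surjective x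
    refine ⟨f.coeff 0, ?_⟩
    rw [Ideal.mem_span_singleton, ← e.commutes, ← map_sub]
    refine map_dvd e ?_
    rw [X_dvd_iff]
    simp
  have hne : Ideal.span {e X} ≠ ⊤ := by
    rw [Ne, Ideal.span_singleton_eq_top, MulEquiv.isUnit_map]
    exact not_isUnit_X
  have hmax : (Ideal.span {e X}).IsMaximal := by
    have hs : Function.Surjective (algebraMap K (A ⧸ Ideal.span {e X})) := by
      intro x
      obtain ⟨x, rfl⟩ := Ideal.Quotient.mk_surjective x
      obtain ⟨c, hc⟩ := hres x
      exact ⟨c, ((Ideal.Quotient.eq).2 hc).symm⟩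
    have : Nontrivial (A ⧸ Ideal.span {e X}) := Ideal.Quotient.nontrivial_iff.2 hne
    apply Ideal.Quotient.maximal_of_isField
    exact MulEquiv.isField (Field.toIsField K)
      (RingEquiv.ofBijective _ ⟨(algebraMap K (A ⧸ Ideal.span {e X})).injective, hs⟩).symm.toMulEquiv
  have h := exists_zeros_of_integralClosure (K := K) (F := F) A K⟮t⟯ B (e X)
    (by simp) (fun v hv x => by
      have hv' : 0 < v.ord t := by rw [← heX]; exact hv
      have ht0 : t ≠ 0 := fun h0 => by rw [h0, ord_zero] at hv'; omega
      have hle : A ≤ { v.ring.toSubring with algebraMap_mem' := v.const_mem } := by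
        refine Algebra.adjoin_le ?_
        rw [Set.singleton_subset_iff]
        exact (v.ord_nonneg_iff ht0).1 hv'.le
      exact hle x.2) hres
  have h2 : algebraMap A F (e X) = t := heX
  rwa [h2] at h

open IntermediateField in
/-- A nonconstant element has finitely many zeros and poles, as many zeros as poles, and at least
one zero. -/
theorem exists_support [IsAlgClosed K] [CharZero K]
    (hF : ∀ t : F, Transcendental K t → FiniteDimensional K⟮t⟯ F) (t : F)
    (ht : Transcendental K t) :
    (∃ s : Finset (Place K F), (∀ v, v ∈ s ↔ v.ord t ≠ 0) ∧ ∑ v ∈ s, v.ord t = 0) ∧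
      ∃ v : Place K F, 0 < v.ord t := by
  classical
  have := hF t ht
  have ht0 : t ≠ 0 := by rintro rfl; exact ht (isAlgebraic_zero)
  have hinv : Transcendental K t⁻¹ := fun h => ht (by simpa using h.inv)
  have := hF _ hinv
  -- Poles of t are zeros of t⁻¹, so the counts of zeros and of poles are degrees over one and the
  -- same subfield.
  have heq : K⟮t⁻¹⟯ = K⟮t⟯ := by
    apply le_antisymm <;> rw [adjoin_simple_le_iff]
    · exact inv_mem (mem_adjoin_simple_self K t)
    · simpa using inv_mem (mem_adjoin_simple_self K t⁻¹)
  obtain ⟨s₁, h1, h2⟩ := exists_zeros t ht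
  obtain ⟨s₂, h3, h4⟩ := exists_zeros t⁻¹ hinv
  rw [heq] at h4
  simp only [ord_inv] at h3 h4
  refine ⟨⟨s₁ ∪ s₂, fun v => ?_, ?_⟩, ?_⟩
  · rw [Finset.mem_union, h1, h3]
    omega
  · rw [Finset.sum_union, h2, ← h4, Finset.sum_neg_distrib]
    · ring
    · rw [Finset.disjoint_left]
      intro v hv hv'
      rw [h1] at hv
      rw [h3] at hv'
      omega
  · by_contra! hcon
    have : s₁ = ∅ := by
      rw [Finset.eq_empty_iff_forall_notMem]
      intro v hv
      rw [h1] at hv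
      exact absurd hv (not_lt.2 (hcon v))
    rw [this, Finset.sum_empty] at h2
    have := Module.finrank_pos (R := K⟮t⟯) (M := F)
    omega

theorem exists_algebraMap_eq_of_not_transcendental [IsAlgClosed K] (t : F)
    (ht : ¬ Transcendental K t) : ∃ c : K, algebraMap K F c = t := by
  have h1 : IsIntegral K t := (not_not.1 ht).isIntegral
  have := IntermediateField.isAlgebraic_adjoin_simple h1
  have h2 := IntermediateField.eq_bot_of_isAlgClosed_of_isAlgebraic (IntermediateField.adjoin K {t})
  exact IntermediateField.mem_bot.1 (h2 ▸ IntermediateField.mem_adjoin_simple_self K t)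

/-- An element without zeros and poles is constant. -/
theorem exists_algebraMap_eq_of_ord_eq_zero [IsAlgClosed K] [CharZero K]
    (hF : ∀ t : F, Transcendental K t → FiniteDimensional (IntermediateField.adjoin K {t}) F)
    (g : F) (h : ∀ v : Place K F, v.ord g = 0) : ∃ c : K, algebraMap K F c = g := by
  refine exists_algebraMap_eq_of_not_transcendental g fun ht => ?_
  obtain ⟨v, hv⟩ := (exists_support hF g ht).2
  exact hv.ne' (h v)

end Place

/-- The divisor of a nonzero function exists and has degree zero. -/
theorem Divisor.exists_div {K F : Type*} [Field K] [Field F] [Algebra K F] [IsAlgClosed K]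
    [CharZero K]
    (hF : ∀ t : F, Transcendental K t → FiniteDimensional (IntermediateField.adjoin K {t}) F)
    (g : F) : ∃ D : Divisor K F, (∀ v, D v = v.ord g) ∧ Divisor.degree K F D = 0 := by
  classical
  by_cases ht : Transcendental K g
  · obtain ⟨⟨s, hs, h0⟩, -⟩ := Place.exists_support hF g ht
    refine ⟨Finsupp.onFinset s (fun v => v.ord g) fun v hv => (hs v).2 hv, fun v => rfl, ?_⟩
    rw [Divisor.degree, Finsupp.liftAddHom_apply, Finsupp.onFinset_sum _ fun _ => rfl]
    exact h0
  · obtain ⟨c, rfl⟩ := Place.exists_algebraMap_eq_of_not_transcendental g ht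
    exact ⟨0, fun v => by rw [Place.ord_algebraMap]; rfl, map_zero _⟩

open IntermediateField in
-- F has transcendence degree at most 1, so any transcendental t is already a transcendence basis.
-- Then F is algebraic and finitely generated over k(t).
theorem finiteDimensional_adjoin_of_transcendental {k F : Type*} [Field k] [Field F] [Algebra k F]
    (x : F) [FiniteDimensional k⟮x⟯ F] (t : F) (ht : Transcendental k t) :
    FiniteDimensional k⟮t⟯ F := by
  have hess : Algebra.EssFiniteType k F := by
    have : Algebra.EssFiniteType k k⟮x⟯ :=
      IntermediateField.essFiniteType_iff.2 ⟨{x}, by simp⟩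
    exact Algebra.EssFiniteType.comp k k⟮x⟯ F
  have halg : Algebra.IsAlgebraic (Algebra.adjoin k {x}) F := by
    open algebraAdjoinAdjoin in
    exact Algebra.IsAlgebraic.trans (Algebra.adjoin k {x}) k⟮x⟯ F
  have htr := Algebra.IsAlgebraic.trdeg_le_cardinalMk (R := k) (s := ({x} : Set F))
  have hind : AlgebraicIndependent k (fun _ : Unit => t) :=
    (algebraicIndependent_unique_type_iff).2 ht
  have hbas : IsTranscendenceBasis k (fun _ : Unit => t) :=
    hind.isTranscendenceBasis_of_lift_trdeg_le_of_finite (by simpa using htr)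
  have h2 := hbas.isAlgebraic_field
  rw [Set.range_const] at h2
  have : Algebra.EssFiniteType k⟮t⟯ F := Algebra.EssFiniteType.of_comp k k⟮t⟯ F
  obtain ⟨S, hS⟩ := IntermediateField.fg_top k⟮t⟯ F
  have h3 : FiniteDimensional k⟮t⟯ (IntermediateField.adjoin k⟮t⟯ (S : Set F)) :=
    finiteDimensional_adjoin fun s _ => (h2.isAlgebraic s).isIntegral
  rw [hS] at h3
  exact Module.Finite.equiv (IntermediateField.topEquiv (F := k⟮t⟯) (E := F)).toLinearEquiv

theorem IntermediateField.aeval_mem {k F : Type*} [Field k] [Field F] [Algebra k F]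
    (L : IntermediateField k F) {x : F} (hx : x ∈ L) (p : k[X]) : aeval x p ∈ L := by
  rw [aeval_eq_sum_range]
  exact sum_mem fun i _ => L.smul_mem (pow_mem hx i)

/-! ### The function field of y² = f(x): every function is (p + qy)/r. -/

namespace GenusTwoCurve

variable {k : Type*} [Field k] [CharZero k] (C : GenusTwoCurve k)

theorem monic_polynomial : C.polynomial.Monic := monic_X_pow_sub_C _ two_ne_zero

theorem f_ne_zero : C.f ≠ 0 := by
  intro h
  rcases C.degree with h1 | h1 <;> simp [h] at h1

theorem aeval_x (p : k[X]) : aeval C.x p =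
    algebraMap C.CoordinateRing C.FunctionField (AdjoinRoot.of C.polynomial p) := by
  have h : (aeval C.x : k[X] →ₐ[k] C.FunctionField) =
      (IsScalarTower.toAlgHom k C.CoordinateRing C.FunctionField).comp
        ((Algebra.ofId k[X] C.CoordinateRing).restrictScalars k) := by
    ext
    simp [x, Algebra.ofId_apply]
  rw [h]
  rfl

theorem y_sq : C.y ^ 2 = aeval C.x C.f := by
  have h := AdjoinRoot.eval₂_root C.polynomial
  rw [polynomial, eval₂_sub, eval₂_pow, eval₂_X, eval₂_C, sub_eq_zero] at h
  rw [aeval_x, y, ← map_pow]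
  exact congrArg _ h

/-- A polynomial of degree at most 1 in y cannot be a nonzero multiple of y² - f. Comparing
coefficients of 1 and y is the main computational device below. -/
theorem eq_zero_of_add_mul_y {p q : k[X]} (h : aeval C.x p + aeval C.x q * C.y = 0) :
    p = 0 ∧ q = 0 := by
  have h1 : AdjoinRoot.mk C.polynomial (Polynomial.C p + Polynomial.C q * X) = 0 := by
    apply IsFractionRing.injective C.CoordinateRing C.FunctionField
    rw [map_zero, ← h, aeval_x, aeval_x, map_add, map_mul, map_add, map_mul]
    rfl
  rw [AdjoinRoot.mk_eq_zero] at h1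
  have h2 : Polynomial.C p + Polynomial.C q * X = 0 := by
    refine eq_zero_of_dvd_of_degree_lt h1 ?_
    rw [polynomial, degree_X_pow_sub_C two_pos, add_comm]
    exact lt_of_le_of_lt degree_linear_le (by norm_num)
  have h3 := congrArg (fun r => coeff r 0) h2
  have h4 := congrArg (fun r => coeff r 1) h2
  simp at h3 h4
  exact ⟨h3, h4⟩

theorem aeval_x_injective : Function.Injective (aeval C.x : k[X] →ₐ[k] C.FunctionField) := by
  rw [injective_iff_map_eq_zero]
  intro p hp
  exact (C.eq_zero_of_add_mul_y (q := 0) (by simpa using hp)).1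

theorem transcendental_x : Transcendental k C.x := transcendental_iff_injective.2 C.aeval_x_injective

theorem aeval_x_ne_zero {p : k[X]} (hp : p ≠ 0) : aeval C.x p ≠ 0 := fun h =>
  hp (C.aeval_x_injective (by rw [h, map_zero]))

/-- This is the norm of p + qy, a product of two nonzero conjugates in a field. -/
theorem norm_ne_zero {p q : k[X]} (h : p ≠ 0 ∨ q ≠ 0) : p ^ 2 - q ^ 2 * C.f ≠ 0 := by
  intro h0
  have h1 : (aeval C.x p + aeval C.x q * C.y) * (aeval C.x p + aeval C.x (-q) * C.y) = 0 := by
    have h2 := congrArg (aeval C.x) h0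
    simp only [map_sub, map_mul, map_pow, map_zero, ← C.y_sq] at h2
    rw [map_neg]
    linear_combination h2
  rcases mul_eq_zero.1 h1 with h2 | h2
  · obtain ⟨h3, h4⟩ := C.eq_zero_of_add_mul_y h2
    simp [h3, h4] at h
  · obtain ⟨h3, h4⟩ := C.eq_zero_of_add_mul_y h2
    simp [h3, neg_eq_zero.1 h4] at h

theorem exists_eq_coordinateRing (a : C.CoordinateRing) : ∃ p q : k[X],
    algebraMap C.CoordinateRing C.FunctionField a = aeval C.x p + aeval C.x q * C.y := by
  obtain ⟨P, rfl⟩ := AdjoinRoot.mk_surjective a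
  have h1 := modByMonic_add_div P C.polynomial
  set R := P %ₘ C.polynomial with hR
  have h2 : R.degree < 2 := by
    have := degree_modByMonic_lt P C.monic_polynomial
    rwa [polynomial, degree_X_pow_sub_C two_pos] at this
  have h3 : R = Polynomial.C (R.coeff 1) * X + Polynomial.C (R.coeff 0) :=
    eq_X_add_C_of_degree_le_one (by
      rw [degree_le_iff_coeff_zero]
      intro m hm
      exact coeff_eq_zero_of_degree_lt (h2.trans_le (by exact_mod_cast (Nat.cast_lt.1 hm))))
  refine ⟨R.coeff 0, R.coeff 1, ?_⟩
  rw [← h1, map_add, map_mul, AdjoinRoot.mk_self, zero_mul, add_zero, aeval_x, aeval_x]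
  conv_lhs => rw [h3, map_add, map_mul, map_add, map_mul, add_comm]
  rfl

/-- Every function is of the form `(p(x) + q(x) y) / r(x)`. -/
theorem exists_eq_div (g : C.FunctionField) : ∃ p q r : k[X], r ≠ 0 ∧
    g = (aeval C.x p + aeval C.x q * C.y) / aeval C.x r := by
  obtain ⟨a, b, hb, rfl⟩ := IsFractionRing.div_surjective (A := C.CoordinateRing) g
  obtain ⟨p, q, h1⟩ := C.exists_eq_coordinateRing a
  obtain ⟨r, s, h2⟩ := C.exists_eq_coordinateRing b
  have hb0 : aeval C.x r + aeval C.x s * C.y ≠ 0 := by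
    rw [← h2]
    simpa using nonZeroDivisors.ne_zero hb
  have hrs : r ≠ 0 ∨ s ≠ 0 := by
    by_contra! h
    simp [h.1, h.2] at hb0
  have hn := C.aeval_x_ne_zero (C.norm_ne_zero hrs)
  -- Numerator and denominator are multiplied by the conjugate r - sy.
  refine ⟨p * r - q * s * C.f, q * r - p * s, r ^ 2 - s ^ 2 * C.f, C.norm_ne_zero hrs, ?_⟩
  rw [h1, h2, div_eq_div_iff hb0 hn]
  simp only [map_sub, map_mul, map_pow, ← C.y_sq]
  ring

open IntermediateField in
theorem adjoin_x_y_eq_top : adjoin k {C.x, C.y} = ⊤ := by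
  rw [eq_top_iff]
  intro g _
  obtain ⟨p, q, r, hr, rfl⟩ := C.exists_eq_div g
  have hx : C.x ∈ adjoin k {C.x, C.y} := subset_adjoin _ _ (by simp)
  have hy : C.y ∈ adjoin k {C.x, C.y} := subset_adjoin _ _ (by simp)
  have hp : ∀ p : k[X], aeval C.x p ∈ adjoin k {C.x, C.y} := fun p =>
    IntermediateField.aeval_mem _ hx p
  exact div_mem (add_mem (hp p) (mul_mem (hp q) hy)) (hp r)

open IntermediateField in
theorem aeval_x_mem_adjoin (p : k[X]) : aeval C.x p ∈ k⟮C.x⟯ :=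
  IntermediateField.aeval_mem _ (mem_adjoin_simple_self k C.x) p

open IntermediateField in
theorem isIntegral_y : IsIntegral k⟮C.x⟯ C.y := by
  refine IsIntegral.of_pow two_pos ?_
  rw [y_sq]
  exact isIntegral_algebraMap (R := k⟮C.x⟯) (x := ⟨_, C.aeval_x_mem_adjoin C.f⟩)

open IntermediateField in
theorem adjoin_y_eq_top : k⟮C.x⟯⟮C.y⟯ = ⊤ := by
  rw [← restrictScalars_eq_top_iff (K := k), adjoin_adjoin_left, ← C.adjoin_x_y_eq_top]
  rfl

open IntermediateField in
instance finiteDimensional_functionField : FiniteDimensional k⟮C.x⟯ C.FunctionField := by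
  have h := adjoin.finiteDimensional C.isIntegral_y
  rw [adjoin_y_eq_top] at h
  exact Module.Finite.equiv
    (IntermediateField.topEquiv (F := k⟮C.x⟯) (E := C.FunctionField)).toLinearEquiv

theorem finiteDimensional_adjoin (t : C.FunctionField) (ht : Transcendental k t) :
    FiniteDimensional (IntermediateField.adjoin k {t}) C.FunctionField :=
  finiteDimensional_adjoin_of_transcendental C.x t ht

/-! ### Torsion points from functions -/

theorem geometric_aeval_x (p : k[X]) : aeval C.geometric.x p =
    aeval C.geometric.x (p.map (algebraMap k (AlgebraicClosure k))) := by
  rw [aeval_map_algebraMap]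

theorem galois_apply_aeval {σ : C.GeometricFunctionField ≃ₐ[k] C.GeometricFunctionField}
    (hσ : σ ∈ C.galois) (p : k[X]) : σ (aeval C.geometric.x p) = aeval C.geometric.x p := by
  rw [← AlgEquiv.coe_toAlgHom, ← aeval_algHom_apply, AlgEquiv.coe_toAlgHom, hσ.1]

end GenusTwoCurve

/-- Composing the valuation at v with σ⁻¹ gives a surjective valuation with the ring of the image
place, and such a valuation is unique. -/
theorem Place.ord_map {k K F : Type*} [Field k] [Field K] [Field F] [Algebra K F] [Algebra k K]
    [Algebra k F] [IsScalarTower k K F] [Algebra.IsAlgebraic k K] (σ : F ≃ₐ[k] F)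
    (v : Place K F) (g : F) : (v.map σ).ord g = v.ord (σ.symm g) := by
  have := v.isDVR
  let w : Valuation F (WithZero (Multiplicative ℤ)) :=
    ((IsDiscreteValuationRing.maximalIdeal v.ring).valuation F).comap (σ.symm : F →+* F)
  have hw : Function.Surjective w :=
    ((IsDiscreteValuationRing.maximalIdeal v.ring).valuation_surjective F).comp σ.symm.surjective
  exact Place.ord_eq_neg_log (v.map σ) w hw (fun g => v.valuation_le_one_iff (σ.symm g)) g

theorem Place.map_injective {k K F : Type*} [Field k] [Field K] [Field F] [Algebra K F]
    [Algebra k K] [Algebra k F] [IsScalarTower k K F] [Algebra.IsAlgebraic k K] (σ : F ≃ₐ[k] F) :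
    Function.Injective (Place.map (K := K) σ) := by
  intro v w h
  refine Place.ext_ring (ValuationSubring.ext _ _ fun g => ?_)
  have h1 : ∀ u : Place K F, σ g ∈ (u.map σ).ring ↔ g ∈ u.ring := fun u => by
    simp [Place.map, ValuationSubring.mem_comap]
  rw [← h1 v, ← h1 w, h]

theorem Place.map_surjective {k K F : Type*} [Field k] [Field K] [Field F] [Algebra K F]
    [Algebra k K] [Algebra k F] [IsScalarTower k K F] [Algebra.IsAlgebraic k K] (σ : F ≃ₐ[k] F) :
    Function.Surjective (Place.map (K := K) σ) := by
  intro v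
  refine ⟨v.map σ.symm, Place.ext_ring (ValuationSubring.ext _ _ fun g => ?_)⟩
  simp [Place.map, ValuationSubring.mem_comap]

namespace GenusTwoCurve

variable {k : Type*} [Field k] [CharZero k] (C : GenusTwoCurve k)

/-- A function fixed by Galois, all of whose orders are divisible by `n`, which is not a `p`-th
power for any prime `p` dividing `n`, gives a rational point of order `n` on the Jacobian. -/
theorem exists_addOrderOf_eq (h : C.GeometricFunctionField) (h0 : h ≠ 0)
    (hσ : ∀ σ ∈ C.galois, σ h = h) (n : ℕ) (hn : n ≠ 0)
    (hdvd : ∀ v : Place (AlgebraicClosure k) C.GeometricFunctionField, (n : ℤ) ∣ v.ord h)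
    (hpow : ∀ p : ℕ, p.Prime → p ∣ n → ∀ g : C.GeometricFunctionField, g ^ p ≠ h) :
    ∃ P : C.JacobianPoints, addOrderOf P = n := by
  classical
  let K := AlgebraicClosure k
  let F := C.GeometricFunctionField
  have hF : ∀ t : F, Transcendental K t → FiniteDimensional (IntermediateField.adjoin K {t}) F :=
    C.geometric.finiteDimensional_adjoin
  obtain ⟨E, hE, hdeg⟩ := Divisor.exists_div (K := K) hF h
  have hn' : (n : ℤ) ≠ 0 := by exact_mod_cast hn
  let D : Divisor K F := E.mapRange (fun m => m / (n : ℤ)) (by simp)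
  have hD : ∀ v, (n : ℤ) * D v = v.ord h := fun v => by
    simp only [D, Finsupp.mapRange_apply, hE]
    exact Int.mul_ediv_cancel' (hdvd v)
  have hnD : n • D = E := by
    ext v
    rw [Finsupp.smul_apply, nsmul_eq_mul, hD, hE]
  have hDdeg : Divisor.degree K F D = 0 := by
    have h1 := congrArg (Divisor.degree K F) hnD
    rw [map_nsmul, hdeg, nsmul_eq_mul] at h1
    exact (mul_eq_zero.1 h1).resolve_left hn'
  have hmem : D ∈ C.rationalClassDivisors := by
    refine ⟨hDdeg, fun σ hs => ?_⟩
    -- Since σ fixes h and D is the divisor of h divided by n, the divisor itself is invariant, not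
    -- merely its class.
    have : Divisor.map σ D = D := by
      ext v
      obtain ⟨w, rfl⟩ := Place.map_surjective (K := K) σ v
      change Finsupp.mapDomain (Place.map σ) D (Place.map σ w) = _
      rw [Finsupp.mapDomain_apply (Place.map_injective σ)]
      apply mul_left_cancel₀ hn'
      rw [hD, hD, Place.ord_map, (σ.symm_apply_eq).2 (hσ σ hs).symm]
    rw [this, sub_self]
    exact zero_mem _
  refine ⟨QuotientAddGroup.mk ⟨D, hmem⟩, ?_⟩
  have hprin : ∀ m : ℕ, m • (QuotientAddGroup.mk ⟨D, hmem⟩ : C.JacobianPoints) = 0 ↔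
      m • D ∈ C.principalDivisors := by
    intro m
    rw [← QuotientAddGroup.mk_nsmul, QuotientAddGroup.eq_zero_iff, AddSubgroup.mem_addSubgroupOf]
    rfl
  refine addOrderOf_eq_of_nsmul_and_div_prime_nsmul (Nat.pos_of_ne_zero hn) ?_ ?_
  · rw [hprin, hnD]
    exact ⟨h, h0, hE⟩
  · intro p hp hpn
    rw [Ne, hprin]
    rintro ⟨g, hg0, hg⟩
    obtain ⟨m, rfl⟩ := hpn
    have hp0 : p ≠ 0 := hp.ne_zero
    have hm0 : m ≠ 0 := right_ne_zero_of_mul hn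
    rw [Nat.mul_div_cancel_left m hp.pos] at hg
    -- If mD = div g with n = pm, then gᵖ and h have the same divisor, so they differ by a constant.
    -- The constant has a p-th root, which would make h a p-th power.
    have hord : ∀ v : Place K F, v.ord (g ^ p / h) = 0 := by
      intro v
      rw [v.ord_div (pow_ne_zero _ hg0) h0, v.ord_pow hg0, ← hD, ← hg, Finsupp.smul_apply,
        nsmul_eq_mul]
      push_cast
      ring
    obtain ⟨c, hc⟩ := Place.exists_algebraMap_eq_of_ord_eq_zero hF _ hord
    have hc0 : c ≠ 0 := by
      rintro rfl
      rw [map_zero] at hc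
      exact div_ne_zero (pow_ne_zero _ hg0) h0 hc.symm
    obtain ⟨d, hd⟩ := IsAlgClosed.exists_pow_nat_eq c hp.pos
    refine hpow p hp (dvd_mul_right _ _) (g / algebraMap K F d) ?_
    rw [div_pow, ← map_pow, hd, hc]
    field_simp

end GenusTwoCurve

/-! ### Local computations for the functions behind the points of order 3 and 16. -/

namespace Place

variable {K F : Type*} [Field K] [Field F] [Algebra K F] (v : Place K F)

theorem ord_add_eq_left {g h : F} (hg : g ≠ 0) (hh : h ≠ 0) (hlt : v.ord g < v.ord h) :
    v.ord (g + h) = v.ord g := by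
  have hgh : g + h ≠ 0 := by
    intro h0
    rw [eq_neg_of_add_eq_zero_left h0, ord_neg] at hlt
    exact lt_irrefl _ hlt
  have h1 := v.min_ord_le_ord_add hg hh hgh
  have h2 := v.min_ord_le_ord_add hgh (neg_ne_zero.2 hh) (by simpa using hg)
  rw [ord_neg, add_neg_cancel_right] at h2
  omega

/-- At a pole of `x`, a polynomial in `x` has a pole of order its degree times that of `x`. -/
theorem ord_aeval_of_neg {x : F} (hx : v.ord x < 0) (p : K[X]) (hp : p ≠ 0) :
    aeval x p ≠ 0 ∧ v.ord (aeval x p) = p.natDegree * v.ord x := by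
  have hx0 : x ≠ 0 := by rintro rfl; rw [ord_zero] at hx; omega
  have hmono : ∀ (c : K) (n : ℕ), c ≠ 0 → aeval x (C c * X ^ n) ≠ 0 ∧
      v.ord (aeval x (C c * X ^ n)) = n * v.ord x := by
    intro c n hc
    have hc' : algebraMap K F c ≠ 0 := by simpa using hc
    rw [map_mul, aeval_C, map_pow, aeval_X]
    refine ⟨mul_ne_zero hc' (pow_ne_zero _ hx0), ?_⟩
    rw [v.ord_mul hc' (pow_ne_zero _ hx0), ord_algebraMap, v.ord_pow hx0, zero_add]
  induction h : p.support.card using Nat.strong_induction_on generalizing p with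
  | _ n ih =>
    have h1 := p.eraseLead_add_C_mul_X_pow
    have h2 := hmono p.leadingCoeff p.natDegree (leadingCoeff_ne_zero.2 hp)
    by_cases h3 : p.eraseLead = 0
    · rw [h3, zero_add] at h1
      rwa [h1] at h2
    · have h4 := ih _ (h ▸ eraseLead_support_card_lt hp) _ h3 rfl
      have h5 : p.eraseLead.natDegree < p.natDegree :=
        (eraseLead_natDegree_lt_or_eraseLead_eq_zero p).resolve_right h3
      have h8 : v.ord (aeval x (C p.leadingCoeff * X ^ p.natDegree)) <
          v.ord (aeval x p.eraseLead) := by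
        rw [h2.2, h4.2]
        have : (p.eraseLead.natDegree : ℤ) < p.natDegree := by exact_mod_cast h5
        nlinarith
      have h9 := v.ord_add_eq_left h2.1 h4.1 h8
      rw [add_comm, ← map_add, h1] at h9
      refine ⟨?_, by rw [h9, h2.2]⟩
      intro h10
      rw [← h1, map_add, add_comm, ← neg_eq_iff_add_eq_zero] at h10
      rw [← h10, ord_neg] at h8
      omega

theorem le_ord_aeval {x : F} (hx : v.ord x < 0) (p : K[X]) (n : ℕ) (hn : p.natDegree ≤ n)
    (h0 : aeval x p ≠ 0) : n * v.ord x ≤ v.ord (aeval x p) := by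
  rw [(v.ord_aeval_of_neg hx p (by rintro rfl; simp at h0)).2]
  have : (p.natDegree : ℤ) ≤ n := by exact_mod_cast hn
  nlinarith

theorem valuation_algebraMap {c : K} (hc : c ≠ 0) : v.ring.valuation (algebraMap K F c) = 1 := by
  rw [← v.ord_eq_zero_iff (by simpa using hc), ord_algebraMap]

theorem valuation_aeval_le {x : F} (hx : x ∈ v.ring) (p : K[X]) :
    v.ring.valuation (aeval x p) ≤ 1 := by
  rw [ValuationSubring.valuation_le_one_iff, aeval_eq_sum_range]
  refine sum_mem fun i _ => ?_
  rw [Algebra.smul_def]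
  exact mul_mem (v.const_mem _) (pow_mem hx i)

theorem valuation_mul_lt {a b : F} (ha : v.ring.valuation a ≤ 1) (hb : v.ring.valuation b < 1) :
    v.ring.valuation (a * b) < 1 := by
  rw [map_mul]
  exact (mul_le_of_le_one_left' ha).trans_lt hb

theorem valuation_lt_of_pow {a : F} (n : ℕ) (h : v.ring.valuation (a ^ n) < 1) :
    v.ring.valuation a < 1 := by
  rw [map_pow] at h
  exact lt_of_not_ge fun h' => absurd h (not_lt.2 (one_le_pow₀ h'))

theorem mem_ring_of_sq_mem {y : F} (hy : y ^ 2 ∈ v.ring) : y ∈ v.ring := by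
  rcases v.ring.mem_or_inv_mem y with h | h
  · exact h
  · by_cases h0 : y = 0
    · rw [h0]; exact zero_mem _
    have := mul_mem hy h
    rwa [pow_two, mul_assoc, mul_inv_cancel₀ h0, mul_one] at this

/-- If `y² = f(x)` with `f` separable, then `f` and `f'` do not both vanish at `v`. -/
theorem not_valuation_lt_one_of_separable {x : F} (hx : x ∈ v.ring) {f : K[X]}
    (hf : f.Separable) (h1 : v.ring.valuation (aeval x f) < 1)
    (h2 : v.ring.valuation (aeval x (derivative f)) < 1) : False := by
  obtain ⟨a, b, hab⟩ := hf
  have h3 := congrArg (aeval x) hab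
  rw [map_add, map_mul, map_mul, map_one] at h3
  have h4 : v.ring.valuation (aeval x a * aeval x f + aeval x b * aeval x (derivative f)) < 1 := by
    exact Valuation.map_add_lt _ (v.valuation_mul_lt (v.valuation_aeval_le hx a) h1)
      (v.valuation_mul_lt (v.valuation_aeval_le hx b) h2)
  rw [h3, map_one] at h4
  exact lt_irrefl _ h4

/-- If `y² = g(x)² + c ℓ(x)³`, the function `y - g(x)` has orders divisible by three. -/
theorem three_dvd_ord [CharZero K] {x y : F} (hxt : Transcendental K x) {f g l : K[X]} {c : K}
    (hc : c ≠ 0) (hy : y ^ 2 = aeval x f) (hfs : f.Separable) (hfd : f.natDegree = 6)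
    (hg : g.natDegree ≤ 3) (hl : l.natDegree = 2) (hf : f = g ^ 2 + C c * l ^ 3) :
    (3 : ℤ) ∣ v.ord (y - aeval x g) := by
  have hl0 : l ≠ 0 := by rintro rfl; simp at hl
  have hlx : aeval x l ≠ 0 := fun h => hl0 ((transcendental_iff.1 hxt) l h)
  have hcF : algebraMap K F c ≠ 0 := by simpa using hc
  have hprod : (y - aeval x g) * (y + aeval x g) = algebraMap K F c * aeval x l ^ 3 := by
    have h1 : (y - aeval x g) * (y + aeval x g) = y ^ 2 - aeval x g ^ 2 := by ring
    rw [h1, hy, hf]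
    simp
  have hne : (y - aeval x g) * (y + aeval x g) ≠ 0 := by
    rw [hprod]; exact mul_ne_zero hcF (pow_ne_zero _ hlx)
  have hh := left_ne_zero_of_mul hne
  have hh' := right_ne_zero_of_mul hne
  have hord : v.ord (y - aeval x g) + v.ord (y + aeval x g) = 3 * v.ord (aeval x l) := by
    rw [← v.ord_mul hh hh', hprod, v.ord_mul hcF (pow_ne_zero _ hlx), ord_algebraMap,
      v.ord_pow hlx]
    push_cast; ring
  by_cases hx : x ∈ v.ring
  · have hyr : y ∈ v.ring := v.mem_ring_of_sq_mem (by
      rw [hy, ← ValuationSubring.valuation_le_one_iff]; exact v.valuation_aeval_le hx f)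
    have hgr : aeval x g ∈ v.ring :=
      (ValuationSubring.valuation_le_one_iff _ _).1 (v.valuation_aeval_le hx g)
    have p1 := (v.ord_nonneg_iff hh).2 (sub_mem hyr hgr)
    have p2 := (v.ord_nonneg_iff hh').2 (add_mem hyr hgr)
    -- A common zero of y - g and y + g is a zero of y, g and ℓ, hence of both f and f'. So at a
    -- finite place one factor has order 0 and the other has order 3 · ord ℓ.
    by_cases hboth : 0 < v.ord (y - aeval x g) ∧ 0 < v.ord (y + aeval x g)
    · exfalso
      obtain ⟨q1, q2⟩ := hboth
      rw [v.ord_pos_iff hh] at q1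
      rw [v.ord_pos_iff hh'] at q2
      have h2 : v.ring.valuation (algebraMap K F 2) = 1 := v.valuation_algebraMap two_ne_zero
      have q3 : v.ring.valuation y < 1 := by
        have := Valuation.map_add_lt _ q1 q2
        rwa [show y - aeval x g + (y + aeval x g) = algebraMap K F 2 * y by
          rw [map_ofNat]; ring, map_mul, h2, one_mul] at this
      have q4 : v.ring.valuation (aeval x g) < 1 := by
        have := Valuation.map_sub_lt _ q2 q3
        rwa [add_sub_cancel_left] at this
      have q5 : v.ring.valuation (aeval x l) < 1 := by
        have h6 : v.ring.valuation (algebraMap K F c * aeval x l ^ 3) < 1 := by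
          rw [← hprod]
          exact v.valuation_mul_lt q1.le q2
        rw [map_mul, v.valuation_algebraMap hc, one_mul] at h6
        exact v.valuation_lt_of_pow 3 h6
      refine v.not_valuation_lt_one_of_separable hx hfs ?_ ?_
      · rw [← hy, map_pow]
        exact pow_lt_one₀ zero_le q3 two_ne_zero
      · rw [hf]
        have : derivative (g ^ 2 + C c * l ^ 3) =
            (2 * derivative g) * g + (C c * (3 * l * derivative l)) * l := by
          simp only [derivative_add, derivative_mul, derivative_pow, derivative_C]
          simp only [map_ofNat, Nat.cast_ofNat]
          ring
        rw [this, map_add, map_mul (aeval x) _ g, map_mul (aeval x) _ l]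
        exact Valuation.map_add_lt _ (v.valuation_mul_lt (v.valuation_aeval_le hx _) q4)
          (v.valuation_mul_lt (v.valuation_aeval_le hx _) q5)
    · omega
  · have hx0 : x ≠ 0 := by rintro rfl; exact hx (zero_mem _)
    have hneg : v.ord x < 0 := by
      rw [← v.ord_nonneg_iff hx0] at hx; omega
    have hl2 := (v.ord_aeval_of_neg hneg l hl0).2
    have hf0 : f ≠ 0 := by rintro rfl; simp at hfd
    have hf2 := v.ord_aeval_of_neg hneg f hf0
    have hy0 : y ≠ 0 := by
      rintro rfl; apply hf2.1; rw [← hy]; simp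
    rw [← hy, v.ord_pow hy0, hfd] at hf2
    rw [hl] at hl2
    push_cast at hl2 hf2
    -- At infinity both factors have order at least 3 · ord x, while the orders add up to 6 · ord x;
    -- hence both are equal to 3 · ord x.
    have key : ∀ g' : K[X], g'.natDegree ≤ 3 → y + aeval x g' ≠ 0 →
        3 * v.ord x ≤ v.ord (y + aeval x g') := by
      intro g' hg' hne'
      by_cases h0 : aeval x g' = 0
      · rw [h0, add_zero]; omega
      · have h1 := v.min_ord_le_ord_add hy0 h0 hne'
        have h2 := v.le_ord_aeval hneg g' 3 hg' h0
        push_cast at h2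
        omega
    have k1 := key g hg hh'
    have k2 := key (-g) (by rwa [natDegree_neg]) (by rwa [map_neg, ← sub_eq_add_neg])
    rw [map_neg, ← sub_eq_add_neg] at k2
    omega

theorem valuation_ofNat [CharZero K] (n : ℕ) [n.AtLeastTwo] :
    v.ring.valuation (OfNat.ofNat n : F) = 1 := by
  rw [← map_ofNat (algebraMap K F) n]
  exact v.valuation_algebraMap (OfNat.ofNat_ne_zero n)

theorem valuation_eq_one_of_sub {a b : F} (h : v.ring.valuation (a - b) < 1)
    (hb : v.ring.valuation b = 1) : v.ring.valuation a = 1 := by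
  rw [← hb] at h
  rw [← sub_add_cancel a b, Valuation.map_add_eq_of_lt_right _ h, hb]

theorem ord_eq_zero_of_valuation {a : F} (h : v.ring.valuation a = 1) : v.ord a = 0 := by
  have ha : a ≠ 0 := by rintro rfl; rw [map_zero] at h; exact zero_ne_one h
  rwa [v.ord_eq_zero_iff ha]

theorem ord_pos_of_valuation_lt {a : F} (h0 : a ≠ 0) (h : v.ring.valuation a < 1) : 0 < v.ord a :=
  (v.ord_pos_iff h0).2 h

/-- The orders of the function attached to the point of order eight on
`Y² = Z (Z + 256) (Z + 81)`, times an eighth power, are divisible by sixteen, provided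
`Y² - G² = κ (Z - 864) Q²`. -/
theorem sixteen_dvd_ord [CharZero K] {x Y : F} (hxt : Transcendental K x) {Z G Q S : K[X]} {κ : K}
    (hκ : κ ≠ 0) (hY : Y ^ 2 = aeval x (Z * (Z + 256) * (Z + 81)))
    (hsep : (Z * (Z + 256) * (Z + 81)).Separable)
    (hG : Z * (Z + 256) * (Z + 81) = G ^ 2 + C κ * (Z - 864) * Q ^ 2)
    (hS : G + 30240 = (Z - 864) * S)
    (hZd : Z.natDegree = 2) (hGd : G.natDegree ≤ 3) (hQd : Q.natDegree = 2) :
    (16 : ℤ) ∣ v.ord ((Y + aeval x G) ^ 8 * (Y - 47 * aeval x Z + 10368) ^ 4 * aeval x Z /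
      (Y + 25 * aeval x Z) ^ 2) := by
  have hinj : ∀ p : K[X], p ≠ 0 → aeval x p ≠ 0 := fun p hp h => hp (transcendental_iff.1 hxt p h)
  have hZc : ∀ c : K, (Z + C c).natDegree = 2 := fun c => by rw [natDegree_add_C, hZd]
  have hZn : ∀ c : K, Z + C c ≠ 0 := fun c h => by have := hZc c; rw [h] at this; simp at this
  have hQ0 : Q ≠ 0 := by rintro rfl; simp at hQd
  set z := aeval x Z with hz
  set g := aeval x G with hg
  set q := aeval x Q with hq
  set s := aeval x S with hs
  have hzc : ∀ c : K, z + algebraMap K F c ≠ 0 := fun c => by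
    have := hinj _ (hZn c)
    rwa [map_add, aeval_C] at this
  have hz0 : z ≠ 0 := by simpa using hzc 0
  have hz864 : z - 864 ≠ 0 := by
    have := hzc (-864)
    rwa [map_neg, map_ofNat, ← sub_eq_add_neg] at this
  have hz144 : z - 144 ≠ 0 := by
    have := hzc (-144)
    rwa [map_neg, map_ofNat, ← sub_eq_add_neg] at this
  have hq0 : q ≠ 0 := hinj Q hQ0
  have hκF : algebraMap K F κ ≠ 0 := by simpa using hκ
  have eY : Y ^ 2 = z * (z + 256) * (z + 81) := by
    rw [hY]; simp only [map_mul, map_add, map_ofNat]; rfl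
  have eG : Y ^ 2 - g ^ 2 = algebraMap K F κ * (z - 864) * q ^ 2 := by
    rw [hY, hG]
    simp only [map_mul, map_add, map_sub, map_pow, map_ofNat, aeval_C]
    ring
  have eS : g + 30240 = (z - 864) * s := by
    have := congrArg (aeval x) hS
    simpa only [map_mul, map_add, map_sub, map_ofNat] using this
  -- Let P = (864, 30240), so that 2P = (144, 3600) and 4P = (0, 0). The line Y = 47z - 10368 is
  -- tangent at P and passes through -2P; the line Y = -25z is tangent at -2P and passes through 4P.
  -- Hence (Y - 47z + 10368)⁴ z / (Y + 25z)² has divisor 8P - 8∞ on the elliptic curve. On the genus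
  -- two curve, Y + g vanishes once over P and doubly over zeros of q, so its eighth power completes
  -- the multiple of 16.
  have e0 : (Y + g) * (Y - g) = algebraMap K F κ * (z - 864) * q ^ 2 := by rw [← eG]; ring
  have e1 : (Y - 47 * z + 10368) * (Y + 47 * z - 10368) = (z - 864) ^ 2 * (z - 144) := by
    linear_combination eY
  have e2 : (Y + 25 * z) * (Y - 25 * z) = z * (z - 144) ^ 2 := by linear_combination eY
  have n0 : (Y + g) * (Y - g) ≠ 0 := by
    rw [e0]; exact mul_ne_zero (mul_ne_zero hκF hz864) (pow_ne_zero _ hq0)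
  have n1 : (Y - 47 * z + 10368) * (Y + 47 * z - 10368) ≠ 0 := by
    rw [e1]; exact mul_ne_zero (pow_ne_zero _ hz864) hz144
  have n2 : (Y + 25 * z) * (Y - 25 * z) ≠ 0 := by
    rw [e2]; exact mul_ne_zero hz0 (pow_ne_zero _ hz144)
  obtain ⟨n0a, n0b⟩ := mul_ne_zero_iff.1 n0
  obtain ⟨n1a, n1b⟩ := mul_ne_zero_iff.1 n1
  obtain ⟨n2a, n2b⟩ := mul_ne_zero_iff.1 n2
  have o0 : v.ord (Y + g) + v.ord (Y - g) = v.ord (z - 864) + 2 * v.ord q := by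
    rw [← v.ord_mul n0a n0b, e0, v.ord_mul (mul_ne_zero hκF hz864) (pow_ne_zero _ hq0),
      v.ord_mul hκF hz864, ord_algebraMap, v.ord_pow hq0]
    push_cast; ring
  have o1 : v.ord (Y - 47 * z + 10368) + v.ord (Y + 47 * z - 10368) =
      2 * v.ord (z - 864) + v.ord (z - 144) := by
    rw [← v.ord_mul n1a n1b, e1, v.ord_mul (pow_ne_zero _ hz864) hz144, v.ord_pow hz864]
    push_cast; ring
  have o2 : v.ord (Y + 25 * z) + v.ord (Y - 25 * z) = v.ord z + 2 * v.ord (z - 144) := by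
    rw [← v.ord_mul n2a n2b, e2, v.ord_mul hz0 (pow_ne_zero _ hz144), v.ord_pow hz144]
    push_cast; ring
  have hgoal : v.ord ((Y + g) ^ 8 * (Y - 47 * z + 10368) ^ 4 * z / (Y + 25 * z) ^ 2) =
      8 * v.ord (Y + g) + 4 * v.ord (Y - 47 * z + 10368) + v.ord z - 2 * v.ord (Y + 25 * z) := by
    rw [v.ord_div (mul_ne_zero (mul_ne_zero (pow_ne_zero _ n0a) (pow_ne_zero _ n1a)) hz0)
      (pow_ne_zero _ n2a), v.ord_mul (mul_ne_zero (pow_ne_zero _ n0a) (pow_ne_zero _ n1a)) hz0,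
      v.ord_mul (pow_ne_zero _ n0a) (pow_ne_zero _ n1a), v.ord_pow n0a, v.ord_pow n1a,
      v.ord_pow n2a]
    push_cast; ring
  rw [hgoal]
  by_cases hx : x ∈ v.ring
  · have lz : v.ring.valuation z ≤ 1 := v.valuation_aeval_le hx Z
    have lg : v.ring.valuation g ≤ 1 := v.valuation_aeval_le hx G
    have ls : v.ring.valuation s ≤ 1 := v.valuation_aeval_le hx S
    have hzr := (v.ring.valuation_le_one_iff z).1 lz
    have hgr := (v.ring.valuation_le_one_iff g).1 lg
    have hYr : Y ∈ v.ring := v.mem_ring_of_sq_mem (by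
      rw [hY, ← ValuationSubring.valuation_le_one_iff]; exact v.valuation_aeval_le hx _)
    have hnum : ∀ n : ℕ, (n : F) ∈ v.ring := fun n => natCast_mem _ n
    have r0a := (v.ord_nonneg_iff n0a).2 (add_mem hYr hgr)
    have r0b := (v.ord_nonneg_iff n0b).2 (sub_mem hYr hgr)
    have r1a := (v.ord_nonneg_iff n1a).2
      (add_mem (sub_mem hYr (mul_mem (hnum 47) hzr)) (hnum 10368))
    have r1b := (v.ord_nonneg_iff n1b).2
      (sub_mem (add_mem hYr (mul_mem (hnum 47) hzr)) (hnum 10368))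
    have r2a := (v.ord_nonneg_iff n2a).2 (add_mem hYr (mul_mem (hnum 25) hzr))
    have r2b := (v.ord_nonneg_iff n2b).2 (sub_mem hYr (mul_mem (hnum 25) hzr))
    have rz := (v.ord_nonneg_iff hz0).2 hzr
    have r864 := (v.ord_nonneg_iff hz864).2 (sub_mem hzr (hnum 864))
    have r144 := (v.ord_nonneg_iff hz144).2 (sub_mem hzr (hnum 144))
    have rq := (v.ord_nonneg_iff hq0).2
      ((v.ring.valuation_le_one_iff q).1 (v.valuation_aeval_le hx Q))
    have h2 : v.ring.valuation (2 : F) = 1 := v.valuation_ofNat 2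
    -- `Y` and `Q` have no common zero
    have hdouble : v.ring.valuation q < 1 → v.ring.valuation Y < 1 →
        v.ring.valuation g < 1 → False := by
      intro q1 q2 q3
      refine v.not_valuation_lt_one_of_separable hx hsep ?_ ?_
      · rw [← hY, pow_two]
        exact v.valuation_mul_lt q2.le q2
      · have hd : derivative (Z * (Z + 256) * (Z + 81)) = (2 * derivative G) * G +
            (C κ * (derivative Z * Q + 2 * (Z - 864) * derivative Q)) * Q := by
          rw [hG]
          simp only [derivative_add, derivative_sub, derivative_mul, derivative_pow, derivative_C,
            derivative_ofNat, map_ofNat, Nat.cast_ofNat]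
          ring
        rw [hd, map_add, map_mul (aeval x) _ G, map_mul (aeval x) _ Q]
        exact Valuation.map_add_lt _ (v.valuation_mul_lt (v.valuation_aeval_le hx _) q3)
          (v.valuation_mul_lt (v.valuation_aeval_le hx _) q1)
    have hsum : v.ring.valuation (Y + g) < 1 → v.ring.valuation (Y - g) < 1 →
        v.ring.valuation Y < 1 ∧ v.ring.valuation g < 1 := by
      intro q1 q2
      constructor
      · have := Valuation.map_add_lt _ q1 q2
        rwa [show Y + g + (Y - g) = 2 * Y by ring, map_mul, h2, one_mul] at this
      · have := Valuation.map_sub_lt _ q1 q2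
        rwa [show Y + g - (Y - g) = 2 * g by ring, map_mul, h2, one_mul] at this
    have hqlt : v.ring.valuation (z - 864) = 1 → v.ring.valuation (Y + g) < 1 →
        v.ring.valuation q < 1 := by
      intro q1 q2
      have h3 : v.ring.valuation ((Y - g) * (Y + g)) < 1 :=
        v.valuation_mul_lt ((v.ring.valuation_le_one_iff _).2 (sub_mem hYr hgr)) q2
      rw [mul_comm, e0, map_mul, map_mul, v.valuation_algebraMap hκ, q1, one_mul, one_mul] at h3
      exact v.valuation_lt_of_pow 2 h3
    -- Away from z = 864 the product (Y + g)(Y - g) is a unit times q², and its factors have no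
    -- common zero.
    have hC : v.ring.valuation (z - 864) = 1 → v.ord (Y + g) = 0 ∨ v.ord (Y + g) = 2 * v.ord q := by
      intro q1
      have q2 := v.ord_eq_zero_of_valuation q1
      by_contra! h3
      have h4 : 0 < v.ord (Y + g) := by omega
      have h5 : 0 < v.ord (Y - g) := by omega
      rw [v.ord_pos_iff n0a] at h4
      rw [v.ord_pos_iff n0b] at h5
      obtain ⟨h6, h7⟩ := hsum h4 h5
      exact hdouble (hqlt q1 h4) h6 h7
    rcases lt_or_eq_of_le lz with hzlt | hz1
    · -- `z = 0`
      have u864 : v.ring.valuation (z - 864) = 1 := by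
        rw [Valuation.map_sub_eq_of_lt_right _ (by rwa [v.valuation_ofNat 864])]
        exact v.valuation_ofNat 864
      have u144 : v.ring.valuation (z - 144) = 1 := by
        rw [Valuation.map_sub_eq_of_lt_right _ (by rwa [v.valuation_ofNat 144])]
        exact v.valuation_ofNat 144
      have u256 : v.ring.valuation (z + 256) = 1 := by
        rw [Valuation.map_add_eq_of_lt_right _ (by rwa [v.valuation_ofNat 256])]
        exact v.valuation_ofNat 256
      have u81 : v.ring.valuation (z + 81) = 1 := by
        rw [Valuation.map_add_eq_of_lt_right _ (by rwa [v.valuation_ofNat 81])]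
        exact v.valuation_ofNat 81
      have n256 : z + 256 ≠ 0 := fun h => by rw [h, map_zero] at u256; exact zero_ne_one u256
      have n81 : z + 81 ≠ 0 := fun h => by rw [h, map_zero] at u81; exact zero_ne_one u81
      have nY : Y ≠ 0 := by
        rintro rfl
        rw [zero_pow two_ne_zero] at eY
        exact mul_ne_zero (mul_ne_zero hz0 n256) n81 eY.symm
      have oY : 2 * v.ord Y = v.ord z := by
        have h3 := congrArg v.ord eY
        rw [v.ord_pow nY, v.ord_mul (mul_ne_zero hz0 n256) n81, v.ord_mul hz0 n256,
          v.ord_eq_zero_of_valuation u256, v.ord_eq_zero_of_valuation u81] at h3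
        push_cast at h3
        omega
      have pz := v.ord_pos_of_valuation_lt hz0 hzlt
      have hYlt := (v.ord_pos_iff nY).1 (by omega)
      have a2 : v.ord (Y + 25 * z) = v.ord Y := by
        have h25 : (25 : F) ≠ 0 := fun h => by
          have := v.valuation_ofNat (F := F) 25
          rw [h, map_zero] at this; exact zero_ne_one this
        refine v.ord_add_eq_left nY (mul_ne_zero h25 hz0) ?_
        rw [v.ord_mul h25 hz0, v.ord_eq_zero_of_valuation (v.valuation_ofNat 25)]
        omega
      have a1 := v.ord_eq_zero_of_valuation u864
      have a3 := v.ord_eq_zero_of_valuation u144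
      have a0 : v.ord (Y + g) = 0 := by
        by_contra h3
        have h4 := (v.ord_pos_iff n0a).1 (by omega)
        have h5 : v.ring.valuation g < 1 := by
          have := Valuation.map_sub_lt _ h4 hYlt
          rwa [add_sub_cancel_left] at this
        exact hdouble (hqlt u864 h4) hYlt h5
      omega
    · have oz := v.ord_eq_zero_of_valuation hz1
      rcases lt_or_eq_of_le
        ((v.ring.valuation_le_one_iff _).2 (sub_mem hzr (hnum 864))) with h864 | h864
      · -- `z = 864`
        rw [Nat.cast_ofNat] at h864
        have u144 : v.ring.valuation (z - 144) = 1 := by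
          refine v.valuation_eq_one_of_sub (b := 720) ?_ (v.valuation_ofNat 720)
          rwa [show z - 144 - 720 = z - 864 by ring]
        have a3 := v.ord_eq_zero_of_valuation u144
        -- Over z = 864 the value of Y is 30240 or -30240, while g takes the value -30240. In the
        -- first case Y - g and Y + 47z - 10368 are units, so Y + g and the first tangent line carry
        -- all zeros; in the second case the roles are exchanged.
        have hYY : v.ring.valuation ((Y - 30240) * (Y + 30240)) < 1 := by
          rw [show (Y - 30240) * (Y + 30240) = (z ^ 2 + 1201 * z + 1058400) * (z - 864) by
            linear_combination eY]
          refine v.valuation_mul_lt ((v.ring.valuation_le_one_iff _).2 ?_) h864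
          exact add_mem (add_mem (pow_mem hzr 2) (mul_mem (hnum 1201) hzr)) (hnum 1058400)
        have hg30 : v.ring.valuation (g + 30240) < 1 := by
          rw [eS, mul_comm]
          exact v.valuation_mul_lt ls h864
        have h47 : v.ring.valuation (47 * (z - 864)) < 1 :=
          v.valuation_mul_lt (v.valuation_ofNat 47).le h864
        by_cases hY1 : v.ring.valuation (Y - 30240) < 1
        · have b1 : v.ring.valuation (Y + 47 * z - 10368) = 1 := by
            refine v.valuation_eq_one_of_sub (b := 60480) ?_ (v.valuation_ofNat 60480)
            rw [show Y + 47 * z - 10368 - 60480 = (Y - 30240) + 47 * (z - 864) by ring]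
            exact Valuation.map_add_lt _ hY1 h47
          have b2 : v.ring.valuation (Y - g) = 1 := by
            refine v.valuation_eq_one_of_sub (b := 60480) ?_ (v.valuation_ofNat 60480)
            rw [show Y - g - 60480 = (Y - 30240) - (g + 30240) by ring]
            exact Valuation.map_sub_lt _ hY1 hg30
          have := v.ord_eq_zero_of_valuation b1
          have := v.ord_eq_zero_of_valuation b2
          omega
        · have hY2 : v.ring.valuation (Y + 30240) < 1 := by
            by_contra h3
            rw [map_mul, ← not_le] at hYY
            exact hYY (one_le_mul (not_lt.1 hY1) (not_lt.1 h3))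
          have b1 : v.ring.valuation (-(Y - 47 * z + 10368)) = 1 := by
            refine v.valuation_eq_one_of_sub (b := 60480) ?_ (v.valuation_ofNat 60480)
            rw [show -(Y - 47 * z + 10368) - 60480 = 47 * (z - 864) - (Y + 30240) by ring]
            exact Valuation.map_sub_lt _ h47 hY2
          have b2 : v.ring.valuation (-(Y + g)) = 1 := by
            refine v.valuation_eq_one_of_sub (b := 60480) ?_ (v.valuation_ofNat 60480)
            rw [show -(Y + g) - 60480 = -((Y + 30240) + (g + 30240)) by ring, Valuation.map_neg]
            exact Valuation.map_add_lt _ hY2 hg30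
          rw [Valuation.map_neg] at b1 b2
          have := v.ord_eq_zero_of_valuation b1
          have := v.ord_eq_zero_of_valuation b2
          omega
      · rw [Nat.cast_ofNat] at h864
        have a1 := v.ord_eq_zero_of_valuation h864
        have a0 := hC h864
        rcases lt_or_eq_of_le
          ((v.ring.valuation_le_one_iff _).2 (sub_mem hzr (hnum 144))) with h144 | h144
        · -- `z = 144`
          rw [Nat.cast_ofNat] at h144
          have hYY : v.ring.valuation ((Y - 3600) * (Y + 3600)) < 1 := by
            rw [show (Y - 3600) * (Y + 3600) = (z ^ 2 + 481 * z + 90000) * (z - 144) by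
              linear_combination eY]
            refine v.valuation_mul_lt ((v.ring.valuation_le_one_iff _).2 ?_) h144
            exact add_mem (add_mem (pow_mem hzr 2) (mul_mem (hnum 481) hzr)) (hnum 90000)
          have h47 : v.ring.valuation (47 * (z - 144)) < 1 :=
            v.valuation_mul_lt (v.valuation_ofNat 47).le h144
          have h25 : v.ring.valuation (25 * (z - 144)) < 1 :=
            v.valuation_mul_lt (v.valuation_ofNat 25).le h144
          by_cases hY1 : v.ring.valuation (Y - 3600) < 1
          · have b1 : v.ring.valuation (Y - 47 * z + 10368) = 1 := by
              refine v.valuation_eq_one_of_sub (b := 7200) ?_ (v.valuation_ofNat 7200)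
              rw [show Y - 47 * z + 10368 - 7200 = (Y - 3600) - 47 * (z - 144) by ring]
              exact Valuation.map_sub_lt _ hY1 h47
            have b2 : v.ring.valuation (Y + 25 * z) = 1 := by
              refine v.valuation_eq_one_of_sub (b := 7200) ?_ (v.valuation_ofNat 7200)
              rw [show Y + 25 * z - 7200 = (Y - 3600) + 25 * (z - 144) by ring]
              exact Valuation.map_add_lt _ hY1 h25
            have := v.ord_eq_zero_of_valuation b1
            have := v.ord_eq_zero_of_valuation b2
            omega
          · have hY2 : v.ring.valuation (Y + 3600) < 1 := by
              by_contra h3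
              rw [map_mul, ← not_le] at hYY
              exact hYY (one_le_mul (not_lt.1 hY1) (not_lt.1 h3))
            have b1 : v.ring.valuation (-(Y + 47 * z - 10368)) = 1 := by
              refine v.valuation_eq_one_of_sub (b := 7200) ?_ (v.valuation_ofNat 7200)
              rw [show -(Y + 47 * z - 10368) - 7200 = -((Y + 3600) + 47 * (z - 144)) by ring,
                Valuation.map_neg]
              exact Valuation.map_add_lt _ hY2 h47
            have b2 : v.ring.valuation (-(Y - 25 * z)) = 1 := by
              refine v.valuation_eq_one_of_sub (b := 7200) ?_ (v.valuation_ofNat 7200)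
              rw [show -(Y - 25 * z) - 7200 = 25 * (z - 144) - (Y + 3600) by ring]
              exact Valuation.map_sub_lt _ h25 hY2
            rw [Valuation.map_neg] at b1 b2
            have := v.ord_eq_zero_of_valuation b1
            have := v.ord_eq_zero_of_valuation b2
            omega
        · rw [Nat.cast_ofNat] at h144
          have := v.ord_eq_zero_of_valuation h144
          omega
  · have hx0 : x ≠ 0 := by rintro rfl; exact hx (zero_mem _)
    have hneg : v.ord x < 0 := by
      rw [← v.ord_nonneg_iff hx0] at hx; omega
    have oc : ∀ c : K, v.ord (z + algebraMap K F c) = 2 * v.ord x := fun c => by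
      have := (v.ord_aeval_of_neg hneg _ (hZn c)).2
      rw [hZc c, map_add, aeval_C] at this
      exact_mod_cast this
    have oz : v.ord z = 2 * v.ord x := by simpa using oc 0
    have o864 : v.ord (z - 864) = 2 * v.ord x := by
      have := oc (-864)
      rwa [map_neg, map_ofNat, ← sub_eq_add_neg] at this
    have o144 : v.ord (z - 144) = 2 * v.ord x := by
      have := oc (-144)
      rwa [map_neg, map_ofNat, ← sub_eq_add_neg] at this
    have oq : v.ord q = 2 * v.ord x := by
      have := (v.ord_aeval_of_neg hneg _ hQ0).2
      rw [hQd] at this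
      exact_mod_cast this
    have n256 : z + 256 ≠ 0 := by
      have := hzc 256
      rwa [map_ofNat] at this
    have n81 : z + 81 ≠ 0 := by
      have := hzc 81
      rwa [map_ofNat] at this
    have nY : Y ≠ 0 := by
      rintro rfl
      rw [zero_pow two_ne_zero] at eY
      exact mul_ne_zero (mul_ne_zero hz0 n256) n81 eY.symm
    have oY : v.ord Y = 3 * v.ord x := by
      have h3 := congrArg v.ord eY
      have o256 := oc 256
      have o81 := oc 81
      rw [map_ofNat] at o256 o81
      rw [v.ord_pow nY, v.ord_mul (mul_ne_zero hz0 n256) n81, v.ord_mul hz0 n256, oz, o256,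
        o81] at h3
      push_cast at h3
      omega
    -- At infinity each of the six linear factors in Y has order at least 3 · ord x, and each
    -- conjugate pair sums to 6 · ord x. So all equal 3 · ord x, and the total is (24 + 12 + 2 - 6)
    -- · ord x = 32 · ord x.
    have key : ∀ p : K[X], p.natDegree ≤ 3 → Y + aeval x p ≠ 0 →
        3 * v.ord x ≤ v.ord (Y + aeval x p) := by
      intro p hp hne
      by_cases h0 : aeval x p = 0
      · rw [h0, add_zero]; omega
      · have h1 := v.min_ord_le_ord_add nY h0 hne
        have h2 := v.le_ord_aeval hneg p 3 hp h0
        push_cast at h2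
        omega
    have hlin : ∀ a b : K, (C a * Z + C b).natDegree ≤ 3 := fun a b => by
      rw [natDegree_add_C]
      exact (natDegree_C_mul_le _ _).trans (by omega)
    have k0a : 3 * v.ord x ≤ v.ord (Y + g) := key G hGd n0a
    have k0b := key (-G) (by rwa [natDegree_neg]) (by rwa [map_neg, ← sub_eq_add_neg])
    have k1a := key (C (-47) * Z + C 10368) (hlin _ _)
    have k1b := key (C 47 * Z + C (-10368)) (hlin _ _)
    have k2a := key (C 25 * Z + C 0) (hlin _ _)
    have k2b := key (C (-25) * Z + C 0) (hlin _ _)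
    simp only [map_add, map_mul, map_neg, map_ofNat, map_zero, add_zero, ← hz] at k1a k1b k2a k2b
    rw [map_neg, ← hg] at k0b
    rw [← sub_eq_add_neg] at k0b
    rw [show Y + (-47 * z + 10368) = Y - 47 * z + 10368 by ring] at k1a
    rw [show Y + (47 * z + -10368) = Y + 47 * z - 10368 by ring] at k1b
    rw [show Y + -25 * z = Y - 25 * z by ring] at k2b
    have := k1a n1a
    have := k1b n1b
    have := k2a n2a
    have := k2b n2b
    omega

end Place

/-! ### Functions that are not squares or cubes, and the criterion for order 48. -/

namespace GenusTwoCurve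

variable {k : Type*} [Field k] [CharZero k] (C : GenusTwoCurve k)

/-- A polynomial factor of degree two of `f` is not a square in the function field. -/
theorem sq_ne_aeval_of_mul_eq (hdeg : C.f.natDegree = 6) {Z R : k[X]} (hf : Z * R = C.f)
    (hZ : Z.natDegree = 2) (u : C.FunctionField) : u ^ 2 ≠ aeval C.x Z := by
  intro hu
  have hsq : Squarefree (Z * R) := hf ▸ C.separable.squarefree
  have hZ0 : Z ≠ 0 := by rintro rfl; simp at hZ
  have hf0 := C.f_ne_zero
  rw [← hf] at hf0
  have hR0 : R ≠ 0 := right_ne_zero_of_mul hf0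
  have hR : R.natDegree = 4 := by
    have := natDegree_mul hZ0 hR0
    rw [hf, hdeg, hZ] at this
    omega
  have key : ∀ P p d : k[X], Squarefree P → P.natDegree ≠ 0 → d ≠ 0 → p ^ 2 = d ^ 2 * P →
      False := by
    intro P p d hP hP0 hd h
    obtain ⟨e, rfl⟩ : d ∣ p := (IsIntegrallyClosed.pow_dvd_pow_iff two_ne_zero).1 ⟨P, h⟩
    have he : e ^ 2 = P := mul_left_cancel₀ (pow_ne_zero 2 hd) (by rw [← h]; ring)
    have hu := hP e ⟨1, by rw [← he]; ring⟩
    rw [← he] at hP0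
    exact hP0 (natDegree_eq_zero_of_isUnit (hu.pow 2))
  obtain ⟨p, q, d, hd, rfl⟩ := C.exists_eq_div u
  have hdF := C.aeval_x_ne_zero hd
  rw [div_pow, div_eq_iff (pow_ne_zero 2 hdF)] at hu
  -- The y-coefficient of u² is 2pq/d², so p = 0 or q = 0. Then d² = -(−q²R) = q²R or p² = d²Z, and
  -- neither R nor Z, being squarefree and nonconstant, is a square up to a square factor.
  have h0 := C.eq_zero_of_add_mul_y (p := p ^ 2 + q ^ 2 * C.f - Z * d ^ 2) (q := 2 * p * q) (by
    simp only [map_sub, map_add, map_mul, map_pow, map_ofNat]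
    linear_combination hu - (aeval C.x q) ^ 2 * C.y_sq)
  obtain ⟨h1, h2⟩ := h0
  rcases mul_eq_zero.1 h2 with h3 | rfl
  · have h4 : p = 0 := by
      rcases mul_eq_zero.1 h3 with h5 | h5
      · exact absurd h5 two_ne_zero
      · exact h5
    subst h4
    rw [← hf] at h1
    refine key R d q hsq.of_mul_right (by omega) ?_ ?_
    · rintro rfl
      apply mul_ne_zero hZ0 (pow_ne_zero 2 hd)
      linear_combination -h1
    · exact mul_left_cancel₀ hZ0 (by linear_combination -h1)
  · exact key Z p d hsq.of_mul_left (by omega) hd (by linear_combination h1)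

/-- If `f = g² + c ℓ³` then `y - g(x)` is not a cube in the function field. -/
theorem cube_ne_sub_aeval (hdeg : C.f.natDegree = 6) {g l : k[X]} {c : k} (hc : c ≠ 0)
    (hl : l.natDegree = 2) (hf : C.f = g ^ 2 + Polynomial.C c * l ^ 3) (u : C.FunctionField) :
    u ^ 3 ≠ C.y - aeval C.x g := by
  intro hu
  obtain ⟨p, q, d, hd, rfl⟩ := C.exists_eq_div u
  have hdF := C.aeval_x_ne_zero hd
  rw [div_pow, div_eq_iff (pow_ne_zero 3 hdF)] at hu
  obtain ⟨h1, h2⟩ := C.eq_zero_of_add_mul_y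
    (p := p ^ 3 + 3 * p * q ^ 2 * C.f + d ^ 3 * g) (q := 3 * p ^ 2 * q + q ^ 3 * C.f - d ^ 3) (by
    simp only [map_sub, map_add, map_mul, map_pow, map_ofNat]
    linear_combination hu - (3 * aeval C.x p * aeval C.x q ^ 2 + aeval C.x q ^ 3 * C.y) * C.y_sq)
  -- Norms to k(x): N(u)³ = N(y - g) = g² - f = -cℓ³. Hence N(u) is a polynomial n of degree 2.
  have h3 : (p ^ 2 - q ^ 2 * C.f) ^ 3 = (d ^ 2) ^ 3 * -(Polynomial.C c * l ^ 3) := by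
    have h4 : (p ^ 2 - q ^ 2 * C.f) ^ 3 =
      (p ^ 3 + 3 * p * q ^ 2 * C.f) ^ 2 - C.f * (3 * p ^ 2 * q + q ^ 3 * C.f) ^ 2 := by ring
    rw [h4, eq_neg_of_add_eq_zero_left h1, sub_eq_zero.1 h2]
    linear_combination -d ^ 6 * hf
  obtain ⟨n, hn⟩ : d ^ 2 ∣ p ^ 2 - q ^ 2 * C.f :=
    (IsIntegrallyClosed.pow_dvd_pow_iff three_ne_zero).1 ⟨_, h3⟩
  have hn3 : n ^ 3 = -(Polynomial.C c * l ^ 3) := by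
    rw [hn, mul_pow] at h3
    exact mul_left_cancel₀ (pow_ne_zero 3 (pow_ne_zero 2 hd)) h3
  have hnd : n.natDegree = 2 := by
    have := congrArg natDegree hn3
    rw [natDegree_neg, natDegree_C_mul hc, natDegree_pow, natDegree_pow, hl] at this
    omega
  -- This is the y-coefficient of u³ = y - g after replacing p² by d²n + q²f. With q and d made
  -- coprime, q is a unit, and then d is a unit since its square divides the squarefree f. The
  -- relation now equates a constant multiple of f, of degree 6, with a polynomial of degree at most
  -- 2.
  have hmain : q * (3 * d ^ 2 * n + 4 * q ^ 2 * C.f) = d ^ 3 := by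
    linear_combination h2 - 3 * q * hn
  obtain ⟨d', q', e, hrel, rfl, rfl⟩ :=
    UniqueFactorizationMonoid.exists_reduced_factors d hd q
  have he : e ≠ 0 := left_ne_zero_of_mul hd
  have hmain' : q' * (3 * d' ^ 2 * n + 4 * q' ^ 2 * C.f) = d' ^ 3 :=
    mul_left_cancel₀ (pow_ne_zero 3 he) (by linear_combination hmain)
  have hqu : IsUnit q' := hrel.pow_left (m := 3) ⟨_, hmain'.symm⟩ dvd_rfl
  have hdu : IsUnit d' := by
    have h5 : d' * d' ∣ q' ^ 3 * (4 * C.f) := ⟨d' - 3 * q' * n, by linear_combination hmain'⟩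
    have h6 : IsUnit (4 : k[X]) := by
      have := isUnit_C.2 (IsUnit.mk0 (4 : k) (OfNat.ofNat_ne_zero 4))
      rwa [map_ofNat] at this
    exact C.separable.squarefree d' ((h6.dvd_mul_left).1 (((hqu.pow 3).dvd_mul_left).1 h5))
  obtain ⟨a, ha, rfl⟩ := Polynomial.isUnit_iff.1 hqu
  obtain ⟨b, hb, rfl⟩ := Polynomial.isUnit_iff.1 hdu
  have h7 : Polynomial.C (4 * a ^ 3) * C.f =
      Polynomial.C (b ^ 3) - Polynomial.C (3 * a * b ^ 2) * n := by
    simp only [map_mul, map_pow, map_ofNat]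
    linear_combination hmain'
  have h8 := congrArg natDegree h7
  rw [natDegree_C_mul (mul_ne_zero (OfNat.ofNat_ne_zero 4) (pow_ne_zero 3 ha.ne_zero)), hdeg] at h8
  have h9 := natDegree_sub_le (Polynomial.C (b ^ 3)) (Polynomial.C (3 * a * b ^ 2) * n)
  have h10 := natDegree_C_mul_le (3 * a * b ^ 2) n
  rw [natDegree_C] at h9
  omega

/-- A criterion for the existence of a rational point of order `48` on the Jacobian of
`y² = Z(x) (Z(x) + 256) (Z(x) + 81)`. -/
theorem exists_addOrderOf_eq_48 {Z G Q S g l : k[X]} {κ c : k}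
    (hf : C.f = Z * (Z + 256) * (Z + 81)) (hZ : Z.natDegree = 2)
    (hκ : κ ≠ 0) (hG : C.f = G ^ 2 + Polynomial.C κ * (Z - 864) * Q ^ 2)
    (hS : G + 30240 = (Z - 864) * S) (hGd : G.natDegree ≤ 3) (hQd : Q.natDegree = 2)
    (hc : c ≠ 0) (hg : C.f = g ^ 2 + Polynomial.C c * l ^ 3)
    (hgd : g.natDegree ≤ 3) (hl : l.natDegree = 2) :
    ∃ P : C.JacobianPoints, addOrderOf P = 48 := by
  let i := algebraMap k (AlgebraicClosure k)
  have hi : Function.Injective i := i.injective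
  have hZc : ∀ a : k, (Z + Polynomial.C a).natDegree = 2 := fun a => by rw [natDegree_add_C, hZ]
  have hdeg : C.f.natDegree = 6 := by
    have h1 : ∀ a : k, Z + Polynomial.C a ≠ 0 := fun a h => by
      have := hZc a; rw [h] at this; simp at this
    have h2 := h1 0
    have h3 := h1 256
    have h4 := h1 81
    have d3 := hZc 256
    have d4 := hZc 81
    simp only [map_zero, add_zero, map_ofNat] at h2 h3 h4 d3 d4
    rw [hf, natDegree_mul (mul_ne_zero h2 h3) h4, natDegree_mul h2 h3, hZ, d3, d4]
  have hgf : C.geometric.f = C.f.map i := rfl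
  have hdegK : C.geometric.f.natDegree = 6 := by rw [hgf, natDegree_map, hdeg]
  have fK : C.geometric.f = Z.map i * (Z.map i + 256) * (Z.map i + 81) := by
    rw [hgf, hf]; simp
  have hne3 : C.geometric.y - aeval C.geometric.x (g.map i) ≠ 0 := by
    intro h0
    exact C.geometric.cube_ne_sub_aeval hdegK (g := g.map i) (l := l.map i) (c := i c)
      (by simpa using hc) (by rw [natDegree_map, hl]) (by rw [hgf, hg]; simp) 0
      (by rw [h0]; simp)
  obtain ⟨P3, hP3⟩ := C.exists_addOrderOf_eq
    (C.geometric.y - aeval C.geometric.x (g.map i)) hne3 (by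
      intro σ hσ
      rw [← geometric_aeval_x, map_sub, C.galois_apply_aeval hσ, hσ.2]) 3 three_ne_zero
    (by
      intro v
      refine v.three_dvd_ord C.geometric.transcendental_x (f := C.geometric.f) (l := l.map i)
        (c := i c) (by simpa using hc) C.geometric.y_sq C.geometric.separable hdegK
        (by rwa [natDegree_map]) (by rwa [natDegree_map]) ?_
      rw [hgf, hg]; simp)
    (by
      intro p hp hp3 u
      obtain rfl := (Nat.prime_dvd_prime_iff_eq hp Nat.prime_three).1 hp3
      refine C.geometric.cube_ne_sub_aeval hdegK (l := l.map i) (c := i c)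
        (by simpa using hc) (by rw [natDegree_map, hl]) ?_ u
      rw [hgf, hg]; simp)
  have hyK : C.geometric.y ^ 2 =
      aeval C.geometric.x (Z.map i * (Z.map i + 256) * (Z.map i + 81)) := by
    rw [← fK, y_sq]
  have fKG : Z.map i * (Z.map i + 256) * (Z.map i + 81) =
      G.map i ^ 2 + Polynomial.C (i κ) * (Z.map i - 864) * Q.map i ^ 2 := by
    rw [← fK, hgf, hG]; simp
  have hnsq := C.geometric.sq_ne_aeval_of_mul_eq hdegK (Z := Z.map i)
    (R := (Z.map i + 256) * (Z.map i + 81)) (by rw [fK]; ring) (by rw [natDegree_map, hZ])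
  set z := aeval C.geometric.x (Z.map i) with hz
  set a := C.geometric.y + aeval C.geometric.x (G.map i) with ha
  have hQ0 : Q.map i ≠ 0 := by
    intro h
    rw [Polynomial.map_eq_zero] at h
    rw [h] at hQd
    simp at hQd
  have hlin : ∀ p : (AlgebraicClosure k)[X], C.geometric.y + aeval C.geometric.x p ≠ 0 := by
    intro p h
    have := (C.geometric.eq_zero_of_add_mul_y (p := p) (q := 1) (by
      rw [map_one, one_mul, add_comm]; exact h)).2
    exact one_ne_zero this
  have ha0 : a ≠ 0 := hlin _
  have hb0 : C.geometric.y - 47 * z + 10368 ≠ 0 := by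
    have := hlin (-47 * Z.map i + 10368)
    rwa [map_add, map_mul, map_neg, map_ofNat, map_ofNat, neg_mul, ← add_assoc,
      ← sub_eq_add_neg] at this
  have hc0 : C.geometric.y + 25 * z ≠ 0 := by
    have := hlin (25 * Z.map i)
    rwa [map_mul, map_ofNat] at this
  have hz0 : z ≠ 0 := fun h => hnsq 0 (by rw [h]; simp)
  have hne16 : a ^ 8 * (C.geometric.y - 47 * z + 10368) ^ 4 * z / (C.geometric.y + 25 * z) ^ 2 ≠ 0 :=
    div_ne_zero (mul_ne_zero (mul_ne_zero (pow_ne_zero _ ha0) (pow_ne_zero _ hb0)) hz0)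
      (pow_ne_zero _ hc0)
  obtain ⟨P16, hP16⟩ := C.exists_addOrderOf_eq _ hne16 (by
      intro σ hσ
      have h1 : σ z = z := by rw [hz, ← geometric_aeval_x, C.galois_apply_aeval hσ]
      have h2 : σ a = a := by
        rw [ha, ← geometric_aeval_x, map_add, C.galois_apply_aeval hσ, hσ.2]
      simp only [map_div₀, map_mul, map_pow, map_add, map_sub, map_ofNat, h1, h2, hσ.2]) 16 (by norm_num)
    (by
      intro v
      refine v.sixteen_dvd_ord C.geometric.transcendental_x (Q := Q.map i) (S := S.map i)
        (κ := i κ) (by simpa using hκ) hyK (fK ▸ C.geometric.separable) fKG ?_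
        (by rwa [natDegree_map]) (by rwa [natDegree_map]) (by rwa [natDegree_map])
      have := congrArg (Polynomial.map i) hS
      simpa using this)
    (by
      intro p hp hp16 u hu
      obtain rfl := (Nat.prime_dvd_prime_iff_eq hp Nat.prime_two).1
        (hp.dvd_of_dvd_pow (show p ∣ 2 ^ 4 from hp16))
      -- The function is a square times z, so if it were a square then z would be one too.
      refine hnsq (u * (C.geometric.y + 25 * z) / (a ^ 4 * (C.geometric.y - 47 * z + 10368) ^ 2)) ?_
      rw [div_pow, mul_pow, hu, div_mul_cancel₀ _ (pow_ne_zero 2 hc0),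
        div_eq_iff (pow_ne_zero 2 (mul_ne_zero (pow_ne_zero 4 ha0) (pow_ne_zero 2 hb0)))]
      ring)
  -- The orders 16 and 3 are coprime, so the sum has order 48.
  refine ⟨P16 + P3, ?_⟩
  rw [(AddCommute.all P16 P3).addOrderOf_add_eq_mul_addOrderOf_of_coprime
    (by rw [hP16, hP3]; norm_num), hP16, hP3]

end GenusTwoCurve

/-! ### A family of curves with a point of order `48` -/

/-- The squares of the roots of the sextic are `familyE₀ t / 7`, `(familyE₀ t + 81 m) / 7` and
`(familyE₀ t + 256 m) / 7`, with `m = familyM t`. -/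
def familyE (t : ℚ) : ℚ := -20736 * t ^ 3 * (t + 2)

/-- Together with `familyE` it is chosen so that the sextic has the form g² + cℓ³ identically in t.
The quartic and cubic terms cancel in `familyE t + 81 * familyM t`, leaving -14175(2t + 1). -/
def familyM (t : ℚ) : ℚ := 256 * t ^ 4 + 512 * t ^ 3 - 350 * t - 175

/-- Only x² occurs, so the curves carry the extra involution x ↦ -x, whose quotient is the elliptic
curve with the point of order 8. -/
def familyZ (t : ℚ) : ℚ[X] := C (-7 / familyM t) * X ^ 2 + C (familyE t / familyM t)

theorem eval_familyZ (t x : ℚ) : (familyZ t).eval x = (familyE t - 7 * x ^ 2) / familyM t := by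
  simp [familyZ]; ring

theorem natDegree_familyZ {t : ℚ} (hm : familyM t ≠ 0) : (familyZ t).natDegree = 2 := by
  rw [familyZ, natDegree_add_C, natDegree_C_mul_X_pow]
  exact div_ne_zero (by norm_num) hm

theorem isCoprime_of_sub_eq_C {k : Type*} [Field k] {p q : k[X]} {a : k} (ha : a ≠ 0)
    (h : p - q = C a) : IsCoprime p q :=
  ⟨C a⁻¹, -C a⁻¹, by rw [neg_mul, ← sub_eq_add_neg, ← mul_sub, h, ← C_mul, inv_mul_cancel₀ ha, C_1]⟩

theorem separable_quadratic {k : Type*} [Field k] [CharZero k] {a b : k} (hb : b ≠ 0) :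
    (C a * X ^ 2 + C b).Separable := by
  refine ⟨C b⁻¹, -C (b⁻¹ / 2) * X, ?_⟩
  have h1 : C b⁻¹ * C b = (1 : k[X]) := by rw [← C_mul, inv_mul_cancel₀ hb, C_1]
  have h2 : C (b⁻¹ / 2) * 2 = (C b⁻¹ : k[X]) := by
    rw [← map_ofNat C, ← C_mul, div_mul_cancel₀ _ two_ne_zero]
  simp only [derivative_add, derivative_mul, derivative_C, derivative_X_pow, zero_mul, zero_add,
    add_zero, Nat.cast_ofNat, map_ofNat, Nat.reduceSub, pow_one]
  linear_combination h1 - C a * X ^ 2 * h2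

/-- The data defining a member of the family. -/
structure IsFamilyParameter (t : ℚ) : Prop where
  lt : t < -1 / 2
  gt : -2 < t
  exists_sq_left : ∃ A < 0, 5 * A ^ 2 = -6912 * t ^ 3 * (t + 2)
  exists_sq_right : ∃ B > 0, 2 * B ^ 2 = -675 * (2 * t + 1)

theorem not_sq_eq_mul_sq {n : ℕ} (hn : ¬ IsSquare n) {a b : ℚ} (hb : b ≠ 0) :
    a ^ 2 ≠ n * b ^ 2 := by
  intro h
  apply hn
  rw [← Rat.isSquare_natCast_iff]
  exact ⟨a / b, by field_simp; linarith⟩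

namespace IsFamilyParameter

variable {t : ℚ} (h : IsFamilyParameter t)
include h

/-- In terms of A and B, 27 · `familyM t` = 14B² - 5A². Its vanishing would make 70 a rational
square; the next lemmas use the same device with other nonsquares. -/
theorem familyM_ne_zero : familyM t ≠ 0 := by
  obtain ⟨A, hA0, hA⟩ := h.exists_sq_left
  obtain ⟨B, hB0, hB⟩ := h.exists_sq_right
  intro hm
  refine not_sq_eq_mul_sq (n := 70) (by norm_num) hB0.ne' (a := 5 * A) ?_
  rw [familyM] at hm
  push_cast
  linear_combination 5 * hA - 35 * hB - 27 * 5 * hm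

theorem familyE_ne_zero : familyE t ≠ 0 := by
  obtain ⟨A, hA0, hA⟩ := h.exists_sq_left
  rw [familyE]
  have := pow_ne_zero 2 hA0.ne
  intro h0
  apply this
  linear_combination (hA + h0 / 3) / 5

theorem add_left_ne_zero : familyE t + 256 * familyM t ≠ 0 := by
  obtain ⟨A, hA0, hA⟩ := h.exists_sq_left
  obtain ⟨B, hB0, hB⟩ := h.exists_sq_right
  intro h0
  refine not_sq_eq_mul_sq (n := 10) (by norm_num) (b := 16 * B) (by positivity) (a := 25 * A) ?_
  rw [familyM, familyE] at h0
  push_cast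
  linear_combination 125 * hA - 1280 * hB - 135 / 7 * h0

theorem add_right_ne_zero : familyE t + 81 * familyM t ≠ 0 := by
  obtain ⟨B, hB0, hB⟩ := h.exists_sq_right
  intro h0
  apply pow_ne_zero 2 hB0.ne'
  rw [familyM, familyE] at h0
  linear_combination (hB + h0 / 21) / 2

theorem separable : (familyZ t * (familyZ t + 256) * (familyZ t + 81)).Separable := by
  have hm := h.familyM_ne_zero
  have key : ∀ c : ℚ, familyE t + c * familyM t ≠ 0 → (familyZ t + C c).Separable := by
    intro c hc
    have : familyZ t + C c = C (-7 / familyM t) * X ^ 2 +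
        C ((familyE t + c * familyM t) / familyM t) := by
      rw [familyZ, add_div, mul_div_cancel_right₀ _ hm, C_add, add_assoc]
    rw [this]
    exact separable_quadratic (div_ne_zero hc hm)
  have h0 := key 0 (by simpa using h.familyE_ne_zero)
  have h1 := key 256 h.add_left_ne_zero
  have h2 := key 81 h.add_right_ne_zero
  simp only [map_zero, add_zero, map_ofNat] at h0 h1 h2
  refine (h0.mul h1 ?_).mul h2 (IsCoprime.mul_left ?_ ?_)
  · exact isCoprime_of_sub_eq_C (a := -256) (by norm_num) (by
      simp only [map_neg, map_ofNat]; ring)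
  · exact isCoprime_of_sub_eq_C (a := -81) (by norm_num) (by
      simp only [map_neg, map_ofNat]; ring)
  · exact isCoprime_of_sub_eq_C (a := 175) (by norm_num) (by
      simp only [map_ofNat]; ring)

theorem natDegree_sextic :
    (familyZ t * (familyZ t + 256) * (familyZ t + 81)).natDegree = 6 := by
  have h1 : ∀ c : ℚ, (familyZ t + C c).natDegree = 2 ∧ familyZ t + C c ≠ 0 := by
    intro c
    have : (familyZ t + C c).natDegree = 2 := by
      rw [natDegree_add_C, natDegree_familyZ h.familyM_ne_zero]
    exact ⟨this, fun h0 => by rw [h0] at this; simp at this⟩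
  have h0 := h1 0
  have h2 := h1 256
  have h3 := h1 81
  simp only [map_zero, add_zero, map_ofNat] at h0 h2 h3
  rw [natDegree_mul (mul_ne_zero h0.2 h2.2) h3.2, natDegree_mul h0.2 h2.2, h0.1, h2.1, h3.1]

/-- The member of the family with parameter `t`. -/
def curve : GenusTwoCurve ℚ where
  f := familyZ t * (familyZ t + 256) * (familyZ t + 81)
  separable := h.separable
  degree := Or.inr h.natDegree_sextic

/-- The identity f = g² + cℓ³ needs only t; the identity f = G² + κ(Z - 864)Q² needs the square
roots A and B, in which `familyE t` is 15A² and `familyM t` is (14B² - 5A²)/27. -/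
theorem exists_addOrderOf_eq_48 : ∃ P : h.curve.JacobianPoints, addOrderOf P = 48 := by
  obtain ⟨A, hA0, hA⟩ := h.exists_sq_left
  obtain ⟨B, hB0, hB⟩ := h.exists_sq_right
  have hm := h.familyM_ne_zero
  have hE := h.familyE_ne_zero
  have ht1 := h.lt
  have ht2 := h.gt
  have hE' : familyE t = 15 * A ^ 2 := by rw [familyE]; linear_combination -3 * hA
  have hM' : familyM t = (14 * B ^ 2 - 5 * A ^ 2) / 27 := by
    rw [familyM]; linear_combination (hA - 7 * hB) / 27
  -- The signs A < 0 < B were prescribed so that this and the next denominator are positive.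
  have hδ : 8 * B - 5 * A ≠ 0 := by linarith
  have hδ' : 7 * B - 4 * A ≠ 0 := by linarith
  have ht0 : t ≠ 0 := by linarith
  have hu : (2 * t + 1) * (t - 1) * (t + 2) * t * (t + 1) ≠ 0 := by
    have h1 : 2 * t + 1 ≠ 0 := by linarith
    have h2 : t - 1 ≠ 0 := by linarith
    have h3 : t + 2 ≠ 0 := by linarith
    have h4 : t + 1 ≠ 0 := by
      intro h4
      refine not_sq_eq_mul_sq (n := 6) (by norm_num) (b := 15) (by norm_num) (a := 2 * B) ?_
      push_cast
      linear_combination 2 * hB - 2700 * h4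
    exact mul_ne_zero (mul_ne_zero (mul_ne_zero (mul_ne_zero h1 h2) h3) ht0) h4
  -- Up to sign this is the leading coefficient of ℓ. A rational root t would make 51361 = 81² + 256
  -- · 175 a square.
  have hl : 256 * t ^ 2 + 162 * t - 175 ≠ 0 := by
    intro h0
    refine not_sq_eq_mul_sq (n := 51361) (by norm_num) (b := 1) one_ne_zero (a := 256 * t + 81) ?_
    push_cast
    linear_combination 256 * h0
  obtain ⟨m, hmdef⟩ : ∃ m, m = familyM t := ⟨_, rfl⟩
  obtain ⟨δ, hδdef⟩ : ∃ δ, δ = 8 * B - 5 * A := ⟨_, rfl⟩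
  obtain ⟨u, hudef⟩ : ∃ u, u = (2 * t + 1) * (t - 1) * (t + 2) * t * (t + 1) := ⟨_, rfl⟩
  rw [← hudef] at hu
  rw [← hδdef] at hδ
  have hm' := hm
  rw [← hmdef] at hM' hm'
  refine h.curve.exists_addOrderOf_eq_48 (Z := familyZ t)
    (G := C (1 / (3 * m * δ)) * (189 * X ^ 3 + C (840 * (7 * B - 4 * A)) * X ^ 2 +
      C (12096 * B ^ 2 - 4725 * A ^ 2) * X + C (2520 * A * B * δ)))
    (Q := C (3 * (7 * B - 4 * A)) * X ^ 2 + C (108 * m) * X + C (9 * A * B * δ))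
    -- G is (Z - 864)S - 30240 with S linear, so that f - G² is divisible by Z - 864; these
    -- coefficients make the quartic cofactor a constant times Q².
    (S := C (-1 / δ) * (9 * X + C (40 * (7 * B - 4 * A))))
    (g := C (7 / (m * (720 * u))) * X *
      (C (t ^ 2 + t + 1) * (C (518400 * (2 * t + 1) * t * (t ^ 2 - 1) * (t + 2)) -
        C (256 * t ^ 2 + 162 * t - 175) * X ^ 2) + C m * X ^ 2))
    (l := C (518400 * (2 * t + 1) * t * (t ^ 2 - 1) * (t + 2)) -
        C (256 * t ^ 2 + 162 * t - 175) * X ^ 2)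
    (κ := 70 / (9 * m ^ 2 * δ ^ 2))
    (c := 49 * (t * (t + 1)) ^ 2 / (m ^ 3 * (720 * u) ^ 2))
    rfl (natDegree_familyZ hm) ?_ ?_ ?_ ?_ ?_ ?_ ?_ ?_ ?_
  · positivity
  · refine Polynomial.funext fun x => ?_
    simp only [curve, eval_mul, eval_add, eval_sub, eval_pow, eval_C, eval_X, eval_ofNat,
      eval_familyZ, ← hmdef, hE']
    field_simp
    rw [hM', hδdef]
    ring
  · refine Polynomial.funext fun x => ?_
    simp only [eval_mul, eval_add, eval_sub, eval_pow, eval_C, eval_X, eval_ofNat,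
      eval_familyZ, ← hmdef, hE']
    field_simp
    rw [hM', hδdef]
    ring
  · refine (natDegree_C_mul_le _ _).trans ?_
    compute_degree
  · compute_degree!
  · have h1 : t * (t + 1) ≠ 0 := by
      intro h1
      apply hu
      rw [hudef, mul_assoc, h1, mul_zero]
    positivity
  · refine Polynomial.funext fun x => ?_
    simp only [curve, eval_mul, eval_add, eval_sub, eval_pow, eval_C, eval_X, eval_ofNat,
      eval_familyZ, ← hmdef]
    field_simp
    rw [hudef, hmdef, familyM, familyE]
    ring
  · compute_degree
  · compute_degree!
    exact fun h0 => hl (by linear_combination -h0)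

end IsFamilyParameter

/-! ### Isomorphisms of curves of genus two -/

/-- Pseudo-division: each division step is first multiplied by the leading coefficient of G, so no
fractions are needed. -/
theorem Polynomial.exists_C_mul_eq_mul_add {R : Type*} [CommRing R] [IsDomain R] {G : R[X]}
    (hG : G ≠ 0) (H : R[X]) :
    ∃ (d : R) (Q S : R[X]), d ≠ 0 ∧ C d * H = G * Q + S ∧ S.degree < G.degree := by
  suffices h : ∀ (n : ℕ) (H : R[X]), H.degree < n →
      ∃ (d : R) (Q S : R[X]), d ≠ 0 ∧ C d * H = G * Q + S ∧ S.degree < G.degree by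
    exact h (H.natDegree + 1) H (lt_of_le_of_lt degree_le_natDegree (by exact_mod_cast Nat.lt_succ_self _))
  intro n
  induction n with
  | zero =>
    intro H hH
    refine ⟨1, 0, 0, one_ne_zero, ?_, by simpa [bot_lt_iff_ne_bot] using hG⟩
    have : H = 0 := by
      by_contra h0
      have := zero_le_degree_iff.2 h0
      exact absurd hH (not_lt.2 (by simpa using this))
    simp [this]
  | succ n ih =>
    intro H hH
    by_cases hlt : H.degree < G.degree
    · exact ⟨1, 0, H, one_ne_zero, by simp, hlt⟩
    have hH0 : H ≠ 0 := by
      rintro rfl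
      exact hlt (by simpa [bot_lt_iff_ne_bot] using hG)
    have hle : G.natDegree ≤ H.natDegree := natDegree_le_natDegree (not_lt.1 hlt)
    have hlG := leadingCoeff_ne_zero.2 hG
    have hlH := leadingCoeff_ne_zero.2 hH0
    set q := C H.leadingCoeff * X ^ (H.natDegree - G.natDegree) with hq
    have hdeg : (C G.leadingCoeff * H).degree = (q * G).degree := by
      rw [degree_C_mul hlG, degree_mul, hq, degree_C_mul_X_pow _ hlH, degree_eq_natDegree hH0,
        degree_eq_natDegree hG]
      norm_cast
      omega
    have h1 : (C G.leadingCoeff * H - q * G).degree < H.degree := by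
      rw [← degree_C_mul hlG (p := H)]
      refine degree_sub_lt_left hdeg (mul_ne_zero (by simpa using hlG) hH0) ?_
      rw [leadingCoeff_mul, leadingCoeff_mul, hq, leadingCoeff_C_mul_X_pow, leadingCoeff_C,
        mul_comm]
    have h2 : (C G.leadingCoeff * H - q * G).degree < n := by
      refine h1.trans_le ?_
      rw [degree_eq_natDegree hH0] at hH ⊢
      norm_cast at hH ⊢
      omega
    obtain ⟨d, Q, S, hd, h3, h4⟩ := ih _ h2
    exact ⟨d * G.leadingCoeff, Q + C d * q, S, mul_ne_zero hd hlG, by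
      rw [C_mul]; linear_combination h3, h4⟩

theorem Polynomial.coeff_coeff_swap {R : Type*} [CommSemiring R] (p : R[X][X]) (i j : ℕ) :
    ((Bivariate.swap p).coeff i).coeff j = (p.coeff j).coeff i := by
  induction p using Polynomial.induction_on' with
  | add p q hp hq => simp only [map_add, coeff_add, hp, hq]
  | monomial n a =>
    induction a using Polynomial.induction_on' with
    | add p q hp hq => simp only [map_add, coeff_add, hp, hq]
    | monomial m r =>
      rw [Bivariate.swap_monomial_monomial]
      simp only [coeff_monomial]
      split_ifs <;> simp_all [coeff_monomial]

/-- The degrees of the coefficients of a divisor are bounded by those of a multiple. -/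
theorem Polynomial.natDegree_coeff_le_of_dvd {R : Type*} [CommRing R] [IsDomain R] {G H : R[X][X]}
    (hH : H ≠ 0) (hdvd : G ∣ H) {n : ℕ} (hn : ∀ i, (H.coeff i).natDegree ≤ n) (i : ℕ) :
    (G.coeff i).natDegree ≤ n := by
  -- The bound is on the degree in the inner variable, which becomes the outer degree after swapping
  -- variables and is then additive on products.
  have key : ∀ P : R[X][X], (∀ i, (P.coeff i).natDegree ≤ n) ↔
      (Bivariate.swap P).natDegree ≤ n := by
    intro P
    rw [natDegree_le_iff_coeff_eq_zero]
    constructor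
    · intro h m hm
      ext j
      rw [coeff_coeff_swap, coeff_zero]
      exact coeff_eq_zero_of_natDegree_lt ((h j).trans_lt hm)
    · intro h i
      rw [natDegree_le_iff_coeff_eq_zero]
      intro m hm
      rw [← coeff_coeff_swap, h m hm, coeff_zero]
  refine (key G).2 ?_ i
  obtain ⟨W, rfl⟩ := hdvd
  have h1 := (key _).1 hn
  obtain ⟨h2, h3⟩ := mul_ne_zero_iff.1 hH
  rw [map_mul, natDegree_mul (by simpa using h2) (by simpa using h3)] at h1
  omega

/-- A primitive polynomial `G` over `k[X]` of least degree with `G(x, u) = 0` divides every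
polynomial `H` with `H(x, u) = 0`. -/
theorem Polynomial.IsPrimitive.dvd_of_aevalAeval_eq_zero {k F : Type*} [Field k] [Field F]
    [Algebra k F] {x u : F} {G H : k[X][X]} (hG : G.IsPrimitive)
    (hG0 : aevalAeval x u G = 0)
    (hmin : ∀ S : k[X][X], S.degree < G.degree → aevalAeval x u S = 0 → S = 0)
    (hH : aevalAeval x u H = 0) : G ∣ H := by
  obtain ⟨d, Q, S, hd, h1, h2⟩ := exists_C_mul_eq_mul_add hG.ne_zero H
  have h3 := congrArg (aevalAeval x u) h1
  rw [map_mul, map_add, map_mul, hH, hG0, mul_zero, zero_mul, zero_add] at h3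
  rw [hmin S h2 h3.symm, add_zero] at h1
  refine hG.dvd_of_fraction_map_dvd_fraction_map (K := FractionRing k[X]) ?_
  have h4 : G.map (algebraMap k[X] (FractionRing k[X])) ∣
      (C d * H).map (algebraMap k[X] (FractionRing k[X])) := by
    rw [h1, Polynomial.map_mul]
    exact dvd_mul_right _ _
  rw [Polynomial.map_mul, map_C] at h4
  refine (IsUnit.dvd_mul_left ?_).1 h4
  rw [isUnit_C, isUnit_iff_ne_zero]
  simpa using hd

theorem Polynomial.exists_eq_sq_mul_of_squarefree {k : Type*} [Field k] {f N d E : k[X]}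
    (hf : Squarefree f) (hd : d ≠ 0) (h : N ^ 2 * f = d ^ 2 * E) : ∃ s, E = s ^ 2 * f := by
  obtain ⟨d', N', e, hrel, rfl, rfl⟩ := UniqueFactorizationMonoid.exists_reduced_factors d hd N
  have he : e ≠ 0 := left_ne_zero_of_mul hd
  have h' : N' ^ 2 * f = d' ^ 2 * E :=
    mul_left_cancel₀ (pow_ne_zero 2 he) (by linear_combination h)
  have h1 : d' ^ 2 ∣ f := by
    refine IsRelPrime.dvd_of_dvd_mul_left (hrel.pow) (Dvd.intro _ h'.symm)
  have h2 : IsUnit d' := hf d' (by rwa [← pow_two])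
  obtain ⟨c, hc, rfl⟩ := Polynomial.isUnit_iff.1 h2
  refine ⟨C c⁻¹ * N', ?_⟩
  have h3 : C c⁻¹ * C c = (1 : k[X]) := by rw [← C_mul, inv_mul_cancel₀ hc.ne_zero, C_1]
  linear_combination (-C c⁻¹ ^ 2) * h' - E * (C c⁻¹ * C c + 1) * h3

namespace GenusTwoCurve

variable {k : Type*} [Field k] [CharZero k] (C : GenusTwoCurve k)

/-- The hyperelliptic map is the only map of degree two: a function `u` over which `x` is quadratic
is a rational function of `x`. -/
theorem exists_eq_aeval_div (hdeg : C.f.natDegree = 6) (u : C.FunctionField) {H : k[X][X]}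
    (hH : H ≠ 0) (hd : ∀ i, (H.coeff i).natDegree ≤ 2) (h : aevalAeval C.x u H = 0) :
    ∃ p r : k[X], r ≠ 0 ∧ u = aeval C.x p / aeval C.x r := by
  obtain ⟨p, q, r, hr, hu⟩ := C.exists_eq_div u
  by_cases hq : q = 0
  · exact ⟨p, r, hr, by rw [hu, hq]; simp⟩
  exfalso
  let := Classical.arbitrary (NormalizedGCDMonoid k[X])
  have hrF := C.aeval_x_ne_zero hr
  have hur : u * aeval C.x r = aeval C.x p + aeval C.x q * C.y := by
    rw [hu, div_mul_cancel₀ _ hrF]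
  -- This is the quadratic relation of u = (p + qy)/r over k(x), with q nonzero. Its primitive part
  -- divides H, hence has coefficients of degree at most 2 in x and a discriminant of degree at most
  -- 4.
  set G₀ : k[X][X] := Polynomial.C (r ^ 2) * X ^ 2 + Polynomial.C (-2 * p * r) * X +
    Polynomial.C (p ^ 2 - q ^ 2 * C.f) with hG₀
  set c := G₀.content with hc
  set G := G₀.primPart with hG
  have hcG : G₀ = Polynomial.C c * G := G₀.eq_C_content_mul_primPart
  have hr2 : r ^ 2 ≠ 0 := pow_ne_zero 2 hr
  have hGdeg : G.natDegree = 2 := by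
    rw [hG, natDegree_primPart, hG₀, natDegree_quadratic hr2]
  have hG₀0 : aevalAeval C.x u G₀ = 0 := by
    simp only [hG₀, map_add, map_mul, map_pow, aevalAeval_C, aevalAeval_Y, map_sub, map_neg,
      map_ofNat]
    linear_combination (u * aeval C.x r - aeval C.x p + aeval C.x q * C.y) * hur +
      aeval C.x q ^ 2 * C.y_sq
  have hc0 : c ≠ 0 := by
    intro h0
    rw [h0, map_zero, zero_mul] at hcG
    have := natDegree_quadratic (b := -2 * p * r) (c := p ^ 2 - q ^ 2 * C.f) hr2
    rw [← hG₀, hcG] at this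
    simp at this
  have hG0 : aevalAeval C.x u G = 0 := by
    rw [hcG, map_mul, aevalAeval_C] at hG₀0
    exact (mul_eq_zero.1 hG₀0).resolve_left (C.aeval_x_ne_zero hc0)
  have hGH : G ∣ H := by
    refine (isPrimitive_primPart G₀).dvd_of_aevalAeval_eq_zero hG0 ?_ h
    intro S hS hS0
    have hS1 : S.natDegree ≤ 1 := by
      rw [degree_eq_natDegree (isPrimitive_primPart G₀).ne_zero, ← hG, hGdeg] at hS
      exact natDegree_le_of_degree_le (Order.le_of_lt_succ (by exact_mod_cast hS))
    rw [eq_X_add_C_of_natDegree_le_one hS1] at hS0 ⊢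
    simp only [map_add, map_mul, aevalAeval_C, aevalAeval_Y] at hS0
    obtain ⟨h1, h2⟩ := C.eq_zero_of_add_mul_y (p := S.coeff 1 * p + S.coeff 0 * r)
      (q := S.coeff 1 * q) (by
        simp only [map_add, map_mul]
        linear_combination aeval C.x r * hS0 - aeval C.x (S.coeff 1) * hur)
    have h3 := (mul_eq_zero.1 h2).resolve_right hq
    rw [h3, zero_mul, zero_add] at h1
    have h4 := (mul_eq_zero.1 h1).resolve_right hr
    simp [h3, h4]
  have hcoef := natDegree_coeff_le_of_dvd hH hGH hd
  have hco : ∀ a b c : k[X],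
      (Polynomial.C a * X ^ 2 + Polynomial.C b * X + Polynomial.C c).coeff 2 = a ∧
      (Polynomial.C a * X ^ 2 + Polynomial.C b * X + Polynomial.C c).coeff 1 = b ∧
      (Polynomial.C a * X ^ 2 + Polynomial.C b * X + Polynomial.C c).coeff 0 = c := fun a b c => by
    simp [coeff_X, coeff_C]
  have e2 : r ^ 2 = c * G.coeff 2 := by
    rw [← coeff_C_mul, ← hcG, hG₀, (hco _ _ _).1]
  have e1 : -2 * p * r = c * G.coeff 1 := by
    rw [← coeff_C_mul, ← hcG, hG₀, (hco _ _ _).2.1]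
  have e0 : p ^ 2 - q ^ 2 * C.f = c * G.coeff 0 := by
    rw [← coeff_C_mul, ← hcG, hG₀, (hco _ _ _).2.2]
  -- The discriminant equals f up to squares. As f is squarefree, it is a polynomial square times f
  -- and has degree at least 6, a contradiction.
  have e : (2 * q * r) ^ 2 * C.f = c ^ 2 * (G.coeff 1 ^ 2 - 4 * G.coeff 2 * G.coeff 0) := by
    linear_combination (-2 * p * r + c * G.coeff 1) * e1 - 4 * (p ^ 2 - q ^ 2 * C.f) * e2 -
      4 * c * G.coeff 2 * e0
  obtain ⟨s, hs⟩ := exists_eq_sq_mul_of_squarefree C.separable.squarefree hc0 e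
  have hs0 : s ≠ 0 := by
    rintro rfl
    rw [hs] at e
    have := C.f_ne_zero
    have h2 : (2 : k[X]) ≠ 0 := two_ne_zero
    simp [hq, hr, this] at e
  have hdisc : (G.coeff 1 ^ 2 - 4 * G.coeff 2 * G.coeff 0).natDegree ≤ 4 := by
    refine (natDegree_sub_le _ _).trans (max_le ?_ ?_)
    · exact natDegree_pow_le.trans (by have := hcoef 1; omega)
    · refine natDegree_mul_le.trans ?_
      have h1 : (4 * G.coeff 2).natDegree ≤ (G.coeff 2).natDegree := by
        rw [← map_ofNat Polynomial.C]
        exact natDegree_C_mul_le _ _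
      have := hcoef 2
      have := hcoef 0
      omega
  rw [hs, natDegree_mul (pow_ne_zero 2 hs0) C.f_ne_zero, hdeg] at hdisc
  omega

/-- If moreover `x` is a rational function of `u`, then `u` is a fractional linear function
of `x`. -/
theorem natDegree_le_one_of_eq_aeval_div {u : C.FunctionField} {p r p' r' : k[X]}
    (hpr : IsCoprime p r) (hr : r ≠ 0) (hu : u = aeval C.x p / aeval C.x r)
    (hr' : aeval u r' ≠ 0) (hx : C.x = aeval u p' / aeval u r') :
    p.natDegree ≤ 1 ∧ r.natDegree ≤ 1 := by
  have hrF := C.aeval_x_ne_zero hr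
  have hr'0 : r' ≠ 0 := by rintro rfl; simp at hr'
  have hprim : (Polynomial.C r * X - Polynomial.C p : k[X][X]).IsPrimitive := by
    rw [isPrimitive_iff_isUnit_of_C_dvd]
    intro d hd
    rw [C_dvd_iff_dvd_coeff] at hd
    have h0 := hd 0
    have h1 := hd 1
    simp [coeff_C] at h0 h1
    exact hpr.isUnit_of_dvd' h0 h1
  have hdeg : (Polynomial.C r * X - Polynomial.C p : k[X][X]).degree = 1 := by
    rw [sub_eq_add_neg, ← C_neg, degree_linear hr]
  -- The primitive relation r(X)Y - p(X) between x and u divides r'(Y)X - p'(Y), which has degree at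
  -- most 1 in X.
  have hdvd := hprim.dvd_of_aevalAeval_eq_zero (x := C.x) (u := u)
    (H := r'.map Polynomial.C * Polynomial.C X - p'.map Polynomial.C) (by
      simp only [map_sub, map_mul, aevalAeval_C, aevalAeval_Y, hu, mul_div_cancel₀ _ hrF, sub_self])
    (by
      intro S hS hS0
      rw [hdeg] at hS
      have : S.degree ≤ 0 := Nat.WithBot.lt_one_iff_le_zero.1 hS
      rw [eq_C_of_degree_le_zero this, aevalAeval_C] at hS0
      rw [eq_C_of_degree_le_zero this]
      by_contra h0
      exact C.aeval_x_ne_zero (fun h => h0 (by rw [h, map_zero])) hS0)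
    (by
      have hmap : ∀ p : k[X], aevalAeval C.x u (p.map Polynomial.C) = aeval u p := by
        intro p
        rw [← Bivariate.swap_C, Bivariate.aevalAeval_swap, aevalAeval_C]
      rw [map_sub, map_mul, hmap, hmap, aevalAeval_C, aeval_X, sub_eq_zero]
      conv_lhs => rw [hx]
      rw [mul_div_cancel₀ _ hr'])
  have hcoef : ∀ i, (r'.map Polynomial.C * Polynomial.C X - p'.map Polynomial.C).coeff i =
      Polynomial.C (r'.coeff i) * X + Polynomial.C (-p'.coeff i) := by
    intro i; simp [sub_eq_add_neg]
  have hne : r'.map Polynomial.C * Polynomial.C X - p'.map Polynomial.C ≠ 0 := by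
    intro h0
    apply hr'0
    ext i
    have := hcoef i
    rw [h0, coeff_zero] at this
    have := congrArg (fun P => coeff P 1) this
    simpa [coeff_C] using this.symm
  have hb := natDegree_coeff_le_of_dvd hne hdvd (n := 1) (fun i => by
    rw [hcoef]; exact natDegree_linear_le)
  have h0 := hb 0
  have h1 := hb 1
  simp [coeff_C] at h0 h1
  exact ⟨h0, h1⟩

end GenusTwoCurve

theorem Polynomial.aeval_homogenization {k : Type*} [Field k] {f p r : k[X]} {n : ℕ} (hf : f.natDegree ≤ n) {L : Type*} [Field L]
    [Algebra k L] {w : L} (hw : aeval w r ≠ 0) :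
    aeval w (∑ i ∈ Finset.range (n + 1), C (f.coeff i) * p ^ i * r ^ (n - i)) =
      aeval w r ^ n * aeval (aeval w p / aeval w r) f := by
  rw [aeval_eq_sum_range' (n := n + 1) (p := f) (by omega), map_sum, Finset.mul_sum]
  refine Finset.sum_congr rfl fun i hi => ?_
  have hi' : i + (n - i) = n := by rw [Finset.mem_range] at hi; omega
  rw [map_mul, map_mul, map_pow, map_pow, aeval_C, Algebra.smul_def, div_pow]
  conv_rhs => rw [← hi', pow_add]
  field_simp

namespace GenusTwoCurve

variable {k : Type*} [Field k] [CharZero k]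

open IntermediateField in
theorem y_notMem_adjoin_x (C : GenusTwoCurve k) : C.y ∉ k⟮C.x⟯ := by
  intro h
  rw [mem_adjoin_simple_iff] at h
  obtain ⟨p, r, h⟩ := h
  by_cases hr : r = 0
  · rw [hr, map_zero, div_zero] at h
    have := (C.eq_zero_of_add_mul_y (p := 0) (q := 1) (by simp [h])).2
    exact one_ne_zero this
  · rw [eq_div_iff (C.aeval_x_ne_zero hr)] at h
    exact hr (C.eq_zero_of_add_mul_y (p := -p) (q := r) (by
      rw [map_neg]; linear_combination h)).2

/-- An isomorphism of curves of genus two is a fractional linear transformation in the coordinate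
`x`: the image of `x` is `p(x) / r(x)`. -/
theorem exists_eq_of_algEquiv {C C' : GenusTwoCurve k} (hC' : C'.f.natDegree = 6) (σ : C.FunctionField ≃ₐ[k] C'.FunctionField) :
    ∃ p r : k[X], r ≠ 0 ∧ IsCoprime p r ∧ σ C.x = aeval C'.x p / aeval C'.x r := by
  obtain ⟨p, q, r, hr, hx⟩ := C.exists_eq_div (σ.symm C'.x)
  have hσ : ∀ p : k[X], σ (aeval C.x p) = aeval (σ C.x) p := fun p => by
    rw [← AlgEquiv.coe_toAlgHom, ← aeval_algHom_apply, AlgEquiv.coe_toAlgHom]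
  have hr0 := C.aeval_x_ne_zero hr
  rw [eq_div_iff hr0] at hx
  -- The preimage of x' is quadratic over k(x); transported by σ, this says that x' is quadratic
  -- over k(σx), as needed to see that σx lies in k(x').
  have hrel : aeval (σ C.x) r ^ 2 * C'.x ^ 2 - 2 * aeval (σ C.x) p * aeval (σ C.x) r * C'.x +
      aeval (σ C.x) (p ^ 2 - q ^ 2 * C.f) = 0 := by
    have h1 : aeval C.x r ^ 2 * σ.symm C'.x ^ 2 - 2 * aeval C.x p * aeval C.x r * σ.symm C'.x +
        aeval C.x (p ^ 2 - q ^ 2 * C.f) = 0 := by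
      simp only [map_sub, map_mul, map_pow]
      linear_combination (σ.symm C'.x * aeval C.x r - aeval C.x p + aeval C.x q * C.y) * hx +
        aeval C.x q ^ 2 * C.y_sq
    have h2 := congrArg σ h1
    simpa only [map_add, map_sub, map_mul, map_pow, hσ, map_ofNat, map_zero,
      AlgEquiv.apply_symm_apply] using h2
  have hmap : ∀ p : k[X], aevalAeval C'.x (σ C.x) (p.map Polynomial.C) = aeval (σ C.x) p := by
    intro p
    rw [← Bivariate.swap_C, Bivariate.aevalAeval_swap, aevalAeval_C]
  have hcoef : ∀ a b c : k[X], ∀ i, (a.map Polynomial.C * Polynomial.C (X ^ 2) +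
      b.map Polynomial.C * Polynomial.C X + c.map Polynomial.C).coeff i =
      Polynomial.C (a.coeff i) * X ^ 2 + Polynomial.C (b.coeff i) * X +
        Polynomial.C (c.coeff i) := by
    intro a b c i
    simp only [coeff_add, coeff_mul_C, coeff_map]
  have hne : ((r ^ 2).map Polynomial.C * Polynomial.C (X ^ 2) +
      (-2 * p * r).map Polynomial.C * Polynomial.C X +
      (p ^ 2 - q ^ 2 * C.f).map Polynomial.C : k[X][X]) ≠ 0 := by
    intro h0
    apply pow_ne_zero 2 hr
    ext i
    have h1 := hcoef (r ^ 2) (-2 * p * r) (p ^ 2 - q ^ 2 * C.f) i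
    rw [h0, coeff_zero] at h1
    have h2 := congrArg (fun P => coeff P 2) h1
    simpa [coeff_C, coeff_X] using h2.symm
  obtain ⟨p₁, r₁, hr₁, hu⟩ := C'.exists_eq_aeval_div hC' (σ C.x) hne
    (fun i => by rw [hcoef]; exact natDegree_quadratic_le)
    (by
      rw [map_add, map_add, map_mul, map_mul, hmap, hmap, hmap, aevalAeval_C, aevalAeval_C, ← hrel]
      simp only [map_mul, map_pow, map_neg, map_ofNat, aeval_X]
      ring)
  obtain ⟨r₂, p₂, e, hrel2, rfl, rfl⟩ :=
    UniqueFactorizationMonoid.exists_reduced_factors r₁ hr₁ p₁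
  refine ⟨p₂, r₂, right_ne_zero_of_mul hr₁, hrel2.symm.isCoprime, ?_⟩
  rw [hu, map_mul, map_mul, mul_div_mul_left]
  exact C'.aeval_x_ne_zero (left_ne_zero_of_mul hr₁)

/-- An isomorphism of curves of genus two induces a fractional linear transformation that maps the
roots of one sextic to roots of the other. -/
theorem exists_moebius_of_isIsomorphic {C C' : GenusTwoCurve k} (hC : C.f.natDegree = 6)
    (hC' : C'.f.natDegree = 6) (h : C.IsIsomorphic C') :
    ∃ p r : k[X], p.natDegree ≤ 1 ∧ r.natDegree ≤ 1 ∧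
      p.coeff 1 * r.coeff 0 - p.coeff 0 * r.coeff 1 ≠ 0 ∧
      ∀ (L : Type _) [Field L] [Algebra k L] (w : L), aeval w C'.f = 0 →
        aeval w r ≠ 0 ∧ aeval (aeval w p / aeval w r) C.f = 0 := by
  obtain ⟨σ⟩ := h
  obtain ⟨p, r, hr, hpr, hu⟩ := exists_eq_of_algEquiv hC' σ
  obtain ⟨p', r', hr', hpr', hu'⟩ := exists_eq_of_algEquiv hC σ.symm
  have hσ : ∀ p : k[X], σ (aeval C.x p) = aeval (σ C.x) p := fun p => by
    rw [← AlgEquiv.coe_toAlgHom, ← aeval_algHom_apply, AlgEquiv.coe_toAlgHom]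
  have hx : C'.x = aeval (σ C.x) p' / aeval (σ C.x) r' := by
    rw [← hσ, ← hσ, ← map_div₀, ← hu', AlgEquiv.apply_symm_apply]
  have hr'0 : aeval (σ C.x) r' ≠ 0 := by
    rw [← hσ]
    simpa using C.aeval_x_ne_zero hr'
  obtain ⟨hp1, hr1⟩ := C'.natDegree_le_one_of_eq_aeval_div hpr hr hu hr'0 hx
  have hr0 := C'.aeval_x_ne_zero hr
  -- A vanishing determinant would make p a constant multiple of r, and x would be constant.
  have hdet : p.coeff 1 * r.coeff 0 - p.coeff 0 * r.coeff 1 ≠ 0 := by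
    intro h0
    have hp := eq_X_add_C_of_natDegree_le_one hp1
    have hr2 := eq_X_add_C_of_natDegree_le_one hr1
    have h1 : p * Polynomial.C (r.coeff 0) = r * Polynomial.C (p.coeff 0) := by
      conv_lhs => rw [hp]
      conv_rhs => rw [hr2]
      have := congrArg Polynomial.C (sub_eq_zero.1 h0)
      simp only [map_mul] at this
      linear_combination X * this
    have h2 : p * Polynomial.C (r.coeff 1) = r * Polynomial.C (p.coeff 1) := by
      conv_lhs => rw [hp]
      conv_rhs => rw [hr2]
      have := congrArg Polynomial.C (sub_eq_zero.1 h0)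
      simp only [map_mul] at this
      linear_combination -this
    obtain ⟨c, hc⟩ : ∃ c, p = r * Polynomial.C c := by
      by_cases h3 : r.coeff 0 = 0
      · have h4 : r.coeff 1 ≠ 0 := by
          intro h4
          apply hr
          rw [hr2, h3, h4]; simp
        refine ⟨p.coeff 1 / r.coeff 1, ?_⟩
        rw [div_eq_mul_inv, map_mul, ← mul_assoc, ← h2, mul_assoc, ← map_mul,
          mul_inv_cancel₀ h4, map_one, mul_one]
      · refine ⟨p.coeff 0 / r.coeff 0, ?_⟩
        rw [div_eq_mul_inv, map_mul, ← mul_assoc, ← h1, mul_assoc, ← map_mul,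
          mul_inv_cancel₀ h3, map_one, mul_one]
    rw [hc, map_mul, mul_div_cancel_left₀ _ hr0, aeval_C, ← AlgEquiv.commutes σ] at hu
    apply C.transcendental_x
    rw [σ.injective hu]
    exact isAlgebraic_algebraMap c
  refine ⟨p, r, hp1, hr1, hdet, ?_⟩
  -- The homogenised sextic evaluated at (p, r). It will turn out to be a square times the other
  -- sextic, because σy is a function of x' times y'.
  set E : k[X] := ∑ i ∈ Finset.range 7, Polynomial.C (C.f.coeff i) * p ^ i * r ^ (6 - i) with hE
  obtain ⟨a, b, d, hd, hy⟩ := C'.exists_eq_div (σ C.y)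
  have hd0 := C'.aeval_x_ne_zero hd
  rw [eq_div_iff hd0] at hy
  have hE2 : aeval C'.x r ^ 6 * σ C.y ^ 2 = aeval C'.x E := by
    rw [hE, aeval_homogenization hC.le hr0, ← map_pow σ, C.y_sq, hσ, ← hu]
  obtain ⟨h1, h2⟩ := C'.eq_zero_of_add_mul_y
    (p := r ^ 6 * (a ^ 2 + b ^ 2 * C'.f) - d ^ 2 * E) (q := r ^ 6 * (2 * a * b)) (by
      simp only [map_sub, map_mul, map_add, map_pow, map_ofNat]
      linear_combination -aeval C'.x r ^ 6 * (σ C.y * aeval C'.x d + aeval C'.x a +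
        aeval C'.x b * C'.y) * hy - aeval C'.x r ^ 6 * aeval C'.x b ^ 2 * C'.y_sq +
        aeval C'.x d ^ 2 * hE2)
  -- If σy were in k(x'), so would be the image of every function, including y'.
  have hb : b ≠ 0 := by
    rintro rfl
    have hmem : ∀ q : k[X], aeval C'.x q ∈ IntermediateField.adjoin k {C'.x} :=
      C'.aeval_x_mem_adjoin
    have m1 : σ C.x ∈ IntermediateField.adjoin k {C'.x} := by
      rw [hu]; exact div_mem (hmem _) (hmem _)
    have m2 : σ C.y ∈ IntermediateField.adjoin k {C'.x} := by
      rw [← eq_div_iff hd0] at hy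
      rw [hy, map_zero, zero_mul, add_zero]; exact div_mem (hmem _) (hmem _)
    apply C'.y_notMem_adjoin_x
    obtain ⟨a₁, b₁, d₁, hd₁, hy₁⟩ := C.exists_eq_div (σ.symm C'.y)
    have h3 := congrArg σ hy₁
    rw [AlgEquiv.apply_symm_apply, map_div₀, map_add, map_mul, hσ, hσ, hσ] at h3
    rw [h3]
    exact div_mem (add_mem (IntermediateField.aeval_mem _ m1 _)
      (mul_mem (IntermediateField.aeval_mem _ m1 _) m2)) (IntermediateField.aeval_mem _ m1 _)
  have ha : a = 0 := by
    have h3 := (mul_eq_zero.1 h2).resolve_left (pow_ne_zero 6 hr)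
    have h4 := (mul_eq_zero.1 h3).resolve_right hb
    exact (mul_eq_zero.1 h4).resolve_left two_ne_zero
  subst ha
  obtain ⟨s, hs⟩ := exists_eq_sq_mul_of_squarefree (N := b * r ^ 3) (E := E)
    C'.separable.squarefree hd (by linear_combination h1)
  intro L _ _ w hw
  have hEw : aeval w E = 0 := by rw [hs, map_mul, hw, mul_zero]
  -- At a root w of r the homogenised sextic is the leading coefficient times p(w)⁶, so p and r
  -- would have a common root. This uses that the degree is exactly 6.
  have hrw : aeval w r ≠ 0 := by
    intro h0
    have h3 : aeval w E = algebraMap k L (C.f.coeff 6) * aeval w p ^ 6 := by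
      rw [hE, map_sum, Finset.sum_eq_single_of_mem 6 (by simp)]
      · simp
      · intro i hi hi6
        rw [Finset.mem_range] at hi
        rw [map_mul, map_pow _ r, h0, zero_pow (by omega), mul_zero]
    rw [hEw] at h3
    have h4 : C.f.coeff 6 ≠ 0 := by
      rw [← hC]; exact leadingCoeff_ne_zero.2 C.f_ne_zero
    have h5 : aeval w p = 0 := by
      rcases mul_eq_zero.1 h3.symm with h6 | h6
      · simp [h4] at h6
      · exact pow_eq_zero_iff (by norm_num) |>.1 h6
    obtain ⟨A, B, hAB⟩ := hpr
    have h6 := congrArg (aeval w) hAB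
    rw [map_add, map_mul, map_mul, h0, h5, mul_zero, mul_zero, add_zero, map_one] at h6
    exact zero_ne_one h6
  refine ⟨hrw, ?_⟩
  rw [hE, aeval_homogenization hC.le hrw] at hEw
  exact (mul_eq_zero.1 hEw).resolve_left (pow_ne_zero 6 hrw)

end GenusTwoCurve

/-! ### Infinitely many members of the family -/

/-- Here 2t + 1 = -6/v² and -t(t + 2) = 15V²/(4v⁴), so A = -72|tV|/v² and B = 45/|v| satisfy the two
conditions. The bounds on t come from v² > 2, which holds because V is nonzero. -/
theorem isFamilyParameter_of_eq {v V : ℚ} (hv : v ≠ 0)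
    (h : 5 * V ^ 2 = (v ^ 2 + 6) * (v ^ 2 - 2)) : IsFamilyParameter (-(6 / v ^ 2 + 1) / 2) := by
  have hv2 : 0 < v ^ 2 := by positivity
  have hV : V ≠ 0 := by
    rintro rfl
    refine not_sq_eq_mul_sq (n := 2) (by norm_num) one_ne_zero (a := v) ?_
    have h1 : v ^ 2 + 6 ≠ 0 := by positivity
    have h2 : (v ^ 2 + 6) * (v ^ 2 - 2) = 0 := by rw [← h]; ring
    have := (mul_eq_zero.1 h2).resolve_left h1
    push_cast
    linear_combination this
  have hv3 : 2 < v ^ 2 := by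
    have h1 : 0 < 5 * V ^ 2 := by positivity
    rw [h] at h1
    have := (pos_iff_pos_of_mul_pos h1).1 (by positivity)
    linarith
  have h6 : 0 < 6 / v ^ 2 := by positivity
  have h6' : 6 / v ^ 2 < 3 := by rw [div_lt_iff₀ hv2]; linarith
  refine ⟨by linarith, by linarith, ?_, ?_⟩
  · refine ⟨-(72 / 5 * |(-(6 / v ^ 2 + 1) / 2)| * |5 * V / v ^ 2|), ?_, ?_⟩
    · have h1 : (-(6 / v ^ 2 + 1) / 2) ≠ 0 := by linarith
      have h2 : 5 * V / v ^ 2 ≠ 0 := by positivity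
      have := abs_pos.2 h1
      have := abs_pos.2 h2
      have : 0 < 72 / 5 * |(-(6 / v ^ 2 + 1) / 2)| * |5 * V / v ^ 2| := by positivity
      linarith
    · have h1 : 5 * (V / v ^ 2) ^ 2 = (1 + 6 / v ^ 2) * (1 - 6 / v ^ 2 / 3) := by
        field_simp
        linear_combination 3 * h
      rw [neg_sq, mul_pow, mul_pow, sq_abs, sq_abs, mul_div_assoc]
      linear_combination 1296 * (6 / v ^ 2 + 1) ^ 2 * h1
  · refine ⟨45 / |v|, by positivity, ?_⟩
    rw [div_pow, sq_abs]
    field_simp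
    norm_num

theorem padicNorm.add_eq_left_of_lt {p : ℕ} [Fact p.Prime] {a b : ℚ}
    (h : padicNorm p b < padicNorm p a) : padicNorm p (a + b) = padicNorm p a := by
  rw [padicNorm.add_eq_max_of_ne h.ne', max_eq_left h.le]

theorem padicNorm_two_two : padicNorm 2 2 = 1 / 2 := by
  have := padicNorm.padicNorm_p_of_prime (p := 2)
  rw [one_div]
  exact_mod_cast this

theorem padicNorm_two_eq_one {n : ℕ} (h : ¬ 2 ∣ n) : padicNorm 2 (n : ℚ) = 1 :=
  (padicNorm.nat_eq_one_iff (p := 2) n).2 h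

/-- Repeated doubling on an elliptic curve gives points of unbounded denominator. -/
theorem exists_padicNorm_eq (k : ℕ) : ∃ X Y : ℚ, Y ^ 2 = X ^ 3 - 10 * X ^ 2 + 100 * X ∧
    padicNorm 2 X = 4 ^ (k + 2) ∧ padicNorm 2 Y = 8 ^ (k + 2) := by
  have p2 := padicNorm_two_two
  have hpow : ∀ (a : ℚ) (n : ℕ), padicNorm 2 (a ^ n) = padicNorm 2 a ^ n := by
    intro a n
    induction n with
    | zero => simp
    | succ n ih => rw [pow_succ, padicNorm.mul, ih, pow_succ]
  have h84 : ∀ n : ℕ, (8 ^ n : ℚ) ^ 2 = (4 ^ n) ^ 3 := fun n => by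
    rw [← pow_mul, ← pow_mul, mul_comm n 2, mul_comm n 3, pow_mul, pow_mul]; norm_num
  have h100 : padicNorm 2 (-100) ≤ 1 := by exact_mod_cast padicNorm.of_int (p := 2) (-100)
  have h10 : padicNorm 2 (-10) ≤ 1 := by exact_mod_cast padicNorm.of_int (p := 2) (-10)
  have hge : ∀ n : ℕ, (16 : ℚ) ≤ 4 ^ (n + 2) := by
    intro n
    have : (1 : ℚ) ≤ 4 ^ n := one_le_pow₀ (by norm_num)
    rw [pow_add]; linarith
  have key : ∀ (n : ℕ) (X Y : ℚ), Y ^ 2 = X ^ 3 - 10 * X ^ 2 + 100 * X →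
      padicNorm 2 X = 4 ^ (n + 2) → padicNorm 2 Y = 8 ^ (n + 2) := by
    intro n X Y h hX
    have hq := hge n
    have h8 := h84 (n + 2)
    have h1 : padicNorm 2 (X ^ 2) = (4 ^ (n + 2)) ^ 2 := by rw [hpow, hX]
    have h2 : padicNorm 2 (X ^ 2 + (-10 * X + 100)) = padicNorm 2 (X ^ 2) := by
      apply padicNorm.add_eq_left_of_lt
      have h3 : padicNorm 2 (-10 * X) ≤ 4 ^ (n + 2) := by
        rw [padicNorm.mul, hX]
        exact mul_le_of_le_one_left (by positivity) h10
      have h4 : padicNorm 2 100 ≤ 1 := by exact_mod_cast padicNorm.of_int (p := 2) 100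
      refine padicNorm.nonarchimedean.trans_lt (max_lt ?_ ?_)
      · rw [h1]; nlinarith
      · rw [h1]; nlinarith
    have h5 := congrArg (padicNorm 2) h
    rw [show X ^ 3 - 10 * X ^ 2 + 100 * X = X * (X ^ 2 + (-10 * X + 100)) by ring, padicNorm.mul,
      h2, h1, hX, hpow] at h5
    refine (pow_left_inj₀ (padicNorm.nonneg _) (by positivity) two_ne_zero).1 ?_
    rw [h5, h8]; ring
  suffices h : ∃ X Y : ℚ, Y ^ 2 = X ^ 3 - 10 * X ^ 2 + 100 * X ∧ padicNorm 2 X = 4 ^ (k + 2) by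
    obtain ⟨X, Y, h1, h2⟩ := h
    exact ⟨X, Y, h1, h2, key k X Y h1 h2⟩
  induction k with
  | zero =>
    -- A starting point with X = (39/28)², whose denominator is already divisible by 4².
    refine ⟨1521 / 784, 280839 / 21952, by norm_num, ?_⟩
    have h1 := padicNorm_two_eq_one (n := 1521) (by norm_num)
    have h2 := padicNorm_two_eq_one (n := 49) (by norm_num)
    push_cast at h1 h2
    rw [show (1521 / 784 : ℚ) = 1521 / (2 ^ 4 * 49) by norm_num, padicNorm.div, padicNorm.mul,
      hpow, h1, h2, p2]
    norm_num
  | succ k ih =>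
    obtain ⟨X, Y, h1, h2⟩ := ih
    have h3 := key k X Y h1 h2
    have hq := hge k
    have hY : Y ≠ 0 := by
      rintro rfl
      rw [padicNorm.zero] at h3
      exact absurd h3 (by positivity)
    -- The duplication formula. When X is 2-adically large, the factor 4 in the denominator
    -- multiplies the 2-adic size of X by exactly 4.
    refine ⟨(X ^ 2 - 100) ^ 2 / (4 * Y ^ 2),
      (X ^ 2 - 100) * (X ^ 4 - 20 * X ^ 3 + 600 * X ^ 2 - 2000 * X + 10000) / (8 * Y ^ 3), ?_, ?_⟩
    · obtain ⟨F, hF⟩ : ∃ F, F = X ^ 3 - 10 * X ^ 2 + 100 * X := ⟨_, rfl⟩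
      have hF0 : F ≠ 0 := by rw [hF, ← h1]; exact pow_ne_zero 2 hY
      rw [div_pow, mul_pow 8, ← pow_mul, mul_comm 3 2, pow_mul, h1, ← hF]
      field_simp
      rw [hF]
      ring
    · have h4 : padicNorm 2 (X ^ 2 - 100) = (4 ^ (k + 2)) ^ 2 := by
        rw [sub_eq_add_neg, padicNorm.add_eq_left_of_lt, hpow, h2]
        rw [hpow, h2]
        refine h100.trans_lt ?_
        nlinarith
      have h8 := h84 (k + 2)
      rw [padicNorm.div, hpow, h4, show (4 : ℚ) = 2 ^ 2 by norm_num, padicNorm.mul, hpow, hpow, p2,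
        h3, h8]
      have h5 : (4 ^ (k + 2) : ℚ) ≠ 0 := by positivity
      rw [show (2 : ℚ) ^ 2 = 4 by norm_num, show k + 1 + 2 = (k + 2) + 1 by ring, pow_succ]
      field_simp
      norm_num
      rw [pow_succ _ (k + 2)]

/-- The map from Y² = X³ - 10X² + 100X to 5V² = (v² + 6)(v² - 2) sends the origin to a point with v
= 2. Points 2-adically closer and closer to the origin give values of v at distinct 2-adic distances
from 2, hence distinct t. -/
theorem infinite_isFamilyParameter : {t | IsFamilyParameter t}.Infinite := by
  have p2 := padicNorm_two_two
  have key : ∀ k : ℕ, ∃ t, IsFamilyParameter t ∧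
      padicNorm 2 (-6 / (2 * t + 1) - 4) = (1 / 2) ^ (k + 5) := by
    intro k
    obtain ⟨X, Y, h, hX, hY⟩ := exists_padicNorm_eq k
    have hq : (16 : ℚ) ≤ 4 ^ (k + 2) := by
      have : (1 : ℚ) ≤ 4 ^ k := one_le_pow₀ (by norm_num)
      rw [pow_add]; linarith
    have h48 : (8 : ℚ) ^ (k + 2) = 2 ^ (k + 2) * 4 ^ (k + 2) := by rw [← mul_pow]; norm_num
    have hq2 : (4 : ℚ) ≤ 2 ^ (k + 2) := by
      have : (1 : ℚ) ≤ 2 ^ k := one_le_pow₀ (by norm_num)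
      rw [pow_add]; linarith
    have hD : padicNorm 2 (Y + 6 * X - 40) = 8 ^ (k + 2) := by
      rw [show Y + 6 * X - 40 = Y + (6 * X + (-40)) by ring, padicNorm.add_eq_left_of_lt, hY]
      have h6 : padicNorm 2 6 ≤ 1 := by exact_mod_cast padicNorm.of_int (p := 2) 6
      have h40 : padicNorm 2 (-40) ≤ 1 := by exact_mod_cast padicNorm.of_int (p := 2) (-40)
      rw [hY, h48]
      refine padicNorm.nonarchimedean.trans_lt (max_lt ?_ ?_)
      · rw [padicNorm.mul, hX]
        nlinarith
      · nlinarith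
    have hD0 : Y + 6 * X - 40 ≠ 0 := by
      intro h0
      rw [h0, padicNorm.zero] at hD
      exact absurd hD (by positivity)
    have h5X : padicNorm 2 (-10 * X + 160) = 1 / 2 * 4 ^ (k + 2) := by
      have h5 := padicNorm_two_eq_one (n := 5) (by norm_num)
      have h80 : padicNorm 2 (80) ≤ 1 := by exact_mod_cast padicNorm.of_int (p := 2) 80
      push_cast at h5
      rw [show -10 * X + 160 = -2 * (5 * X + (-80)) by ring, padicNorm.mul, padicNorm.neg, p2,
        padicNorm.add_eq_left_of_lt, padicNorm.mul, h5, hX, one_mul]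
      rw [padicNorm.mul, h5, hX, padicNorm.neg]
      linarith
    obtain ⟨v, hv⟩ : ∃ v, v = 2 * (Y + X + 40) / (Y + 6 * X - 40) := ⟨_, rfl⟩
    have hv2 : padicNorm 2 (v - 2) = (1 / 2) ^ (k + 3) := by
      have h1 : v - 2 = (-10 * X + 160) / (Y + 6 * X - 40) := by
        rw [hv, eq_div_iff hD0, sub_mul, div_mul_cancel₀ _ hD0]; ring
      rw [h1, padicNorm.div, hD, h5X, h48, pow_succ (1 / 2 : ℚ), div_pow, one_pow]
      field_simp
    have hlt : ((1 : ℚ) / 2) ^ (k + 3) ≤ 1 / 8 := by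
      have : ((1 : ℚ) / 2) ^ k ≤ 1 := pow_le_one₀ (by norm_num) (by norm_num)
      rw [pow_add]; linarith
    have p4 : padicNorm 2 4 = 1 / 4 := by
      rw [show (4 : ℚ) = 2 * 2 by norm_num, padicNorm.mul, p2]; norm_num
    have hv4 : padicNorm 2 (v + 2) = 1 / 4 := by
      rw [show v + 2 = 4 + (v - 2) by ring, padicNorm.add_eq_left_of_lt, p4]
      rw [p4, hv2]; linarith
    have hv0 : v ≠ 0 := by
      intro h0
      rw [h0, zero_add, p2] at hv4
      norm_num at hv4
    refine ⟨_, isFamilyParameter_of_eq (v := v)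
      (V := (2 * X ^ 3 - 96 * X ^ 2 + 440 * X - 3200 - 224 * Y) / (Y + 6 * X - 40) ^ 2) hv0 ?_, ?_⟩
    · have h5 : 5 * (2 * X ^ 3 - 96 * X ^ 2 + 440 * X - 3200 - 224 * Y) ^ 2 =
          ((2 * (Y + X + 40)) ^ 2 + 6 * (Y + 6 * X - 40) ^ 2) *
            ((2 * (Y + X + 40)) ^ 2 - 2 * (Y + 6 * X - 40) ^ 2) := by
        linear_combination ((-20) * X ^ 0 * Y ^ 2 + (-4480) * X ^ 0 * Y ^ 1 + (263680) * X ^ 0 * Y ^ 0 + (1720) * X ^ 2 * Y ^ 0 + (-50640) * X ^ 1 * Y ^ 0 + (-20) * X ^ 3 * Y ^ 0) * h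
      obtain ⟨D, hD⟩ : ∃ D, D = Y + 6 * X - 40 := ⟨_, rfl⟩
      rw [← hD] at hD0 h5 hv ⊢
      rw [hv]
      field_simp
      linear_combination h5
    -- The expression -6/(2t + 1) recovers v² from t, so the 2-adic size of v² - 4 separates the
    -- parameters.
    · have h1 : -6 / (2 * (-(6 / v ^ 2 + 1) / 2) + 1) - 4 = (v - 2) * (v + 2) := by
        have : 2 * (-(6 / v ^ 2 + 1) / 2) + 1 = -(6 / v ^ 2) := by ring
        rw [this]
        field_simp
        ring
      rw [h1, padicNorm.mul, hv2, hv4, pow_add _ k 5, pow_add _ k 3]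
      ring
  choose t ht ht' using key
  refine Set.infinite_of_injective_forall_mem (f := t) (fun i j hij => ?_) ht
  have h1 := ht' i
  rw [hij, ht' j] at h1
  have := pow_right_injective₀ (a := (1 / 2 : ℚ)) (by norm_num) (by norm_num) h1
  omega

/-- A polynomial vanishing at the parameters for which the cross ratio of four of the roots of the
sextic is given. -/
def crossRatioPolynomial {L : Type*} [Field L] (n m : L) : L[X] :=
  C ((n - m) ^ 2) * (-20736 * X ^ 3 * (X + 2) - 14175 * (2 * X + 1)) ^ 2 -
    C (4 * (n + m) ^ 2) * (20736 * X ^ 3 * (X + 2) * (14175 * (2 * X + 1)))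

/-- At 0 only the term with (n - m)² survives; when n = m, evaluation at 1 isolates the other term.
-/
theorem crossRatioPolynomial_ne_zero {L : Type*} [Field L] [CharZero L] {n : L} (hn : n ≠ 0)
    (m : L) : crossRatioPolynomial n m ≠ 0 := by
  intro h
  by_cases hnm : n = m
  · have h1 := congrArg (eval 1) h
    simp only [crossRatioPolynomial, ← hnm, eval_sub, eval_mul, eval_pow, eval_add, eval_C, eval_X,
      eval_ofNat, eval_neg, eval_one, eval_zero, sub_self] at h1
    have h2 : n ^ 2 * 42326323200 = 0 := by linear_combination -h1 
    simp [hn] at h2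
  · have h1 := congrArg (eval 0) h
    simp only [crossRatioPolynomial, eval_sub, eval_mul, eval_pow, eval_add, eval_C, eval_X,
      eval_ofNat, eval_neg, eval_one, eval_zero] at h1
    have h2 : (n - m) ^ 2 * 200930625 = 0 := by linear_combination h1
    simp [sub_eq_zero, hnm] at h2

theorem IsFamilyParameter.aeval_curve_f {t : ℚ} (h : IsFamilyParameter t) {L : Type*} [Field L]
    [Algebra ℚ L] {w : L}
    (hw : 7 * w ^ 2 = algebraMap ℚ L (familyE t) ∨
      7 * w ^ 2 = algebraMap ℚ L (familyE t + 81 * familyM t)) : aeval w h.curve.f = 0 := by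
  have hm : algebraMap ℚ L (familyM t) ≠ 0 := (_root_.map_ne_zero _).2 h.familyM_ne_zero
  have hZ : aeval w (familyZ t) = (algebraMap ℚ L (familyE t) - 7 * w ^ 2) /
      algebraMap ℚ L (familyM t) := by
    simp only [familyZ, map_add, map_mul, map_pow, aeval_X, aeval_C, map_div₀, map_neg, map_ofNat]
    ring
  have hf : h.curve.f = familyZ t * (familyZ t + 256) * (familyZ t + 81) := rfl
  rw [hf]
  simp only [map_mul, map_add, map_ofNat, hZ]
  rcases hw with hw | hw
  · rw [hw]; simp
  · have h1 : (algebraMap ℚ L (familyE t) - 7 * w ^ 2) / algebraMap ℚ L (familyM t) + 81 = 0 := by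
      rw [hw]
      simp only [map_add, map_mul, map_ofNat]
      field_simp
      ring
    rw [h1, mul_zero]

/-- A Möbius map takes the roots ±α, ±β of the sextic at t' to roots of the fixed sextic and
preserves their cross ratio. There are finitely many quadruples of roots, and for each the cross
ratio imposes a nonzero polynomial equation on t'. -/
theorem finite_isIsomorphic {t : ℚ} (h : IsFamilyParameter t) :
    {t' : ℚ | ∃ h' : IsFamilyParameter t', h.curve.IsIsomorphic h'.curve}.Finite := by
  obtain ⟨L, _, _, _, _⟩ : ∃ (L : Type) (_ : Field L) (_ : Algebra ℚ L) (_ : CharZero L),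
      IsAlgClosed L := ⟨AlgebraicClosure ℚ, inferInstance, inferInstance, inferInstance,
        inferInstance⟩
  have hdeg : ∀ {t : ℚ} (h : IsFamilyParameter t), h.curve.f.natDegree = 6 :=
    fun h => h.natDegree_sextic
  let S : Set L := h.curve.f.rootSet L
  have hS : S.Finite := rootSet_finite _ _
  have hfin : (⋃ q ∈ {q : L × L | q.1 ≠ 0} ∩ (fun q : (L × L) × (L × L) =>
      ((q.1.1 - q.2.1) * (q.1.2 - q.2.2), (q.1.1 - q.2.2) * (q.1.2 - q.2.1))) '' ((S ×ˢ S) ×ˢ (S ×ˢ S)),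
      {t' : ℚ | algebraMap ℚ L t' ∈ {w | (crossRatioPolynomial q.1 q.2).IsRoot w}}).Finite := by
    refine Set.Finite.biUnion ?_ fun q hq => ?_
    · exact (((hS.prod hS).prod (hS.prod hS)).image _).inter_of_right _
    · exact (finite_setOfPred_isRoot (crossRatioPolynomial_ne_zero hq.1 _)).preimage (algebraMap ℚ L).injective.injOn
  refine hfin.subset ?_
  rintro t' ⟨h', hiso⟩
  obtain ⟨p, r, hp, hr, hdet, hroot⟩ :=
    GenusTwoCurve.exists_moebius_of_isIsomorphic (hdeg h) (hdeg h') hiso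
  obtain ⟨α, hα⟩ := IsAlgClosed.exists_pow_nat_eq (algebraMap ℚ L (familyE t' / 7)) two_pos
  obtain ⟨β, hβ⟩ := IsAlgClosed.exists_pow_nat_eq
    (algebraMap ℚ L ((familyE t' + 81 * familyM t') / 7)) two_pos
  have hα7 : 7 * α ^ 2 = algebraMap ℚ L (familyE t') := by
    rw [hα, map_div₀, map_ofNat]; field_simp
  have hβ7 : 7 * β ^ 2 = algebraMap ℚ L (familyE t' + 81 * familyM t') := by
    rw [hβ, map_div₀, map_ofNat]; field_simp
  have r1 := hroot L α (h'.aeval_curve_f (Or.inl hα7))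
  have r2 := hroot L (-α) (h'.aeval_curve_f (Or.inl (by rwa [neg_sq])))
  have r3 := hroot L β (h'.aeval_curve_f (Or.inr hβ7))
  have r4 := hroot L (-β) (h'.aeval_curve_f (Or.inr (by rwa [neg_sq])))
  have hsub : ∀ w w' : L, aeval w r ≠ 0 → aeval w' r ≠ 0 →
      aeval w p / aeval w r - aeval w' p / aeval w' r =
        algebraMap ℚ L (p.coeff 1 * r.coeff 0 - p.coeff 0 * r.coeff 1) * (w - w') /
          (aeval w r * aeval w' r) := by
    intro w w' hw hw'
    rw [div_sub_div _ _ hw hw']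
    congr 1
    rw [eq_X_add_C_of_natDegree_le_one hp, eq_X_add_C_of_natDegree_le_one hr]
    simp
    ring
  have hdet' : algebraMap ℚ L (p.coeff 1 * r.coeff 0 - p.coeff 0 * r.coeff 1) ≠ 0 := by
    exact (_root_.map_ne_zero _).2 hdet
  have hmem : ∀ w : L, aeval w h.curve.f = 0 → w ∈ S := fun w hw =>
    (mem_rootSet_of_ne h.curve.f_ne_zero).2 hw
  set a := aeval α p / aeval α r
  set b := aeval (-α) p / aeval (-α) r
  set c := aeval β p / aeval β r
  set d := aeval (-β) p / aeval (-β) r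
  have hαβ : α ^ 2 - β ^ 2 ≠ 0 := by
    intro h0
    apply h'.familyM_ne_zero
    have h1 : algebraMap ℚ L (81 * familyM t') = 0 := by
      rw [map_add, ← hα7] at hβ7
      linear_combination -hβ7 - 7 * h0
    have h2 := (_root_.map_eq_zero _).1 h1
    linarith
  have hαβ' : (α - β) * (α + β) ≠ 0 := by rwa [show (α - β) * (α + β) = α ^ 2 - β ^ 2 by ring]
  obtain ⟨hm, hp'⟩ := mul_ne_zero_iff.1 hαβ'
  obtain ⟨δ, hδ⟩ : ∃ δ, δ = algebraMap ℚ L (p.coeff 1 * r.coeff 0 - p.coeff 0 * r.coeff 1) :=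
    ⟨_, rfl⟩
  rw [← hδ] at hdet' hsub
  have hac := hsub α β r1.1 r3.1
  have hbd := hsub (-α) (-β) r2.1 r4.1
  have had := hsub α (-β) r1.1 r4.1
  have hbc := hsub (-α) β r2.1 r3.1
  have hn : (a - c) * (b - d) ≠ 0 := by
    have h1 : -α - -β ≠ 0 := fun h0 => hm (by linear_combination -h0)
    refine mul_ne_zero ?_ ?_
    · rw [hac]
      exact div_ne_zero (mul_ne_zero hdet' hm) (mul_ne_zero r1.1 r3.1)
    · rw [hbd]
      exact div_ne_zero (mul_ne_zero hdet' h1) (mul_ne_zero r2.1 r4.1)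
  have hcross : (a - c) * (b - d) * (α + β) ^ 2 = (a - d) * (b - c) * (α - β) ^ 2 := by
    rw [hac, hbd, had, hbc]
    have := r1.1
    have := r2.1
    have := r3.1
    have := r4.1
    field_simp
    ring
  refine Set.mem_biUnion (x := ((a - c) * (b - d), (a - d) * (b - c)))
    ⟨hn, ⟨((a, b), (c, d)), ⟨⟨hmem a r1.2, hmem b r2.2⟩, ⟨hmem c r3.2, hmem d r4.2⟩⟩, rfl⟩⟩ ?_
  change (crossRatioPolynomial _ _).eval _ = 0
  obtain ⟨n, hn'⟩ : ∃ n, n = (a - c) * (b - d) := ⟨_, rfl⟩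
  obtain ⟨m, hm'⟩ : ∃ m, m = (a - d) * (b - c) := ⟨_, rfl⟩
  simp only [← hn', ← hm'] at hcross ⊢
  -- Squaring this relation leaves only α² and β², which are polynomials in t'.
  have e1 : (n - m) * (α ^ 2 + β ^ 2) = -2 * (n + m) * (α * β) := by linear_combination hcross
  have e0 : 7 * α ^ 2 = -20736 * algebraMap ℚ L t' ^ 3 * (algebraMap ℚ L t' + 2) := by
    rw [hα7, familyE]; simp
  have e2 : 7 * β ^ 2 = -14175 * (2 * algebraMap ℚ L t' + 1) := by
    rw [hβ7, familyE, familyM]; simp; ring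
  simp only [crossRatioPolynomial, eval_sub, eval_mul, eval_pow, eval_add, eval_C, eval_X,
      eval_ofNat, eval_neg, eval_one]
  have e3 : -20736 * algebraMap ℚ L t' ^ 3 * (algebraMap ℚ L t' + 2) -
      14175 * (2 * algebraMap ℚ L t' + 1) = 7 * (α ^ 2 + β ^ 2) := by
    linear_combination -e0 - e2
  have e4 : 20736 * algebraMap ℚ L t' ^ 3 * (algebraMap ℚ L t' + 2) *
      (14175 * (2 * algebraMap ℚ L t' + 1)) = 49 * (α * β) ^ 2 := by
    linear_combination -7 * β ^ 2 * e0 + 20736 * algebraMap ℚ L t' ^ 3 * (algebraMap ℚ L t' + 2) * e2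
  rw [e3, e4]
  linear_combination 49 * ((n - m) * (α ^ 2 + β ^ 2) - 2 * (n + m) * (α * β)) * e1

/-- Greedy choice: finitely many members exclude only finitely many of the infinitely many
parameters. -/
theorem GenusTwoCurve.exists_seq_addOrderOf_eq_48 : ∃ C : ℕ → GenusTwoCurve ℚ,
    (∀ i j, i ≠ j → ¬ (C i).IsIsomorphic (C j)) ∧
      ∀ i, ∃ P : (C i).JacobianPoints, addOrderOf P = 48 := by
  obtain ⟨s, -, hs⟩ := exists_seq_of_forall_finset_exists
    (P := fun _ : {t // IsFamilyParameter t} => True)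
    (r := fun a b => ¬ a.2.curve.IsIsomorphic b.2.curve) (by
      intro s _
      have hfin : (⋃ a ∈ s, {t' : ℚ | ∃ h' : IsFamilyParameter t',
          a.2.curve.IsIsomorphic h'.curve}).Finite :=
        s.finite_toSet.biUnion fun a _ => finite_isIsomorphic a.2
      obtain ⟨b, hb, hb'⟩ := (infinite_isFamilyParameter.sdiff hfin).nonempty
      refine ⟨⟨b, hb⟩, trivial, fun a ha hab => hb' ?_⟩
      exact Set.mem_biUnion (x := a) ha ⟨hb, hab⟩)
  refine ⟨fun n => (s n).2.curve, fun i j hij => ?_, fun i => (s i).2.exists_addOrderOf_eq_48⟩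
  rcases lt_or_gt_of_ne hij with h | h
  · exact hs i j h
  · exact fun ⟨e⟩ => hs j i h ⟨e.symm⟩

/-! ### The degree of the function `s` -/

/-- A squarefree nonconstant polynomial in a transcendental element `t` is not a square
in `k(t)`. -/
theorem sq_ne_aeval_of_mem_adjoin {k F : Type*} [Field k] [Field F] [Algebra k F] {t : F}
    (ht : Transcendental k t) {P : k[X]} (hP : Squarefree P) (hdeg : P.natDegree ≠ 0) {g : F}
    (hg : g ∈ IntermediateField.adjoin k {t}) : g ^ 2 ≠ aeval t P := by
  intro h
  have hinj : ∀ p : k[X], aeval t p = 0 → p = 0 := transcendental_iff.1 ht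
  have hP0 : P ≠ 0 := by rintro rfl; simp at hdeg
  rw [IntermediateField.mem_adjoin_simple_iff] at hg
  obtain ⟨a, b, rfl⟩ := hg
  by_cases hb : b = 0
  · rw [hb, map_zero, div_zero, zero_pow two_ne_zero] at h
    exact hP0 (hinj _ h.symm)
  have hbF : aeval t b ≠ 0 := fun h0 => hb (hinj _ h0)
  rw [div_pow, div_eq_iff (pow_ne_zero 2 hbF)] at h
  have h1 : a ^ 2 = b ^ 2 * P := by
    rw [← sub_eq_zero]
    apply hinj
    simp only [map_sub, map_mul, map_pow]
    linear_combination h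
  obtain ⟨e, rfl⟩ : b ∣ a := (IsIntegrallyClosed.pow_dvd_pow_iff two_ne_zero).1 ⟨P, h1⟩
  have he : e ^ 2 = P := mul_left_cancel₀ (pow_ne_zero 2 hb) (by rw [← h1]; ring)
  have hu := hP e ⟨1, by rw [← he]; ring⟩
  rw [← he] at hdeg
  exact hdeg (natDegree_eq_zero_of_isUnit (hu.pow 2))

open IntermediateField in
/-- The degree of a quadratic extension. -/
theorem relfinrank_sup_adjoin_eq_two {k F : Type*} [Field k] [Field F] [Algebra k F]
    (L : IntermediateField k F) {a b c : F} (ha : a ∉ L) (hb : b ∈ L) (hc : c ∈ L)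
    (h : a ^ 2 + b * a + c = 0) : relfinrank L (L ⊔ k⟮a⟯) = 2 := by
  let p : L[X] := X ^ 2 + C ⟨b, hb⟩ * X + C ⟨c, hc⟩
  have hp : p = C 1 * X ^ 2 + C ⟨b, hb⟩ * X + C ⟨c, hc⟩ := by simp [p]
  have hpd : p.natDegree = 2 := by rw [hp]; exact natDegree_quadratic one_ne_zero
  have hpm : p.Monic := by
    rw [Monic, hp, leadingCoeff_quadratic one_ne_zero]
  have hpa : aeval a p = 0 := by
    simp only [p, map_add, map_mul, map_pow, aeval_X, aeval_C]
    exact h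
  have hint : IsIntegral L a := ⟨p, hpm, hpa⟩
  have hmin : (minpoly L a).natDegree = 2 := by
    apply le_antisymm
    · rw [← hpd]; exact natDegree_le_of_dvd (minpoly.dvd L a hpa) hpm.ne_zero
    · rw [minpoly.two_le_natDegree_iff hint]
      rintro ⟨x, rfl⟩
      exact ha x.2
  have h1 : L ⊔ k⟮a⟯ = L⟮a⟯.restrictScalars k := by
    rw [restrictScalars_adjoin_eq_sup]
  rw [h1, relfinrank_eq_finrank_of_le (le_sup_left.trans h1.le), ← hmin, ← adjoin.finrank hint]
  rfl

open IntermediateField in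
-- If s were algebraic over k, then t, being algebraic over k(s), would be too.
theorem transcendental_of_quadratic {k F : Type*} [Field k] [Field F] [Algebra k F]
    {s t a b c : F} (ht : Transcendental k t) (ha : a ∈ k⟮s⟯) (hb : b ∈ k⟮s⟯) (hc : c ∈ k⟮s⟯)
    (ha0 : a ≠ 0) (h : a * t ^ 2 + b * t + c = 0) : Transcendental k s := by
  intro hs
  apply ht
  have h1 : Algebra.IsAlgebraic k k⟮s⟯ := isAlgebraic_adjoin_simple hs.isIntegral
  have h2 : IsAlgebraic k⟮s⟯ t := by
    refine ⟨C ⟨a, ha⟩ * X ^ 2 + C ⟨b, hb⟩ * X + C ⟨c, hc⟩, ?_, ?_⟩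
    · intro h0
      have := congrArg (fun P => coeff P 2) h0
      simp at this
      exact ha0 (congrArg Subtype.val this)
    · simp only [map_add, map_mul, map_pow, aeval_X, aeval_C]
      exact h
  exact h2.restrictScalars k

theorem separable_of_add_eq_C {k : Type*} [Field k] {f a b : k[X]} {c : k} (hc : c ≠ 0)
    (h : a * f + b * derivative f = C c) : f.Separable := by
  refine ⟨C c⁻¹ * a, C c⁻¹ * b, ?_⟩
  rw [mul_assoc, mul_assoc, ← mul_add, h, ← C_mul, inv_mul_cancel₀ hc, C_1]

section

variable {F : Type*} [Field F]

/-- Isolating w and squaring gives a multiple of the denominator, which is cancelled. The result is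
palindromic under z ↦ 196/z, which is what makes τ = z/14 + 14/z useful. -/
theorem quartic_of_eq_sExpr {s z w : F}
    (hw : w ^ 2 = z ^ 3 + 14 * z ^ 2 + 196 * z) (hd : sDen z ≠ 0) (hs : s = sExpr z w) :
    (s + 21) ^ 2 * (z ^ 2 + 196) ^ 2 + 14 * (-64 * s ^ 2 + 168 * s - 504) * z * (z ^ 2 + 196) +
      196 * (-128 * s ^ 2 - 1008) * z ^ 2 = 0 := by
  apply mul_left_cancel₀ hd
  rw [mul_zero]
  have h1 : s * sDen z = -21 * ((z ^ 2 + 196) * (z ^ 2 + 56 * z + 196) +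
      32 * (z + 14) * (z - 14) * w) := by
    rw [hs, sExpr]; field_simp
  have h2 : (s * sDen z + 21 * ((z ^ 2 + 196) * (z ^ 2 + 56 * z + 196))) ^ 2 =
      (21 * 32 * (z + 14) * (z - 14)) ^ 2 * (z ^ 3 + 14 * z ^ 2 + 196 * z) := by
    rw [← hw, h1]; ring
  rw [sDen] at h2 ⊢
  linear_combination h2

variable [Algebra ℚ F]

theorem aeval_ne_zero_of_natDegree {t : F} (ht : Transcendental ℚ t) {p : ℚ[X]}
    (hp : p.natDegree ≠ 0) : aeval t p ≠ 0 := by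
  intro h
  apply hp
  rw [transcendental_iff.1 ht p h, natDegree_zero]

open IntermediateField

theorem mem_adjoin_of_aeval_eq {t g : F} {p : ℚ[X]} (h : aeval t p = g) : g ∈ ℚ⟮t⟯ :=
  h ▸ IntermediateField.aeval_mem _ (mem_adjoin_simple_self ℚ t) p

theorem notMem_adjoin_of_sq_eq {z w : F} (hz : Transcendental ℚ z)
    (hw : w ^ 2 = z ^ 3 + 14 * z ^ 2 + 196 * z) : w ∉ ℚ⟮z⟯ := by
  intro h
  refine sq_ne_aeval_of_mem_adjoin hz (P := X ^ 3 + 14 * X ^ 2 + 196 * X) ?_ ?_ h ?_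
  · refine (separable_of_add_eq_C (a := -77 - 6 * X) (b := 294 + 35 * X + 2 * X ^ 2) (c := 57624)
      (by norm_num) ?_).squarefree
    simp only [derivative_add, derivative_mul, derivative_X_pow, derivative_ofNat, derivative_X,
      map_ofNat, Nat.cast_ofNat, Nat.reduceSub]
    ring
  · have : (X ^ 3 + 14 * X ^ 2 + 196 * X : ℚ[X]).natDegree = 3 := by compute_degree!
    omega
  · rw [hw]; simp only [map_add, map_mul, map_pow, map_ofNat, aeval_X]

theorem notMem_adjoin_of_quadratic {z τ : F} (hτ : Transcendental ℚ τ)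
    (h : z ^ 2 + -14 * τ * z + 196 = 0) : z ∉ ℚ⟮τ⟯ := by
  intro hz
  refine sq_ne_aeval_of_mem_adjoin hτ (P := 196 * X ^ 2 - 784) ?_ ?_ (g := 2 * z - 14 * τ) ?_ ?_
  · refine (separable_of_add_eq_C (a := -2) (b := X) (c := 1568) (by norm_num) ?_).squarefree
    simp only [derivative_sub, derivative_mul, derivative_X_pow, derivative_ofNat,
      map_ofNat, Nat.cast_ofNat, Nat.reduceSub]
    ring
  · have : (196 * X ^ 2 - 784 : ℚ[X]).natDegree = 2 := by compute_degree!
    omega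
  · exact sub_mem (mul_mem (ofNat_mem _ _) hz) (mul_mem (ofNat_mem _ _) (mem_adjoin_simple_self ℚ τ))
  · simp only [map_sub, map_mul, map_pow, aeval_X, map_ofNat]
    linear_combination 4 * h

theorem sExpr_notMem_adjoin {z w : F} (hw : w ∉ ℚ⟮z⟯) (hz : Transcendental ℚ z)
    (hd : sDen z ≠ 0) : sExpr z w ∉ ℚ⟮z⟯ := by
  have : CharZero F := charZero_of_injective_algebraMap (algebraMap ℚ F).injective
  intro h
  apply hw
  have hB : 32 * (z + 14) * (z - 14) ≠ 0 := by
    have := aeval_ne_zero_of_natDegree hz (p := 32 * X ^ 2 - 6272) (by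
      have : (32 * X ^ 2 - 6272 : ℚ[X]).natDegree = 2 := by compute_degree!
      omega)
    simp only [map_sub, map_mul, map_pow, aeval_X, map_ofNat] at this
    convert this using 1
    ring
  have hw : w = (-sExpr z w * sDen z / 21 - (z ^ 2 + 196) * (z ^ 2 + 56 * z + 196)) /
      (32 * (z + 14) * (z - 14)) := by
    rw [eq_div_iff hB, sExpr]
    field_simp
    ring
  have h1 : sDen z ∈ ℚ⟮z⟯ := by
    exact mem_adjoin_of_aeval_eq (t := z)
      (p := X ^ 4 - 896 * X ^ 3 - 24696 * X ^ 2 - 175616 * X + 38416) (by simp [sDen, map_ofNat])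
  have h2 : (z ^ 2 + 196) * (z ^ 2 + 56 * z + 196) ∈ ℚ⟮z⟯ := by
    exact mem_adjoin_of_aeval_eq (t := z) (p := (X ^ 2 + 196) * (X ^ 2 + 56 * X + 196)) (by simp [map_ofNat])
  have h3 : 32 * (z + 14) * (z - 14) ∈ ℚ⟮z⟯ := by
    exact mem_adjoin_of_aeval_eq (t := z) (p := 32 * (X + 14) * (X - 14)) (by simp [map_ofNat])
  rw [hw]
  exact div_mem (sub_mem (div_mem (mul_mem (neg_mem h) h1) (ofNat_mem _ _)) h2) h3

/-- The discriminant in τ is the squarefree quartic 4608(s⁴ + 70s² + 441), not a square in ℚ(s). -/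
theorem notMem_adjoin_of_quadratic' {s τ : F} (hs : Transcendental ℚ s)
    (h : (s + 21) ^ 2 * τ ^ 2 + (-64 * s ^ 2 + 168 * s - 504) * τ + (-128 * s ^ 2 - 1008) = 0) :
    τ ∉ ℚ⟮s⟯ := by
  intro hτ
  refine sq_ne_aeval_of_mem_adjoin hs
    (P := 4608 * (X ^ 4 + 70 * X ^ 2 + 441)) ?_ ?_
    (g := 2 * (s + 21) ^ 2 * τ + (-64 * s ^ 2 + 168 * s - 504)) ?_ ?_
  · refine (separable_of_add_eq_C (a := 448 + 20 * X ^ 2) (b := -287 * X - 5 * X ^ 3)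
      (c := 4608 * 197568) (by norm_num) ?_).squarefree
    simp only [derivative_add, derivative_mul, derivative_X_pow, derivative_ofNat,
      map_mul, map_ofNat, Nat.cast_ofNat, Nat.reduceSub]
    ring
  · have : (4608 * (X ^ 4 + 70 * X ^ 2 + 441) : ℚ[X]) =
        4608 * X ^ 4 + 322560 * X ^ 2 + 2032128 := by ring
    rw [this]
    have : (4608 * X ^ 4 + 322560 * X ^ 2 + 2032128 : ℚ[X]).natDegree = 4 := by compute_degree!
    omega
  · refine add_mem (mul_mem ?_ hτ) ?_
    · exact mem_adjoin_of_aeval_eq (t := s) (p := 2 * (X + 21) ^ 2) (by simp [map_ofNat])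
    · exact mem_adjoin_of_aeval_eq (t := s) (p := -64 * X ^ 2 + 168 * X - 504) (by simp [map_ofNat])
  · simp only [map_add, map_mul, map_pow, aeval_X, map_ofNat]
    linear_combination 4 * (s + 21) ^ 2 * h

/-- F has degree 2 · 2 over ℚ(τ), and ℚ(s, τ) has degree 2 over ℚ(τ) because s is not even in ℚ(z).
So F has degree 2 over ℚ(s, τ), which has degree 2 over ℚ(s). -/
theorem finrank_adjoin_sExpr {z w : F} (hz : Transcendental ℚ z)
    (hw : w ^ 2 = z ^ 3 + 14 * z ^ 2 + 196 * z) (htop : ℚ⟮z⟯ ⊔ ℚ⟮w⟯ = ⊤) :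
    Module.finrank ℚ⟮sExpr z w⟯ F = 4 := by
  have : CharZero F := charZero_of_injective_algebraMap (algebraMap ℚ F).injective
  have hwz := notMem_adjoin_of_sq_eq hz hw
  have hz0 : z ≠ 0 := by
    simpa using aeval_ne_zero_of_natDegree hz (p := X) (by simp)
  obtain ⟨τ, hτ⟩ : ∃ τ, τ = z / 14 + 14 / z := ⟨_, rfl⟩
  have hzmem := mem_adjoin_simple_self ℚ z
  have hτmem : τ ∈ ℚ⟮z⟯ := by
    rw [hτ]
    exact add_mem (div_mem hzmem (ofNat_mem _ _)) (div_mem (ofNat_mem _ _) hzmem)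
  have hzτ : z ^ 2 + -14 * τ * z + 196 = 0 := by
    rw [hτ]; field_simp; ring
  have hm14 : -14 * τ ∈ ℚ⟮τ⟯ := by exact mem_adjoin_of_aeval_eq (t := τ) (p := -14 * X) (by simp [map_ofNat])
  have hτt : Transcendental ℚ τ :=
    transcendental_of_quadratic (a := 1) hz (one_mem _) hm14 (ofNat_mem _ 196) one_ne_zero
      (by rw [one_mul]; exact hzτ)
  -- The coefficient of s² in the relation between s and τ; up to 196z² it is the denominator of s.
  obtain ⟨e, he⟩ : ∃ e, e = τ ^ 2 - 64 * τ - 128 := ⟨_, rfl⟩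
  have he0 : e ≠ 0 := by
    have := aeval_ne_zero_of_natDegree hτt (p := X ^ 2 - 64 * X - 128) (by
      have : (X ^ 2 - 64 * X - 128 : ℚ[X]).natDegree = 2 := by compute_degree!
      omega)
    simpa only [he, map_add, map_sub, map_mul, map_pow, map_neg, map_ofNat, aeval_X] using this
  have hemem : e ∈ ℚ⟮τ⟯ := by
    rw [he]
    exact mem_adjoin_of_aeval_eq (t := τ) (p := X ^ 2 - 64 * X - 128) (by simp [map_ofNat])
  have hd : sDen z ≠ 0 := by
    have : sDen z = 196 * z ^ 2 * e := by
      rw [sDen, he, hτ]; field_simp; ring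
    rw [this]
    exact mul_ne_zero (mul_ne_zero (OfNat.ofNat_ne_zero 196) (pow_ne_zero 2 hz0)) he0
  have hsz := sExpr_notMem_adjoin hwz hz hd
  obtain ⟨s, hs⟩ : ∃ s, s = sExpr z w := ⟨_, rfl⟩
  rw [← hs] at hsz ⊢
  have hsτ : (s + 21) ^ 2 * τ ^ 2 + (-64 * s ^ 2 + 168 * s - 504) * τ + (-128 * s ^ 2 - 1008) = 0 := by
    have h := quartic_of_eq_sExpr hw hd hs
    have h1 : z ^ 2 + 196 = 14 * z * τ := by linear_combination hzτ
    rw [h1] at h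
    apply mul_left_cancel₀ (pow_ne_zero 2 (mul_ne_zero (OfNat.ofNat_ne_zero 14) hz0))
    linear_combination h
  have hs21 : s + 21 ≠ 0 := by
    intro h
    apply hsz
    rw [eq_neg_of_add_eq_zero_left h]
    exact neg_mem (ofNat_mem _ _)
  obtain ⟨c, hc⟩ : ∃ c, c = (s + 21) ^ 2 := ⟨_, rfl⟩
  have hc0 : c ≠ 0 := hc ▸ pow_ne_zero 2 hs21
  have m1 : c ∈ ℚ⟮s⟯ := by
    rw [hc]; exact mem_adjoin_of_aeval_eq (t := s) (p := (X + 21) ^ 2) (by simp [map_ofNat])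
  have m2 : -64 * s ^ 2 + 168 * s - 504 ∈ ℚ⟮s⟯ := by
    exact mem_adjoin_of_aeval_eq (t := s) (p := -64 * X ^ 2 + 168 * X - 504) (by simp [map_ofNat])
  have m3 : -128 * s ^ 2 - 1008 ∈ ℚ⟮s⟯ := by
    exact mem_adjoin_of_aeval_eq (t := s) (p := -128 * X ^ 2 - 1008) (by simp [map_ofNat])
  have hsτ' := hsτ
  rw [← hc] at hsτ'
  have hst : Transcendental ℚ s := transcendental_of_quadratic hτt m1 m2 m3 hc0 hsτ'
  have h1 : relfinrank ℚ⟮z⟯ ⊤ = 2 := by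
    rw [← htop]
    refine relfinrank_sup_adjoin_eq_two _ hwz (b := 0)
      (c := -(z ^ 3 + 14 * z ^ 2 + 196 * z)) (zero_mem _) (neg_mem ?_) (by rw [hw]; ring)
    exact mem_adjoin_of_aeval_eq (t := z) (p := X ^ 3 + 14 * X ^ 2 + 196 * X) (by simp [map_ofNat])
  have hle : ℚ⟮τ⟯ ≤ ℚ⟮z⟯ := adjoin_simple_le_iff.2 hτmem
  have h2 : relfinrank ℚ⟮τ⟯ ℚ⟮z⟯ = 2 := by
    have := relfinrank_sup_adjoin_eq_two _ (notMem_adjoin_of_quadratic hτt hzτ) hm14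
      (ofNat_mem _ 196) hzτ
    rwa [sup_eq_right.2 hle] at this
  have h3 : relfinrank ℚ⟮τ⟯ (ℚ⟮τ⟯ ⊔ ℚ⟮s⟯) = 2 := by
    refine relfinrank_sup_adjoin_eq_two _ (fun h => hsz (hle h))
      (b := (42 * τ ^ 2 + 168 * τ) / e) (c := (441 * τ ^ 2 - 504 * τ - 1008) / e)
      (div_mem ?_ hemem) (div_mem ?_ hemem) ?_
    · exact mem_adjoin_of_aeval_eq (t := τ) (p := 42 * X ^ 2 + 168 * X) (by simp [map_ofNat])
    · exact mem_adjoin_of_aeval_eq (t := τ) (p := 441 * X ^ 2 - 504 * X - 1008) (by simp [map_ofNat])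
    · field_simp
      rw [he]
      linear_combination hsτ
  have h4 : relfinrank ℚ⟮s⟯ (ℚ⟮s⟯ ⊔ ℚ⟮τ⟯) = 2 := by
    refine relfinrank_sup_adjoin_eq_two _ (notMem_adjoin_of_quadratic' hst hsτ) (div_mem m2 m1)
      (div_mem m3 m1) ?_
    field_simp
    linear_combination hsτ'
  have h5 := relfinrank_mul_finrank_top hle
  rw [h2, ← relfinrank_top_right, h1] at h5
  have h6 := relfinrank_mul_finrank_top (le_sup_left : ℚ⟮τ⟯ ≤ ℚ⟮τ⟯ ⊔ ℚ⟮s⟯)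
  rw [h3, ← h5] at h6
  have h7 := relfinrank_mul_finrank_top (le_sup_left : ℚ⟮s⟯ ≤ ℚ⟮s⟯ ⊔ ℚ⟮τ⟯)
  rw [h4, sup_comm] at h7
  omega

end

namespace CurveD

open WeierstrassCurve.Affine

/-- The coordinate functions on the curve `D`. -/
def z : curveD.FunctionField :=
  algebraMap curveD.CoordinateRing curveD.FunctionField (CoordinateRing.mk curveD (Polynomial.C X))

def w : curveD.FunctionField :=
  algebraMap curveD.CoordinateRing curveD.FunctionField (CoordinateRing.mk curveD X)

theorem aeval_z (p : ℚ[X]) : aeval z p =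
    algebraMap curveD.CoordinateRing curveD.FunctionField (CoordinateRing.mk curveD (C p)) := by
  have h : (aeval z : ℚ[X] →ₐ[ℚ] curveD.FunctionField) =
      (IsScalarTower.toAlgHom ℚ curveD.CoordinateRing curveD.FunctionField).comp
        ((Algebra.ofId ℚ[X] curveD.CoordinateRing).restrictScalars ℚ) := by
    ext
    simp [z, Algebra.ofId_apply]
  rw [h]
  rfl

theorem transcendental_z : Transcendental ℚ z := by
  rw [transcendental_iff]
  intro p hp
  rw [aeval_z, map_eq_zero_iff _ (IsFractionRing.injective _ _)] at hp
  have := (CoordinateRing.smul_basis_eq_zero (W' := curveD) (p := p) (q := 0) (by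
    rw [zero_smul, add_zero, CoordinateRing.smul, mul_one]; exact hp)).1
  exact this

theorem w_sq : w ^ 2 = z ^ 3 + 14 * z ^ 2 + 196 * z := by
  have hp : curveD.polynomial = X ^ 2 - (C X ^ 3 + 14 * C X ^ 2 + 196 * C X) := by
    simp only [WeierstrassCurve.Affine.polynomial, curveD, map_zero, map_add, map_mul, map_pow,
      zero_mul, add_zero, map_ofNat]
  have h : CoordinateRing.mk curveD (X ^ 2 - (C X ^ 3 + 14 * C X ^ 2 + 196 * C X)) = 0 := by
    rw [← hp]
    exact AdjoinRoot.mk_self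
  have h1 := congrArg (algebraMap curveD.CoordinateRing curveD.FunctionField) h
  simp only [map_sub, map_add, map_mul, map_pow, map_zero, map_ofNat] at h1
  exact sub_eq_zero.1 h1

theorem adjoin_z_w : IntermediateField.adjoin ℚ {z} ⊔ IntermediateField.adjoin ℚ {w} = ⊤ := by
  rw [eq_top_iff]
  rintro g -
  set L := IntermediateField.adjoin ℚ {z} ⊔ IntermediateField.adjoin ℚ {w}
  have hz : z ∈ L := (le_sup_left : _ ≤ L) (IntermediateField.mem_adjoin_simple_self ℚ z)
  have hw : w ∈ L := (le_sup_right : _ ≤ L) (IntermediateField.mem_adjoin_simple_self ℚ w)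
  obtain ⟨a, b, hb, rfl⟩ := IsFractionRing.div_surjective (A := curveD.CoordinateRing) g
  have key : ∀ a : curveD.CoordinateRing, algebraMap _ curveD.FunctionField a ∈ L := by
    intro a
    obtain ⟨p, q, rfl⟩ := CoordinateRing.exists_smul_basis_eq a
    rw [CoordinateRing.smul, CoordinateRing.smul, mul_one, map_add, map_mul, ← aeval_z, ← aeval_z]
    exact add_mem (IntermediateField.aeval_mem _ hz _)
      (mul_mem (IntermediateField.aeval_mem _ hz _) hw)
  exact div_mem (key a) (key b)

theorem finrank_adjoin_sFunction :
    Module.finrank (IntermediateField.adjoin ℚ {sFunction}) curveD.FunctionField = 4 := by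
  exact finrank_adjoin_sExpr transcendental_z w_sq adjoin_z_w

/-! ### The fibres of `s` -/

/-- The polynomial whose roots are the `z`-coordinates of the points in a fibre of `s`. -/
def fiberPolynomial (s : ℚ) : ℚ[X] :=
  C ((s + 21) ^ 2) * (X ^ 2 + 196) ^ 2 + C (14 * (-64 * s ^ 2 + 168 * s - 504)) * X * (X ^ 2 + 196) +
    C (196 * (-128 * s ^ 2 - 1008)) * X ^ 2

/-- The values at 1 and -1 differ by a nonzero multiple of -64s² + 168s - 504, which is always
negative. -/
theorem fiberPolynomial_ne_zero (s : ℚ) : fiberPolynomial s ≠ 0 := by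
  intro h
  have h1 := congrArg (eval 1) h
  have h2 := congrArg (eval (-1)) h
  simp only [fiberPolynomial, eval_add, eval_mul, eval_pow, eval_C, eval_X, eval_ofNat,
    eval_zero] at h1 h2
  nlinarith [sq_nonneg (s - 21 / 16)]

theorem natDegree_fiberPolynomial_le (s : ℚ) : (fiberPolynomial s).natDegree ≤ 4 := by
  rw [fiberPolynomial]
  compute_degree

/-- The `z`-coordinate of a point. -/
def xCoord : curveD.Point → ℚ
  | 0 => 0
  | .some z _ _ => z

theorem equation_iff {z w : ℚ} : curveD.Equation z w ↔ w ^ 2 = z ^ 3 + 14 * z ^ 2 + 196 * z := by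
  rw [WeierstrassCurve.Affine.equation_iff]
  simp [curveD]

theorem encard_sFiber_le (s : ℚ) : (sFiber s).encard ≤ 4 := by
  have hmaps : Set.MapsTo xCoord (sFiber s) ((fiberPolynomial s).roots.toFinset : Set ℚ) := by
    rintro _ ⟨z, w, h, rfl, hd, hs⟩
    have := quartic_of_eq_sExpr (equation_iff.1 h.1) hd hs
    rw [Finset.mem_coe, Multiset.mem_toFinset, mem_roots (fiberPolynomial_ne_zero s), IsRoot.def]
    simp only [xCoord, fiberPolynomial, eval_add, eval_mul, eval_pow, eval_C, eval_X, eval_ofNat]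
    linear_combination this
  have hinj : Set.InjOn xCoord (sFiber s) := by
    rintro _ ⟨z, w, h, rfl, hd, hs⟩ _ ⟨z', w', h', rfl, hd', hs'⟩ hz
    change z = z' at hz
    subst hz
    have hw := equation_iff.1 h.1
    -- The coefficient of w in s must not vanish if s and z are to determine w. Indeed w² would be
    -- negative for z = -14 and 42 · 14² for z = 14.
    have hB : (z + 14) * (z - 14) ≠ 0 := by
      intro h0
      rcases mul_eq_zero.1 h0 with h0 | h0
      · rw [eq_neg_of_add_eq_zero_left h0] at hw
        have := sq_nonneg w
        linarith
      · rw [sub_eq_zero.1 h0] at hw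
        refine not_sq_eq_mul_sq (n := 42) (by norm_num) (b := 14) (by norm_num) (a := w) ?_
        push_cast
        linear_combination hw
    have h1 : s * sDen z = s * sDen z := rfl
    conv_lhs at h1 => rw [hs]
    conv_rhs at h1 => rw [hs']
    rw [sExpr, sExpr] at h1
    field_simp at h1
    have h2 : (z + 14) * (z - 14) * w = (z + 14) * (z - 14) * w' := by linarith
    have h3 := mul_left_cancel₀ hB h2
    subst h3
    rfl
  refine (Set.encard_le_encard_of_injOn hmaps hinj).trans ?_
  rw [Set.encard_coe_eq_coe_finsetCard]
  have := (Multiset.toFinset_card_le (fiberPolynomial s).roots).trans (card_roots' _)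
  exact_mod_cast this.trans (natDegree_fiberPolynomial_le s)

end CurveD

/-! ### The arithmetic of the first descent on `D` -/

theorem Nat.isSquare_and_isSquare_of_coprime {a b : ℕ} (h : a.Coprime b) (hs : IsSquare (a * b)) :
    IsSquare a ∧ IsSquare b := by
  have key : ∀ {a b : ℕ}, a.Coprime b → IsSquare (a * b) → IsSquare a := by
    intro a b h hs
    obtain ⟨c, hc⟩ := hs
    obtain ⟨d, hd⟩ := exists_associated_pow_of_mul_eq_pow (k := 2)
      (isUnit_iff_eq_one.2 h : IsUnit (gcd a b)) (hc.trans (sq c).symm)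
    exact ⟨d, by rw [← sq, associated_iff_eq.1 hd]⟩
  exact ⟨key h hs, key h.symm (by rwa [mul_comm])⟩

theorem Nat.isSquare_of_isSquare_sq_mul {a b : ℕ} (ha : a ≠ 0) (h : IsSquare (a ^ 2 * b)) :
    IsSquare b := by
  obtain ⟨c, hc⟩ := h
  obtain ⟨d, rfl⟩ : a ∣ c := (Nat.pow_dvd_pow_iff two_ne_zero).1 ⟨b, by rw [hc, sq]⟩
  refine ⟨d, Nat.eq_of_mul_eq_mul_left (pow_pos (Nat.pos_of_ne_zero ha) 2) ?_⟩
  rw [hc]; ring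

namespace CurveD

theorem coprime_mul_norm {p q : ℕ} (h : p.Coprime q) :
    (p * q).Coprime (p ^ 2 + p * q + q ^ 2) := by
  refine Nat.Coprime.mul_left ?_ ?_
  · rw [show p ^ 2 + p * q + q ^ 2 = q ^ 2 + p * (p + q) by ring]
    simpa using h.pow_right 2
  · rw [show p ^ 2 + p * q + q ^ 2 = p ^ 2 + q * (p + q) by ring]
    simpa using h.symm.pow_right 2

theorem odd_norm {p q : ℕ} (h : p.Coprime q) : Odd (p ^ 2 + p * q + q ^ 2) := by
  have : ¬ (Even p ∧ Even q) := fun ⟨h1, h2⟩ => by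
    have := Nat.dvd_gcd h1.two_dvd h2.two_dvd
    rw [h] at this
    omega
  rw [← Nat.not_even_iff_odd]
  simp only [Nat.even_add, Nat.even_mul, Nat.even_pow] at this ⊢
  tauto

/-- The norm form is odd and coprime to pq, so 7 is the only prime it can share with the cofactor
14pq. -/
theorem isSquare_norm_or {p q : ℕ} (h : p.Coprime q)
    (hs : IsSquare (14 * p * q * (p ^ 2 + p * q + q ^ 2))) :
    (IsSquare (14 * p * q) ∧ IsSquare (p ^ 2 + p * q + q ^ 2)) ∨
      IsSquare (7 * (p ^ 2 + p * q + q ^ 2)) := by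
  have h1 := coprime_mul_norm h
  have h2 : Nat.Coprime 2 (p ^ 2 + p * q + q ^ 2) := (Nat.coprime_two_left).2 (odd_norm h)
  generalize p ^ 2 + p * q + q ^ 2 = n at *
  by_cases h7 : 7 ∣ n
  · right
    obtain ⟨m, rfl⟩ := h7
    have h3 : IsSquare (2 * p * q * m) :=
      Nat.isSquare_of_isSquare_sq_mul (a := 7) (by norm_num) (by convert hs using 1; ring)
    have h4 : (2 * p * q).Coprime m := by
      rw [mul_assoc]
      exact (h2.mul_left h1).coprime_mul_left_right
    obtain ⟨c, rfl⟩ := (Nat.isSquare_and_isSquare_of_coprime h4 h3).2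
    exact ⟨7 * c, by ring⟩
  · left
    apply Nat.isSquare_and_isSquare_of_coprime _ hs
    rw [mul_assoc, show 14 = 2 * 7 by rfl]
    exact Nat.Coprime.mul_left (h2.mul_left ((Nat.Prime.coprime_iff_not_dvd (by norm_num)).2 h7)) h1

/-- A common prime is odd and divides 2p + q. If it is 3, then 9 divides 3q²; in every case it
divides q, hence also p. -/
theorem coprime_add_add {p q V : ℕ} (h : p.Coprime q) (hq : Odd q)
    (hV : (4 * p + 2 * q + V) * V = 3 * q ^ 2) : (4 * p + 2 * q + V).Coprime V := by
  have hodd : Odd ((4 * p + 2 * q + V) * V) := by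
    rw [hV]; exact (by decide : Odd 3).mul hq.pow
  apply Nat.Coprime.symm
  refine Nat.coprime_of_dvd fun l hl h1 h2 => ?_
  have h3 : l ∣ 4 * p + 2 * q := (Nat.dvd_add_left h1).1 h2
  have hl2 : Nat.Coprime l 2 := by
    rw [Nat.coprime_two_right]
    exact (Nat.odd_mul.1 hodd).2.of_dvd_nat h1
  have h4 : l ∣ 2 * p + q := by
    refine hl2.dvd_of_dvd_mul_left (?_ : l ∣ 2 * (2 * p + q))
    convert h3 using 1; ring
  have h5 : l ∣ q := by
    have h6 : l ∣ 3 * q ^ 2 := hV ▸ h1.mul_left _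
    rcases (Nat.Prime.dvd_mul hl).1 h6 with h7 | h7
    · have h8 : l = 3 := (Nat.prime_dvd_prime_iff_eq hl Nat.prime_three).1 h7
      subst h8
      have h9 : 3 * 3 ∣ 3 * q ^ 2 := hV ▸ mul_dvd_mul h2 h1
      exact hl.dvd_of_dvd_pow (Nat.dvd_of_mul_dvd_mul_left (by norm_num) h9)
    · exact hl.dvd_of_dvd_pow h7
  have h6 : l ∣ p := hl2.dvd_of_dvd_mul_left ((Nat.dvd_add_left h5).1 h4)
  exact hl.one_lt.ne' (Nat.dvd_one.1 (h ▸ Nat.dvd_gcd h6 h5))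

/-- Put U = 2k + 2p + q and V = 2k - 2p - q. Then UV = 3q² with U, V coprime, so one is a square and
the other three times a square. Likewise 14pq being a square makes q a square or 7 times a square.
Two of the four combinations give the alternatives; the other two contradict p, q coprime modulo 7.
-/
theorem isSquare_or_isSquare {p q k : ℕ} (hq0 : 0 < q) (h : p.Coprime q) (hq : Odd q)
    (hk : p ^ 2 + p * q + q ^ 2 = k ^ 2) (hs : IsSquare (14 * p * q)) :
    IsSquare (3 * (2 * k + 2 * p + q) * q) ∨ IsSquare (7 * (2 * k + 2 * p + q) * q) := by
  obtain ⟨V, hV⟩ : ∃ V, 2 * k = 2 * p + q + V := Nat.exists_eq_add_of_le (by nlinarith)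
  have hU : 2 * k + 2 * p + q = 4 * p + 2 * q + V := by omega
  have hUV : (4 * p + 2 * q + V) * V = 3 * q ^ 2 := by
    have : 4 * (p ^ 2 + p * q + q ^ 2) = (2 * p + q + V) ^ 2 := by rw [hk, ← hV]; ring
    nlinarith
  have hco := coprime_add_add h hq hUV
  rw [hU]
  have h7 : ¬ (7 ∣ p ∧ 7 ∣ q) := fun ⟨h1, h2⟩ => by
    have := Nat.dvd_gcd h1 h2
    rw [h] at this
    omega
  have hcases : (∃ a b, 4 * p + 2 * q + V = 3 * a ^ 2 ∧ V = b ^ 2 ∧ q = a * b) ∨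
      (∃ a b, 4 * p + 2 * q + V = a ^ 2 ∧ V = 3 * b ^ 2 ∧ q = a * b) := by
    rcases (Nat.Prime.dvd_mul Nat.prime_three).1 (Dvd.intro _ hUV.symm) with ⟨c, hc⟩ | ⟨c, hc⟩
    · left
      rw [hc] at hUV hco
      have h1 : c * V = q ^ 2 := by linarith
      obtain ⟨⟨a, ha⟩, ⟨b, hb⟩⟩ := Nat.isSquare_and_isSquare_of_coprime hco.coprime_mul_left
        ⟨q, by rw [h1, sq]⟩
      refine ⟨a, b, by rw [hc, ha]; ring, by rw [hb]; ring, ?_⟩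
      refine Nat.pow_left_injective (n := 2) two_ne_zero ?_
      change q ^ 2 = (a * b) ^ 2
      rw [← h1, ha, hb]; ring
    · right
      rw [hc] at hUV hco
      have h1 : (4 * p + 2 * q + 3 * c) * c = q ^ 2 := by linarith
      obtain ⟨⟨a, ha⟩, ⟨b, hb⟩⟩ := Nat.isSquare_and_isSquare_of_coprime
        hco.coprime_mul_left_right ⟨q, by rw [h1, sq]⟩
      refine ⟨a, b, by rw [hc, ha]; ring, by rw [hc, hb]; ring, ?_⟩
      refine Nat.pow_left_injective (n := 2) two_ne_zero ?_
      change q ^ 2 = (a * b) ^ 2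
      rw [← h1, ha, hb]; ring
  have hqc : (7 ∣ p ∧ ∃ r, q = r ^ 2) ∨ (∃ r s, q = 7 * r ^ 2 ∧ 2 * p = s ^ 2) := by
    by_cases h7q : 7 ∣ q
    · right
      obtain ⟨m, rfl⟩ := h7q
      have h1 : IsSquare (2 * p * m) :=
        Nat.isSquare_of_isSquare_sq_mul (a := 7) (by norm_num) (by convert hs using 1; ring)
      have h2 : (2 * p).Coprime m :=
        ((Nat.coprime_two_left.2 hq).mul_left h).coprime_mul_left_right
      obtain ⟨⟨s, hs⟩, ⟨r, hr⟩⟩ := Nat.isSquare_and_isSquare_of_coprime h2 h1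
      exact ⟨r, s, by rw [hr, sq], by rw [hs, sq]⟩
    · left
      have h2 : (14 * p).Coprime q := by
        rw [show 14 = 2 * 7 by rfl]
        exact ((Nat.coprime_two_left.2 hq).mul_left
          ((Nat.Prime.coprime_iff_not_dvd (by norm_num)).2 h7q)).mul_left h
      obtain ⟨⟨s, hs⟩, ⟨r, hr⟩⟩ := Nat.isSquare_and_isSquare_of_coprime h2 hs
      refine ⟨?_, r, by rw [hr, sq]⟩
      have h3 : 7 ∣ s := by
        have : 7 ∣ s * s := ⟨2 * p, by rw [← hs]; ring⟩
        rcases (Nat.Prime.dvd_mul (by norm_num)).1 this with h | h <;> exact h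
      obtain ⟨s, rfl⟩ := h3
      have : 7 ∣ 2 * p := ⟨s * s, by linarith⟩
      exact (Nat.Coprime.dvd_of_dvd_mul_left (by norm_num) this)
  have hz : ∀ {n : ℕ}, (n : ZMod 7) = 0 → 7 ∣ n := (ZMod.natCast_eq_zero_iff _ _).1
  rcases hcases with ⟨a, b, hUa, hVb, hqab⟩ | ⟨a, b, hUa, hVb, hqab⟩ <;>
    rcases hqc with ⟨h7p, r, hr⟩ | ⟨r, s, hr, hs2⟩
  · left
    exact ⟨3 * a * r, by rw [hUa, hr]; ring⟩
  · exfalso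
    have key : ∀ a b s : ZMod 7, a * b = 0 → 3 * a ^ 2 = 2 * s ^ 2 + b ^ 2 → s = 0 := by decide
    have h1 : (a * b : ZMod 7) = 0 := by
      have : ((a * b : ℕ) : ZMod 7) = 0 := by
        rw [← hqab, hr, ZMod.natCast_eq_zero_iff]; exact dvd_mul_right _ _
      exact_mod_cast this
    have h2 : (3 * a ^ 2 : ZMod 7) = 2 * s ^ 2 + b ^ 2 := by
      have h3 : 3 * a ^ 2 = 2 * s ^ 2 + 2 * (a * b) + b ^ 2 := by
        rw [← hUa, ← hs2, ← hqab, ← hVb]; ring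
      have h4 := congrArg (Nat.cast : ℕ → ZMod 7) h3
      push_cast at h4
      rw [h4, h1]; ring
    have h3 := hz (key a b s h1 h2)
    apply h7
    refine ⟨Nat.Coprime.dvd_of_dvd_mul_left (by norm_num : Nat.Coprime 7 2) ?_,
      by rw [hr]; exact dvd_mul_right _ _⟩
    rw [hs2]
    exact dvd_pow h3 two_ne_zero
  · exfalso
    have key : ∀ a b r : ZMod 7, a * b = r ^ 2 → a ^ 2 = 2 * (a * b) + 3 * b ^ 2 → r = 0 := by
      decide
    have h1 : (a * b : ZMod 7) = r ^ 2 := by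
      have := congrArg (Nat.cast : ℕ → ZMod 7) (hqab.symm.trans hr)
      exact_mod_cast this
    have h2 : (a ^ 2 : ZMod 7) = 2 * (a * b) + 3 * b ^ 2 := by
      have h3 : a ^ 2 = 4 * p + 2 * (a * b) + 3 * b ^ 2 := by
        rw [← hUa, ← hqab, ← hVb]
      have h4 := congrArg (Nat.cast : ℕ → ZMod 7) h3
      push_cast at h4
      rw [h4, (ZMod.natCast_eq_zero_iff p 7).2 h7p]; ring
    refine h7 ⟨h7p, ?_⟩
    rw [hr]
    exact dvd_pow (hz (key a b r h1 h2)) two_ne_zero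
  · right
    exact ⟨7 * a * r, by rw [hUa, hr]; ring⟩

end CurveD

/-! ### The descent map on `D` -/

namespace CurveD

open WeierstrassCurve.Affine

/-- The chord or tangent meets the cubic in the three listed abscissae; stated for all t so that it
can be transferred to t = 14ω. -/
theorem slope_identity {x₁ y₁ x₂ y₂ : ℚ} (h₁ : curveD.Equation x₁ y₁) (h₂ : curveD.Equation x₂ y₂)
    (hxy : ¬(x₁ = x₂ ∧ y₁ = curveD.negY x₂ y₂)) :
    ∃ l c : ℚ, ∀ t : ℚ, (l * t + c) ^ 2 - (t ^ 3 + 14 * t ^ 2 + 196 * t) =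
      -((t - x₁) * (t - x₂) * (t - curveD.addX x₁ x₂ (curveD.slope x₁ x₂ y₁ y₂))) := by
  refine ⟨curveD.slope x₁ x₂ y₁ y₂, y₁ - curveD.slope x₁ x₂ y₁ y₂ * x₁, fun t => ?_⟩
  have h := congrArg (eval t) (addPolynomial_slope h₁ h₂ hxy)
  generalize curveD.slope x₁ x₂ y₁ y₂ = l at h ⊢
  rw [addPolynomial_eq] at h
  simp only [Cubic.toPoly, eval_neg, eval_add, eval_mul, eval_C, eval_X, eval_pow, eval_sub,
    curveD] at h ⊢
  linear_combination h

theorem negY_eq (x y : ℚ) : curveD.negY x y = -y := by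
  simp [curveD]

/-- The field `ℚ(ω)` with `ω² + ω + 1 = 0`. -/
abbrev K := QuadraticAlgebra ℚ (-1) (-1)

instance : Fact (∀ r : ℚ, r ^ 2 ≠ -1 + -1 * r) :=
  ⟨fun r h => by nlinarith [sq_nonneg (2 * r + 1)]⟩

/-- The descent map `(x, y) ↦ x - 14ω`. -/
def delta : curveD.Point → K
  | 0 => 1
  | .some x _ _ => ⟨x, -14⟩

theorem delta_zero : delta 0 = 1 := rfl

theorem delta_some {x y : ℚ} (h : curveD.Nonsingular x y) : delta (.some x y h) = ⟨x, -14⟩ := rfl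

theorem delta_ne_zero (P : curveD.Point) : delta P ≠ 0 := by
  rcases P with _ | ⟨x, y, h⟩
  · exact one_ne_zero
  · intro h0
    have := congrArg QuadraticAlgebra.im h0
    simp [delta] at this

theorem delta_neg (P : curveD.Point) : delta (-P) = delta P := by
  rcases P with _ | ⟨x, y, h⟩ <;> rfl

theorem isSquare_delta_add (P Q : curveD.Point) :
    IsSquare (delta P * delta Q * delta (P + Q)) := by
  rcases P with _ | ⟨x₁, y₁, h₁⟩
  · rw [← Point.zero_def, zero_add, delta_zero]
    exact ⟨delta Q, by ring⟩
  rcases Q with _ | ⟨x₂, y₂, h₂⟩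
  · rw [← Point.zero_def, add_zero, delta_zero]
    exact ⟨delta (.some x₁ y₁ h₁), by ring⟩
  by_cases hxy : x₁ = x₂ ∧ y₁ = curveD.negY x₂ y₂
  · rw [Point.add_of_Y_eq hxy.1 hxy.2, delta_zero, mul_one]
    obtain ⟨rfl, -⟩ := hxy
    exact ⟨_, rfl⟩
  · rw [Point.add_some hxy]
    obtain ⟨l, c, hlc⟩ := slope_identity h₁.1 h₂.1 hxy
    simp only [delta]
    generalize curveD.addX x₁ x₂ (curveD.slope x₁ x₂ y₁ y₂) = x₃ at hlc ⊢
    -- The cubic terms cancel, so the values at 0, 1, -1 contain the whole identity. Substituting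
    -- the root t = 14ω of the cubic shows that the product of the three x - 14ω is (c + 14lω)².
    have e0 := hlc 0
    have e1 := hlc 1
    have e2 := hlc (-1)
    refine ⟨⟨c, 14 * l⟩, ?_⟩
    ext
    · simp only [QuadraticAlgebra.re_mul, QuadraticAlgebra.im_mul]
      linear_combination 196 * ((e1 + e2) / 2 - e0) - e0
    · simp only [QuadraticAlgebra.re_mul, QuadraticAlgebra.im_mul]
      linear_combination 196 * ((e1 + e2) / 2 - e0) - 7 * (e1 - e2)

theorem isSquare_of_mul {F : Type*} [Field F] {a b c : F} (hb : b ≠ 0) (h₁ : IsSquare (a * b)) (h₂ : IsSquare (b * c)) :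
    IsSquare (a * c) := by
  obtain ⟨r, hr⟩ := h₁
  obtain ⟨s, hs⟩ := h₂
  refine ⟨r * s / b, ?_⟩
  field_simp
  linear_combination (b * c) * hr + r * r * hs

theorem double_some {x y : ℚ} (h : curveD.Nonsingular x y) (hy : y ≠ 0) :
    ∃ y' h', Point.some x y h + Point.some x y h =
      Point.some (((x ^ 2 - 196) / (2 * y)) ^ 2) y' h' := by
  have hy' : y ≠ curveD.negY x y := by
    rw [negY_eq]; intro h0; exact hy (by linarith)
  have hx : curveD.addX x x (curveD.slope x x y y) = ((x ^ 2 - 196) / (2 * y)) ^ 2 := by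
    have he := equation_iff.1 h.1
    rw [slope_of_Y_ne rfl hy', negY_eq]
    simp only [addX, curveD]
    have : y - -y = 2 * y := by ring
    rw [this]
    field_simp
    linear_combination (-4 * (14 + 2 * x)) * he
  rw [Point.add_self_of_Y_ne hy']
  have : ∀ {a b : ℚ} (hab : a = b) {y' : ℚ} (h' : curveD.Nonsingular a y'),
      ∃ y'' h'', Point.some a y' h' = Point.some b y'' h'' := by
    rintro a _ rfl y' h'
    exact ⟨y', h', rfl⟩
  exact this hx _

theorem nonsingular_of_sq {x y : ℚ} (hy : y ≠ 0) (h : y ^ 2 = x ^ 3 + 14 * x ^ 2 + 196 * x) :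
    curveD.Nonsingular x y := by
  rw [nonsingular_iff]
  refine ⟨equation_iff.2 h, Or.inr ?_⟩
  simp only [curveD]
  intro h0
  exact hy (by linarith)

/-- If x - 14ω is a square its norm is a square, and then so is x. The rational component of the
usual descent map is thus redundant, and halving is explicit. -/
theorem exists_add_self_of_isSquare {P : curveD.Point} (hP : IsSquare (delta P)) :
    ∃ R, P = R + R := by
  rcases P with _ | ⟨x, w, h⟩
  · exact ⟨0, rfl⟩
  obtain ⟨⟨a, b⟩, hab⟩ := hP
  have h1 := congrArg QuadraticAlgebra.re hab
  have h2 := congrArg QuadraticAlgebra.im hab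
  simp only [delta, QuadraticAlgebra.re_mul, QuadraticAlgebra.im_mul] at h1 h2
  have he := equation_iff.1 h.1
  have hb : b ≠ 0 := by rintro rfl; norm_num at h2
  have hk : x ^ 2 + 14 * x + 196 = (a ^ 2 - a * b + b ^ 2) ^ 2 := by
    linear_combination (x + (a ^ 2 - b ^ 2) + 14) * h1 -
      (14 + (b ^ 2 - 2 * a * b) + (a ^ 2 - b ^ 2)) * h2
  have hk0 : a ^ 2 - a * b + b ^ 2 ≠ 0 := by
    intro h0; rw [h0] at hk; nlinarith [sq_nonneg (x + 7)]
  obtain ⟨k, hkdef⟩ : ∃ k, k = a ^ 2 - a * b + b ^ 2 := ⟨_, rfl⟩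
  rw [← hkdef] at hk hk0
  obtain ⟨c, hc⟩ : ∃ c, c = w / k := ⟨_, rfl⟩
  have hcx : c ^ 2 = x := by
    rw [hc, div_pow, div_eq_iff (pow_ne_zero 2 hk0), ← hk, he]; ring
  have hca : c - a ≠ 0 := by
    intro h0
    rw [sub_eq_zero.1 h0, h1] at hcx
    exact hb (by nlinarith)
  -- The abscissa of a half of P in terms of a + bω = √(x - 14ω) and c = √x. The final case split
  -- settles the sign of the ordinate.
  let X := 14 * (c - a) / b
  let Y := 14 * X / b
  have hY : Y ≠ 0 := by simp [Y, X, hb, hca]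
  have hXY : Y ^ 2 = X ^ 3 + 14 * X ^ 2 + 196 * X := by
    have h3 : 14 * (c - a) - b * (c - a) ^ 2 - b ^ 2 * (c - a) - b ^ 3 = 0 := by
      linear_combination (-b) * hcx - b * h1 - (c - a) * h2
    rw [← sub_eq_zero, ← mul_zero (14 * (c - a) / b * (196 / b ^ 3)), ← h3]
    simp only [X, Y]
    field_simp
    ring
  obtain ⟨y', h', hd⟩ := double_some (nonsingular_of_sq hY hXY) hY
  have hx : ((X ^ 2 - 196) / (2 * Y)) ^ 2 = x := by
    rw [← hcx]
    congr 1
    rw [div_eq_iff (mul_ne_zero two_ne_zero hY), ← sub_eq_zero, ← mul_zero (196 / b ^ 2)]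
    have h3 : (c - a) ^ 2 - b ^ 2 - 2 * c * (c - a) = 0 := by
      linear_combination -hcx - h1
    rw [← h3]
    simp only [X, Y]
    field_simp
    ring
  rcases Point.X_eq_iff.1 hx with h3 | h3
  · exact ⟨_, (hd.trans h3).symm⟩
  · exact ⟨-(Point.some X Y (nonsingular_of_sq hY hXY)), by rw [← neg_add, hd, h3, neg_neg]⟩

end CurveD

/-! ### The image of the descent map -/

namespace CurveD

open WeierstrassCurve.Affine

theorem isSquare_of_mul_mul_self {F : Type*} [Field F] {a b : F} (hb : b ≠ 0)
    (h : IsSquare (a * b * b)) : IsSquare a := by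
  obtain ⟨r, hr⟩ := h
  refine ⟨r / b, ?_⟩
  field_simp
  linear_combination hr

/-- The quadratic factor is positive, so x ≥ 0. The substitution x = 14p/q turns the equation into a
statement about coprime natural numbers, in which 196 has disappeared from the norm form. -/
theorem exists_eq_div {x y : ℚ} (h : y ^ 2 = x ^ 3 + 14 * x ^ 2 + 196 * x) :
    ∃ p q : ℕ, 0 < q ∧ p.Coprime q ∧ x = 14 * (p / q) ∧
      IsSquare (14 * p * q * (p ^ 2 + p * q + q ^ 2)) := by
  have hx : 0 ≤ x := by
    by_contra! hx
    have : x * (x ^ 2 + 14 * x + 196) < 0 :=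
      mul_neg_of_neg_of_pos hx (by nlinarith [sq_nonneg (x + 7)])
    nlinarith [sq_nonneg y]
  have hn : 0 ≤ (x / 14).num := Rat.num_nonneg.2 (by positivity)
  have hq : ((x / 14).den : ℚ) ≠ 0 := by exact_mod_cast (x / 14).den_ne_zero
  have hx2 : x = 14 * (((x / 14).num.natAbs : ℕ) / ((x / 14).den : ℕ)) := by
    have h1 : (((x / 14).num.natAbs : ℕ) : ℚ) = (x / 14).num := by
      rw [← Int.cast_natCast, Int.natAbs_of_nonneg hn]
    rw [h1, Rat.num_div_den]
    ring
  refine ⟨(x / 14).num.natAbs, (x / 14).den, (x / 14).den_pos, (x / 14).reduced, hx2, ?_⟩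
  generalize (x / 14).num.natAbs = p at hx2
  generalize (x / 14).den = q at hx2 hq
  rw [← Rat.isSquare_natCast_iff]
  refine ⟨y * q ^ 2 / 14, ?_⟩
  have h1 : y * q ^ 2 / 14 * (y * q ^ 2 / 14) = y ^ 2 * q ^ 4 / 196 := by ring
  rw [h1, h, hx2]
  push_cast
  field_simp
  ring

theorem add_pointP1 {x y : ℚ} (h : curveD.Nonsingular x y) (hx : x ≠ 0) :
    ∃ y' h', Point.some x y h + pointP1 = Point.some (196 / x) y' h' := by
  have he := equation_iff.1 h.1
  have hx3 : curveD.addX x 0 (curveD.slope x 0 y 0) = 196 / x := by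
    rw [slope_of_X_ne hx]
    simp only [addX, curveD]
    field_simp
    linear_combination x * he
  rw [pointP1, Point.add_of_X_ne hx]
  have : ∀ {a b : ℚ} (hab : a = b) {y' : ℚ} (h' : curveD.Nonsingular a y'),
      ∃ y'' h'', Point.some a y' h' = Point.some b y'' h'' := by
    rintro a _ rfl y' h'
    exact ⟨y', h', rfl⟩
  exact this hx3 _

theorem norm_delta_some {x y : ℚ} (h : curveD.Nonsingular x y) :
    QuadraticAlgebra.norm (delta (.some x y h)) = x ^ 2 + 14 * x + 196 := by
  rw [delta_some, QuadraticAlgebra.norm_def]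
  ring

theorem norm_ne_zero (x : ℚ) : x ^ 2 + 14 * x + 196 ≠ 0 := by
  nlinarith [sq_nonneg (x + 7)]

theorem norm_delta_ne_zero (P : curveD.Point) : QuadraticAlgebra.norm (delta P) ≠ 0 :=
  fun h => delta_ne_zero P (QuadraticAlgebra.norm_eq_zero_iff_eq_zero.1 h)

theorem isSquare_C {r : ℚ} (h : IsSquare r) : IsSquare (QuadraticAlgebra.C r : K) := by
  obtain ⟨s, rfl⟩ := h
  exact ⟨.C s, by rw [QuadraticAlgebra.C_mul]⟩

theorem C_ne_zero {r : ℚ} (h : r ≠ 0) : (QuadraticAlgebra.C r : K) ≠ 0 := by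
  rwa [Ne, QuadraticAlgebra.C_eq_zero_iff]

/-- For α of norm k² one has α(Tr α + 2k) = (α + k)²; so the class of such an α is that of a
rational number. -/
theorem isSquare_delta_mul_C {x y k : ℚ} (h : curveD.Nonsingular x y)
    (hk : x ^ 2 + 14 * x + 196 = k ^ 2) :
    IsSquare (delta (.some x y h) * QuadraticAlgebra.C (2 * k + 2 * x + 14)) := by
  refine ⟨⟨x + k, -14⟩, ?_⟩
  rw [delta_some]
  ext
  · simp only [QuadraticAlgebra.re_mul, QuadraticAlgebra.re_C, QuadraticAlgebra.im_C]
    linear_combination hk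
  · simp only [QuadraticAlgebra.im_mul, QuadraticAlgebra.re_C, QuadraticAlgebra.im_C]
    ring

theorem isSquare_C_mul_delta_pointP1 :
    IsSquare (QuadraticAlgebra.C 42 * delta pointP1) := by
  refine ⟨⟨14, -14⟩, ?_⟩
  rw [pointP1, delta_some]
  ext <;> simp only [QuadraticAlgebra.re_mul, QuadraticAlgebra.im_mul, QuadraticAlgebra.re_C,
    QuadraticAlgebra.im_C] <;> norm_num

theorem isSquare_C_mul_delta_pointP3 :
    IsSquare (QuadraticAlgebra.C 2 * delta pointP3) := by
  refine ⟨⟨6, -2⟩, ?_⟩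
  rw [pointP3, delta_some]
  ext <;> simp only [QuadraticAlgebra.re_mul, QuadraticAlgebra.im_mul, QuadraticAlgebra.re_C,
    QuadraticAlgebra.im_C] <;> norm_num

/-- The class of the point is that of the rational number 14(2k + 2p + q)q, which is 42 or 2 up to
squares, and these are the classes of P₁ and P₃. -/
theorem isSquare_delta_of_odd {x y : ℚ} (h : curveD.Nonsingular x y) {p q k : ℕ} (hq0 : 0 < q)
    (hpq : p.Coprime q) (hx : x = 14 * (p / q)) (hq : Odd q)
    (hk : p ^ 2 + p * q + q ^ 2 = k ^ 2) (hs : IsSquare (14 * p * q)) :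
    IsSquare (delta (.some x y h) * delta pointP1) ∨
      IsSquare (delta (.some x y h) * delta pointP3) := by
  have hq' : (q : ℚ) ≠ 0 := by exact_mod_cast hq0.ne'
  have hkQ : (p ^ 2 + p * q + q ^ 2 : ℚ) = k ^ 2 := by exact_mod_cast hk
  have h1 := isSquare_delta_mul_C (k := 14 * k / q) h (by
    rw [hx]; field_simp; linear_combination 196 * hkQ)
  have h0 : (2 * (14 * k / q) + 2 * x + 14 : ℚ) ≠ 0 := by
    rw [hx]; positivity
  rcases isSquare_or_isSquare hq0 hpq hq hk hs with h2 | h2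
  · left
    refine isSquare_of_mul (C_ne_zero (by norm_num : (42 : ℚ) ≠ 0))
      (isSquare_of_mul (C_ne_zero h0) h1 ?_) isSquare_C_mul_delta_pointP1
    rw [← QuadraticAlgebra.C_mul]
    apply isSquare_C
    obtain ⟨r, hr⟩ := h2
    refine ⟨14 * r / q, ?_⟩
    have hr' : (3 * (2 * k + 2 * p + q) * q : ℚ) = r * r := by exact_mod_cast hr
    rw [hx]
    field_simp
    linear_combination 14 * hr'
  · right
    refine isSquare_of_mul (C_ne_zero (by norm_num : (2 : ℚ) ≠ 0))
      (isSquare_of_mul (C_ne_zero h0) h1 ?_) isSquare_C_mul_delta_pointP3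
    rw [← QuadraticAlgebra.C_mul]
    apply isSquare_C
    obtain ⟨r, hr⟩ := h2
    refine ⟨2 * r / q, ?_⟩
    have hr' : (7 * (2 * k + 2 * p + q) * q : ℚ) = r * r := by exact_mod_cast hr
    rw [hx]
    field_simp
    linear_combination 2 * hr'

theorem eq_pointP1_of_x_eq_zero {x y : ℚ} (h : curveD.Nonsingular x y) (hx : x = 0) :
    Point.some x y h = pointP1 := by
  subst hx
  have hy : y = 0 := by
    have := equation_iff.1 h.1
    simpa using this
  subst hy
  rfl

/-- Adding P₁ replaces x by 196/x and swaps p and q, so q may be taken odd. -/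
theorem exists_isSquare_of_isSquare_norm (P : curveD.Point)
    (hP : IsSquare (QuadraticAlgebra.norm (delta P))) :
    ∃ T : curveD.Point, (T = 0 ∨ T = pointP3) ∧ ∃ e : curveD.Point, (e = 0 ∨ e = pointP1) ∧
      IsSquare (delta P * delta T * delta e) := by
  rcases P with _ | ⟨x, y, h⟩
  · exact ⟨0, .inl rfl, 0, .inl rfl, 1, by
      rw [← Point.zero_def, delta_zero, mul_one]⟩
  by_cases hx0 : x = 0
  · rw [eq_pointP1_of_x_eq_zero h hx0]
    exact ⟨0, .inl rfl, pointP1, .inr rfl, delta pointP1, by rw [delta_zero, mul_one]⟩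
  obtain ⟨p, q, hq0, hpq, hx, hs⟩ := exists_eq_div (equation_iff.1 h.1)
  have hp0 : 0 < p := Nat.pos_of_ne_zero (by rintro rfl; simp at hx; exact hx0 hx)
  have hq' : (q : ℚ) ≠ 0 := by exact_mod_cast hq0.ne'
  have hp' : (p : ℚ) ≠ 0 := by exact_mod_cast hp0.ne'
  rw [norm_delta_some] at hP
  obtain ⟨k, hk⟩ : ∃ k : ℕ, p ^ 2 + p * q + q ^ 2 = k ^ 2 := by
    have : IsSquare (p ^ 2 + p * q + q ^ 2) := by
      rw [← Rat.isSquare_natCast_iff]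
      obtain ⟨r, hr⟩ := hP
      refine ⟨r * q / 14, ?_⟩
      have h1 : r * q / 14 * (r * q / 14) = (r * r) * q ^ 2 / 196 := by ring
      rw [h1, ← hr, hx]
      push_cast
      field_simp
      ring
    obtain ⟨k, hk⟩ := this
    exact ⟨k, by rw [hk, sq]⟩
  have hs' : IsSquare (14 * p * q) := by
    rw [hk, mul_comm] at hs
    refine Nat.isSquare_of_isSquare_sq_mul ?_ hs
    rintro rfl
    nlinarith
  by_cases hq : Odd q
  · rcases isSquare_delta_of_odd h hq0 hpq hx hq hk hs' with h1 | h1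
    · exact ⟨0, .inl rfl, pointP1, .inr rfl, by rwa [delta_zero, mul_one]⟩
    · exact ⟨pointP3, .inr rfl, 0, .inl rfl, by rwa [delta_zero, mul_one]⟩
  · have hp : Odd p := by
      rw [← Nat.not_even_iff_odd] at hq ⊢
      rw [not_not] at hq
      intro hp
      have := Nat.dvd_gcd hp.two_dvd hq.two_dvd
      rw [hpq] at this
      omega
    obtain ⟨y', h', hadd⟩ := add_pointP1 h hx0
    have h2 := isSquare_delta_add (.some x y h) pointP1
    rw [hadd] at h2
    have h3 := isSquare_delta_of_odd (q := p) (p := q) (k := k) h' hp0 hpq.symm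
      (by rw [hx]; field_simp; norm_num) hp (by rw [← hk]; ring) (by convert hs' using 1; ring)
    rcases h3 with h3 | h3
    · refine ⟨0, .inl rfl, 0, .inl rfl, ?_⟩
      rw [delta_zero, mul_one, mul_one]
      exact isSquare_of_mul_mul_self (delta_ne_zero pointP1)
        (isSquare_of_mul (delta_ne_zero _) h2 h3)
    · refine ⟨pointP3, .inr rfl, pointP1, .inr rfl, ?_⟩
      rw [mul_right_comm]
      exact isSquare_of_mul (delta_ne_zero _) h2 h3

theorem isSquare_norm_delta_or (P : curveD.Point) :
    IsSquare (QuadraticAlgebra.norm (delta P)) ∨ IsSquare (7 * QuadraticAlgebra.norm (delta P)) := by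
  rcases P with _ | ⟨x, y, h⟩
  · left
    exact ⟨1, by rw [← Point.zero_def, delta_zero, map_one, mul_one]⟩
  obtain ⟨p, q, hq0, hpq, hx, hs⟩ := exists_eq_div (equation_iff.1 h.1)
  have hq' : (q : ℚ) ≠ 0 := by exact_mod_cast hq0.ne'
  rw [norm_delta_some]
  rcases isSquare_norm_or hpq hs with ⟨-, r, hr⟩ | ⟨r, hr⟩
  · left
    refine ⟨14 * r / q, ?_⟩
    have hr' : (p ^ 2 + p * q + q ^ 2 : ℚ) = r * r := by exact_mod_cast hr
    rw [hx]
    field_simp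
    linear_combination 196 * hr'
  · right
    refine ⟨14 * r / q, ?_⟩
    have hr' : (7 * (p ^ 2 + p * q + q ^ 2) : ℚ) = r * r := by exact_mod_cast hr
    rw [hx]
    field_simp
    linear_combination 196 * hr'

theorem norm_delta_pointP2 : QuadraticAlgebra.norm (delta pointP2) = 343 := by
  rw [pointP2, norm_delta_some]
  norm_num

/-- The norm class is 1 or 7, and P₂ has norm 7³, so adding P₂ reduces to square norm. The
representative P₂ - P₃ is used rather than P₂ + P₃ because its height is much smaller. -/
theorem exists_isSquare (P : curveD.Point) :
    ∃ T : curveD.Point, (T = 0 ∨ T = pointP2 ∨ T = pointP3 ∨ T = pointP2 - pointP3) ∧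
      ∃ e : curveD.Point, (e = 0 ∨ e = pointP1) ∧ IsSquare (delta P * delta T * delta e) := by
  rcases isSquare_norm_delta_or P with h | h
  · obtain ⟨T, hT, e, he, hs⟩ := exists_isSquare_of_isSquare_norm P h
    exact ⟨T, by tauto, e, he, hs⟩
  · have h1 := isSquare_delta_add P pointP2
    have h2 : IsSquare (QuadraticAlgebra.norm (delta (P + pointP2))) := by
      have h3 := h1.map QuadraticAlgebra.norm
      rw [map_mul, map_mul, norm_delta_pointP2] at h3
      have h4 : IsSquare (1 * QuadraticAlgebra.norm (delta (P + pointP2))) := by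
        refine isSquare_of_mul (mul_ne_zero (norm_delta_ne_zero P)
          (by norm_num : (343 : ℚ) ≠ 0)) ?_ h3
        obtain ⟨r, hr⟩ := h
        exact ⟨7 * r, by linear_combination 49 * hr⟩
      rwa [one_mul] at h4
    obtain ⟨T, hT, e, he, hs⟩ := exists_isSquare_of_isSquare_norm _ h2
    rw [mul_assoc] at hs
    have h5 := isSquare_of_mul (delta_ne_zero _) h1 hs
    rcases hT with rfl | rfl
    · refine ⟨pointP2, by tauto, e, he, ?_⟩
      rwa [delta_zero, one_mul] at h5
    · refine ⟨pointP2 - pointP3, by tauto, e, he, ?_⟩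
      have h6 := isSquare_delta_add pointP2 (-pointP3)
      rw [delta_neg, ← sub_eq_add_neg, mul_comm] at h6
      have h7 : IsSquare (delta (pointP2 - pointP3) * (delta P * delta e)) := by
        refine isSquare_of_mul (mul_ne_zero (delta_ne_zero pointP2) (delta_ne_zero pointP3)) h6 ?_
        convert h5 using 1
        ring
      convert h7 using 1
      ring

end CurveD

/-! ### Heights on `D` -/

/-- The coefficients of the product of two primitive linear forms are coprime. -/
theorem Int.exists_eq_mul_of_isCoprime {a b c d u v w : ℤ} (hab : IsCoprime a b)
    (hcd : IsCoprime c d) (hb : b ≠ 0) (hd : d ≠ 0) (h₁ : a * c * w = b * d * u)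
    (h₂ : (a * d + c * b) * w = b * d * v) :
    ∃ g, u = g * (a * c) ∧ v = g * (a * d + c * b) ∧ w = g * (b * d) := by
  have key : b * d ∣ w := by
    obtain ⟨r, s, hrs⟩ := hcd
    have ha : b * d ∣ a ^ 2 * w :=
      ⟨r * a * u + s * (a * v - b * u), by
        linear_combination r * a * h₁ + s * (a * h₂ - b * h₁) - a ^ 2 * w * hrs⟩
    have hb : b * d ∣ b ^ 2 * w :=
      ⟨r * (b * v - a * w) + s * b * w, by
        linear_combination r * b * h₂ - b ^ 2 * w * hrs⟩
    obtain ⟨m, n, hmn⟩ := hab.pow (m := 2) (n := 2)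
    have : w = m * (a ^ 2 * w) + n * (b ^ 2 * w) := by linear_combination (-w) * hmn
    rw [this]
    exact dvd_add (ha.mul_left _) (hb.mul_left _)
  obtain ⟨g, rfl⟩ := key
  have hbd := mul_ne_zero hb hd
  refine ⟨g, mul_left_cancel₀ hbd ?_, mul_left_cancel₀ hbd ?_, by ring⟩
  · linear_combination -h₁
  · linear_combination -h₂

namespace CurveD

open WeierstrassCurve.Affine

/-- The height of a point: the naive height of `x / 14`. -/
def height : curveD.Point → ℕ
  | 0 => 1
  | .some x _ _ => max (x / 14).num.natAbs (x / 14).den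

theorem height_zero : height 0 = 1 := rfl

theorem height_some {x y : ℚ} (h : curveD.Nonsingular x y) {p q : ℕ} (hq : 0 < q)
    (hpq : p.Coprime q) (hx : x = 14 * (p / q)) : height (.some x y h) = max p q := by
  have h1 : x / 14 = ((p : ℤ) : ℚ) / ((q : ℤ) : ℚ) := by rw [hx]; push_cast; ring
  have hq' : (0 : ℤ) < q := by exact_mod_cast hq
  have h2 := Rat.num_div_eq_of_coprime hq' (a := p) (by simpa using hpq)
  have h3 := Rat.den_div_eq_of_coprime hq' (a := p) (by simpa using hpq)
  rw [height, h1, h2, Int.natAbs_natCast]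
  congr 1
  exact_mod_cast h3

/-- The symmetric functions of x(P + Q) and x(P - Q) are rational in x(P) and x(Q), which is what
makes a quasi-parallelogram law for heights possible. -/
theorem exists_add_sub {x₁ y₁ x₂ y₂ : ℚ} (h₁ : curveD.Nonsingular x₁ y₁)
    (h₂ : curveD.Nonsingular x₂ y₂) (hx : x₁ ≠ x₂) :
    ∃ x₃ y₃ h₃ x₄ y₄ h₄, Point.some x₁ y₁ h₁ + Point.some x₂ y₂ h₂ = Point.some x₃ y₃ h₃ ∧
      Point.some x₁ y₁ h₁ - Point.some x₂ y₂ h₂ = Point.some x₄ y₄ h₄ ∧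
      x₃ * x₄ * (x₁ - x₂) ^ 2 = (x₁ * x₂ - 196) ^ 2 ∧
      (x₃ + x₄) * (x₁ - x₂) ^ 2 = 2 * ((x₁ + x₂) * (x₁ * x₂ + 196) + 28 * x₁ * x₂) := by
  have e₁ := equation_iff.1 h₁.1
  have e₂ := equation_iff.1 h₂.1
  have hx' := sub_ne_zero.2 hx
  rw [sub_eq_add_neg, Point.neg_some]
  refine ⟨_, _, _, _, _, _, Point.add_of_X_ne hx, Point.add_of_X_ne hx, ?_, ?_⟩
  · rw [slope_of_X_ne hx, slope_of_X_ne hx, negY_eq]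
    simp only [addX, curveD]
    obtain ⟨d, hd⟩ : ∃ d, d = x₁ - x₂ := ⟨_, rfl⟩
    rw [← hd] at hx' ⊢
    have : (y₁ - y₂) ^ 2 * (y₁ - -y₂) ^ 2 = (y₁ ^ 2 - y₂ ^ 2) ^ 2 := by ring
    have h3 : (((y₁ - y₂) / d) ^ 2 + 0 * ((y₁ - y₂) / d) - 14 - x₁ - x₂) *
        (((y₁ - -y₂) / d) ^ 2 + 0 * ((y₁ - -y₂) / d) - 14 - x₁ - x₂) * d ^ 2 =
        ((y₁ ^ 2 - y₂ ^ 2) ^ 2 - (14 + x₁ + x₂) * d ^ 2 * (2 * (y₁ ^ 2 + y₂ ^ 2)) +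
          (14 + x₁ + x₂) ^ 2 * d ^ 4) / d ^ 2 := by
      field_simp
      ring
    rw [h3, div_eq_iff (pow_ne_zero 2 hx'), e₁, e₂, hd]
    ring
  · rw [slope_of_X_ne hx, slope_of_X_ne hx, negY_eq]
    simp only [addX, curveD]
    field_simp
    linear_combination 2 * e₁ + 2 * e₂

theorem max_mul_max_le_of_le {p q c d a b a' b' H : ℕ} (hp : p ≤ H) (hq : q ≤ H)
    (h₁ : (a * a' : ℤ) ≤ (p * c - q * d) ^ 2)
    (h₂ : (a * b' + a' * b : ℤ) ≤
      2 * ((p * d + q * c) * (p * c + q * d) + 2 * (p * q * (c * d))))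
    (h₃ : (b * b' : ℤ) ≤ (p * d - q * c) ^ 2) :
    max a b * max a' b' ≤ 2 * ((c + d) ^ 2 + 2 * (c * d)) * H ^ 2 := by
  have u1 : (p * c : ℤ) ≤ H * c := by exact_mod_cast Nat.mul_le_mul_right c hp
  have u2 : (q * c : ℤ) ≤ H * c := by exact_mod_cast Nat.mul_le_mul_right c hq
  have u3 : (p * d : ℤ) ≤ H * d := by exact_mod_cast Nat.mul_le_mul_right d hp
  have u4 : (q * d : ℤ) ≤ H * d := by exact_mod_cast Nat.mul_le_mul_right d hq
  have z1 : (0 : ℤ) ≤ p * c := by positivity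
  have z2 : (0 : ℤ) ≤ q * c := by positivity
  have z3 : (0 : ℤ) ≤ p * d := by positivity
  have z4 : (0 : ℤ) ≤ q * d := by positivity
  have b1 : ((p * c - q * d) ^ 2 : ℤ) ≤ (H * c + H * d) ^ 2 :=
    sq_le_sq' (by linarith) (by linarith)
  have b3 : ((p * d - q * c) ^ 2 : ℤ) ≤ (H * c + H * d) ^ 2 :=
    sq_le_sq' (by linarith) (by linarith)
  have b2 : ((p * d + q * c) * (p * c + q * d) : ℤ) ≤ (H * c + H * d) ^ 2 := by
    rw [sq]
    exact mul_le_mul (by linarith) (by linarith) (by positivity) (by positivity)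
  have b4 : (p * q * (c * d) : ℤ) ≤ H * H * (c * d) := by
    exact_mod_cast Nat.mul_le_mul_right (c * d) (Nat.mul_le_mul hp hq)
  have b5 : (0 : ℤ) ≤ H * H * (c * d) := by positivity
  have b6 : (0 : ℤ) ≤ (H * c + H * d) ^ 2 := by positivity
  have z5 : (0 : ℤ) ≤ a * b' := by positivity
  have z6 : (0 : ℤ) ≤ a' * b := by positivity
  have key : ((max a b * max a' b' : ℕ) : ℤ) ≤
      2 * ((H * c + H * d) ^ 2 + 2 * (H * H * (c * d))) := by
    generalize (H * c + H * d : ℤ) ^ 2 = X at *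
    generalize (H * H * (c * d) : ℤ) = Y at *
    generalize (p * q * (c * d) : ℤ) = Z at *
    generalize ((p * d + q * c) * (p * c + q * d) : ℤ) = W at *
    rcases max_choice a b with h | h <;> rcases max_choice a' b' with h' | h' <;> rw [h, h'] <;>
      push_cast <;> linarith
  have e : ((2 * ((c + d) ^ 2 + 2 * (c * d)) * H ^ 2 : ℕ) : ℤ) =
      2 * ((H * c + H * d) ^ 2 + 2 * (H * H * (c * d))) := by push_cast; ring
  rw [← e] at key
  exact_mod_cast key

/-- By Gauss's lemma the products aa', ab' + a'b, bb' are coprime, so the integral forms in p, q, c,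
d proportional to them are a multiple g ≥ 1 of them and bound them from above. -/
theorem height_add_mul_height_sub_le {x₁ y₁ x₂ y₂ : ℚ} (h₁ : curveD.Nonsingular x₁ y₁)
    (h₂ : curveD.Nonsingular x₂ y₂) (hx : x₁ ≠ x₂) {c d : ℕ} (hd : 0 < d)
    (hx₂ : x₂ = 14 * (c / d)) :
    height (.some x₁ y₁ h₁ + .some x₂ y₂ h₂) * height (.some x₁ y₁ h₁ - .some x₂ y₂ h₂) ≤
      2 * ((c + d) ^ 2 + 2 * (c * d)) * height (.some x₁ y₁ h₁) ^ 2 := by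
  obtain ⟨x₃, y₃, h₃, x₄, y₄, h₄, hadd, hsub, hprod, hsum⟩ := exists_add_sub h₁ h₂ hx
  rw [hadd, hsub]
  obtain ⟨p, q, hq, hpq, hpx, -⟩ := exists_eq_div (equation_iff.1 h₁.1)
  obtain ⟨a, b, hb, hab, hax, -⟩ := exists_eq_div (equation_iff.1 h₃.1)
  obtain ⟨a', b', hb', hab', hax', -⟩ := exists_eq_div (equation_iff.1 h₄.1)
  rw [height_some h₁ hq hpq hpx, height_some h₃ hb hab hax, height_some h₄ hb' hab' hax']
  have hdQ : (d : ℚ) ≠ 0 := by exact_mod_cast hd.ne'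
  have hqQ : (q : ℚ) ≠ 0 := by exact_mod_cast hq.ne'
  have hbQ : (b : ℚ) ≠ 0 := by exact_mod_cast hb.ne'
  have hbQ' : (b' : ℚ) ≠ 0 := by exact_mod_cast hb'.ne'
  have hne : (p * d - q * c : ℚ) ≠ 0 := by
    intro h0
    apply hx
    rw [hpx, hx₂]
    congr 1
    rw [div_eq_div_iff hqQ hdQ]
    linear_combination h0
  have hP : (a * a' * (p * d - q * c) ^ 2 : ℚ) = b * b' * (p * c - q * d) ^ 2 := by
    rw [hax, hax', hpx, hx₂] at hprod
    field_simp at hprod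
    linear_combination hprod / 38416
  have hS : ((a * b' + a' * b) * (p * d - q * c) ^ 2 : ℚ) =
      b * b' * (2 * ((p * d + q * c) * (p * c + q * d) + 2 * (p * q * (c * d)))) := by
    rw [hax, hax', hpx, hx₂] at hsum
    field_simp at hsum
    linear_combination hsum / 196
  have hP' : (a * a' * (p * d - q * c) ^ 2 : ℤ) = b * b' * (p * c - q * d) ^ 2 := by
    exact_mod_cast hP
  have hS' : ((a * b' + a' * b) * (p * d - q * c) ^ 2 : ℤ) =
      b * b' * (2 * ((p * d + q * c) * (p * c + q * d) + 2 * (p * q * (c * d)))) := by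
    exact_mod_cast hS
  have hne' : (p * d - q * c : ℤ) ≠ 0 := by exact_mod_cast hne
  obtain ⟨g, g1, g2, g3⟩ := Int.exists_eq_mul_of_isCoprime (Nat.isCoprime_iff_coprime.2 hab)
    (Nat.isCoprime_iff_coprime.2 hab') (by exact_mod_cast hb.ne') (by exact_mod_cast hb'.ne') hP' hS'
  have hg : 1 ≤ g := by
    have h1 : (0 : ℤ) < g * (b * b') := by
      rw [← g3]; positivity
    exact pos_of_mul_pos_left h1 (by positivity)
  have le_of_mul : ∀ {m n : ℤ}, 0 ≤ n → m = g * n → n ≤ m := by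
    intro m n hn hm
    rw [hm]
    exact le_mul_of_one_le_left hn hg
  have k1 := le_of_mul (by positivity) g1
  have k2 := le_of_mul (by positivity) g2
  have k3 := le_of_mul (by positivity) g3
  exact max_mul_max_le_of_le (le_max_left p q) (le_max_right p q) k1 k2 k3

/-- If u is at most v/5 the first form is large, otherwise the second. The constant 131/10 exceeds
12 · (25/24)², the worse of the two bounds. -/
theorem height_pow_le_of_le {u v A B : ℤ} (hu : 0 ≤ u) (huv : u ≤ v)
    (hA : (u ^ 2 - v ^ 2) ^ 2 ≤ 12 * A) (hB : 4 * (u * v) * (u ^ 2 + u * v + v ^ 2) ≤ 12 * B) :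
    10 * v ^ 4 ≤ 131 * max A B := by
  by_cases h : 5 * u ≤ v
  · have h1 : 24 * v ^ 2 ≤ 25 * (v ^ 2 - u ^ 2) := by nlinarith
    have h2 : (24 * v ^ 2) * (24 * v ^ 2) ≤ 25 * (v ^ 2 - u ^ 2) * (25 * (v ^ 2 - u ^ 2)) :=
      mul_le_mul h1 h1 (by positivity) (by nlinarith)
    have h3 := le_max_left A B
    nlinarith
  · push Not at h
    have h0 : 0 ≤ v := hu.trans huv
    have h1 : 31 * v ^ 2 ≤ 25 * (u ^ 2 + u * v + v ^ 2) := by nlinarith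
    have h2 : v ^ 2 ≤ 5 * (u * v) := by nlinarith
    have h3 : v ^ 2 * (31 * v ^ 2) ≤ 5 * (u * v) * (25 * (u ^ 2 + u * v + v ^ 2)) :=
      mul_le_mul h2 h1 (by positivity) (by positivity)
    have h4 := le_max_right A B
    have h5 : 0 ≤ v ^ 4 := by positivity
    nlinarith

/-- With x(R) = 14p/q, duplication gives the fraction (p² - q²)² / (4pq(p² + pq + q²)); the point is
that cancellation removes at most a factor 12. -/
theorem height_pow_le (R : curveD.Point) : 10 * height R ^ 4 ≤ 131 * height (R + R) := by
  rcases R with _ | ⟨x, y, h⟩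
  · rw [← Point.zero_def, add_zero, height_zero]; norm_num
  obtain ⟨p, q, hq, hpq, hx, -⟩ := exists_eq_div (equation_iff.1 h.1)
  by_cases hy : y = 0
  · have h0 : x * (x ^ 2 + 14 * x + 196) = 0 := by
      have := equation_iff.1 h.1
      rw [hy] at this
      linear_combination -this
    have hx0 := (mul_eq_zero.1 h0).resolve_right (norm_ne_zero x)
    rw [Point.add_self_of_Y_eq (by rw [negY_eq, hy, neg_zero]), height_zero,
      height_some h (p := 0) (q := 1) one_pos (by simp) (by simp [hx0])]
    norm_num
  obtain ⟨y', h', hd⟩ := double_some h hy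
  obtain ⟨a, b, hb, hab, hax, -⟩ := exists_eq_div (equation_iff.1 h'.1)
  rw [hd, height_some h hq hpq hx, height_some h' hb hab hax]
  have hp : 0 < p := by
    apply Nat.pos_of_ne_zero
    rintro rfl
    have := equation_iff.1 h.1
    rw [hx] at this
    simp at this
    exact hy this
  have hpQ : (p : ℚ) ≠ 0 := by exact_mod_cast hp.ne'
  have hqQ : (q : ℚ) ≠ 0 := by exact_mod_cast hq.ne'
  have hbQ : (b : ℚ) ≠ 0 := by exact_mod_cast hb.ne'
  have hrel : (a * (4 * (p * q) * (p ^ 2 + p * q + q ^ 2)) : ℤ) = b * (p ^ 2 - q ^ 2) ^ 2 := by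
    have h1 : (x ^ 2 - 196) ^ 2 = 4 * (x ^ 3 + 14 * x ^ 2 + 196 * x) * (14 * (a / b)) := by
      rw [← equation_iff.1 h.1, ← hax]
      field_simp
      ring
    rw [hx] at h1
    field_simp at h1
    have h2 : (a * (4 * (p * q) * (p ^ 2 + p * q + q ^ 2)) : ℚ) = b * (p ^ 2 - q ^ 2) ^ 2 := by
      linear_combination -h1 / 38416
    exact_mod_cast h2
  have hco : IsCoprime (a : ℤ) b := Nat.isCoprime_iff_coprime.2 hab
  have hcopq : IsCoprime (p : ℤ) q := Nat.isCoprime_iff_coprime.2 hpq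
  obtain ⟨g, hg⟩ : (b : ℤ) ∣ 4 * (p * q) * (p ^ 2 + p * q + q ^ 2) :=
    hco.symm.dvd_of_dvd_mul_left ⟨_, hrel⟩
  have hg2 : (p ^ 2 - q ^ 2 : ℤ) ^ 2 = g * a := by
    have hb0 : (b : ℤ) ≠ 0 := by exact_mod_cast hb.ne'
    apply mul_left_cancel₀ hb0
    rw [← hrel, hg]; ring
  have hg0 : 0 < g := by
    have : (0 : ℤ) < b * g := by rw [← hg]; positivity
    exact pos_of_mul_pos_right this (by positivity)
  have hgp : IsCoprime g (p * q) := by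
    have h1 : IsCoprime ((p ^ 2 - q ^ 2 : ℤ) ^ 2) (p * q) := by
      apply IsCoprime.pow_left
      apply IsCoprime.mul_right
      · rw [show (p ^ 2 - q ^ 2 : ℤ) = -q ^ 2 + p * p by ring]
        exact (hcopq.symm.pow_left (m := 2)).neg_left.add_mul_left_left (p : ℤ)
      · rw [show (p ^ 2 - q ^ 2 : ℤ) = p ^ 2 + q * -q by ring]
        exact (hcopq.pow_left (m := 2)).add_mul_left_left (-q : ℤ)
    rw [hg2] at h1
    exact h1.of_mul_left_left
  -- The cancelled factor is coprime to pq and divides 12p²q², by 4(p² + pq + q²)(p² - pq + q²) -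
  -- 4(p² - q²)² = 12p²q².
  have hg12 : g ≤ 12 := by
    apply Int.le_of_dvd (by norm_num)
    have h1 : g ∣ 4 * (p ^ 2 + p * q + q ^ 2) := by
      apply hgp.dvd_of_dvd_mul_left
      exact ⟨b, by linear_combination hg⟩
    have h2 : g ∣ (p * q : ℤ) * (p * q) * 12 := by
      have h3 : (p * q : ℤ) * (p * q) * 12 = 4 * (p ^ 2 + p * q + q ^ 2) *
          (p ^ 2 - p * q + q ^ 2) - g * (4 * a) := by linear_combination -4 * hg2
      rw [h3]
      exact dvd_sub (h1.mul_right _) (dvd_mul_right _ _)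
    exact (hgp.mul_right hgp).dvd_of_dvd_mul_left h2
  have hA : (p ^ 2 - q ^ 2 : ℤ) ^ 2 ≤ 12 * a := by
    rw [hg2]; exact mul_le_mul_of_nonneg_right hg12 (by positivity)
  have hB : (4 * (p * q) * (p ^ 2 + p * q + q ^ 2) : ℤ) ≤ 12 * b := by
    rw [hg, mul_comm]; exact mul_le_mul_of_nonneg_right hg12 (by positivity)
  have : ((10 * max p q ^ 4 : ℕ) : ℤ) ≤ ((131 * max a b : ℕ) : ℤ) := by
    push_cast
    rcases le_total p q with hle | hle
    · rw [max_eq_right (by exact_mod_cast hle)]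
      exact height_pow_le_of_le (by positivity) (by exact_mod_cast hle) hA hB
    · rw [max_eq_left (by exact_mod_cast hle)]
      refine height_pow_le_of_le (u := q) (by positivity) (by exact_mod_cast hle) ?_ ?_
      · convert hA using 1; ring
      · convert hB using 1; ring
  exact_mod_cast this

theorem height_add_pointP1 (P : curveD.Point) : height (P + pointP1) = height P := by
  rcases P with _ | ⟨x, y, h⟩
  · rw [← Point.zero_def, zero_add, height_zero, pointP1,
      height_some _ (p := 0) (q := 1) one_pos (by simp) (by simp)]
    rfl
  by_cases hx0 : x = 0
  · rw [eq_pointP1_of_x_eq_zero h hx0]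
    have : pointP1 + pointP1 = 0 := by
      rw [pointP1, Point.add_self_of_Y_eq (by rw [negY_eq, neg_zero])]
    rw [this, height_zero, pointP1,
      height_some _ (p := 0) (q := 1) one_pos (by simp) (by simp)]
    rfl
  obtain ⟨y', h', hadd⟩ := add_pointP1 h hx0
  obtain ⟨p, q, hq, hpq, hx, -⟩ := exists_eq_div (equation_iff.1 h.1)
  have hp : 0 < p := Nat.pos_of_ne_zero (by rintro rfl; simp at hx; exact hx0 hx)
  have hpQ : (p : ℚ) ≠ 0 := by exact_mod_cast hp.ne'
  have hqQ : (q : ℚ) ≠ 0 := by exact_mod_cast hq.ne'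
  rw [hadd, height_some h hq hpq hx, height_some h' (p := q) hp hpq.symm, max_comm]
  rw [hx]
  field_simp
  norm_num

end CurveD

/-! ### The Mordell–Weil group of `D` -/

namespace CurveD

open WeierstrassCurve.Affine

theorem pointP1_add_self : pointP1 + pointP1 = 0 := by
  rw [pointP1, Point.add_self_of_Y_eq (by rw [negY_eq, neg_zero])]

theorem pointP1_ne_zero : pointP1 ≠ 0 := Point.some_ne_zero _

theorem addOrderOf_pointP1 : addOrderOf pointP1 = 2 := by
  refine addOrderOf_eq_prime ?_ pointP1_ne_zero
  rw [two_nsmul, pointP1_add_self]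

theorem pointP2_sub_pointP3 : ∃ h, pointP2 - pointP3 = Point.some 252 (-4116) h := by
  have hx : (7 : ℚ) ≠ 16 := by norm_num
  have hs : curveD.slope 7 16 (-49) (curveD.negY 16 (-104)) = 17 := by
    rw [slope_of_X_ne hx, negY_eq]; norm_num
  have key : ∀ {a b a' b' : ℚ} (ha : a = a') (hb : b = b') (h : curveD.Nonsingular a b),
      ∃ h', Point.some a b h = Point.some a' b' h' := by
    rintro a b _ _ rfl rfl h
    exact ⟨h, rfl⟩
  rw [sub_eq_add_neg, pointP2, pointP3, Point.neg_some, Point.add_of_X_ne hx]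
  apply key
  · rw [hs]; simp [curveD]; norm_num
  · rw [hs, addY, negY_eq]; simp [curveD]; norm_num

theorem eq_or_eq_neg_of_x_eq {x y x' y' : ℚ} {h : curveD.Nonsingular x y}
    {h' : curveD.Nonsingular x' y'} (hx : x = x') :
    Point.some x y h = Point.some x' y' h' ∨ Point.some x y h = -Point.some x' y' h' :=
  Point.X_eq_iff.1 hx

/-- The better of P + T and P - T. The x-coordinates divided by 14 are 1/2, 8/7 and 18, and the last
gives the largest constant, 2(19² + 36) = 794. -/
theorem exists_height_sq_le {P T : curveD.Point}
    (hT : T = 0 ∨ T = pointP2 ∨ T = pointP3 ∨ T = pointP2 - pointP3) (hP0 : P ≠ 0) (h1 : P ≠ T)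
    (h2 : P ≠ -T) :
    ∃ S, (S = P + T ∨ S = P - T) ∧ height S ^ 2 ≤ 794 * height P ^ 2 := by
  rcases P with _ | ⟨x, y, h⟩
  · exact absurd rfl hP0
  rcases eq_or_ne T 0 with rfl | hT0
  · exact ⟨_, .inl rfl, by rw [add_zero]; nlinarith⟩
  have key : ∃ c d : ℕ, 0 < d ∧ 2 * ((c + d) ^ 2 + 2 * (c * d)) ≤ 794 ∧
      ∃ (x₂ y₂ : ℚ) (h₂ : curveD.Nonsingular x₂ y₂), x₂ = 14 * (c / d) ∧
        T = Point.some x₂ y₂ h₂ := by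
    rcases hT with rfl | rfl | rfl | rfl
    · exact absurd rfl hT0
    · exact ⟨1, 2, by norm_num, by norm_num, _, _, _, by norm_num, rfl⟩
    · exact ⟨8, 7, by norm_num, by norm_num, _, _, _, by norm_num, rfl⟩
    · obtain ⟨h', he⟩ := pointP2_sub_pointP3
      rw [he]
      exact ⟨18, 1, by norm_num, by norm_num, _, _, _, by norm_num, rfl⟩
  obtain ⟨c, d, hd, hcd, x₂, y₂, h₂, hx₂, rfl⟩ := key
  have hx : x ≠ x₂ := fun hx =>
    (eq_or_eq_neg_of_x_eq (h := h) (h' := h₂) hx).elim h1 h2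
  have hle := (height_add_mul_height_sub_le h h₂ hx hd hx₂).trans
    (Nat.mul_le_mul_right _ hcd)
  rcases le_total (height (.some x y h + .some _ y₂ h₂)) (height (.some x y h - .some _ y₂ h₂))
    with h3 | h3
  · exact ⟨_, .inl rfl, le_trans (by rw [sq]; exact Nat.mul_le_mul_left _ h3) hle⟩
  · exact ⟨_, .inr rfl, le_trans (by rw [sq]; exact Nat.mul_le_mul_right _ h3) hle⟩

/-- If r ≥ t, then 100t⁶ ≤ 131² · 794, which fails from t = 8 on but not for t = 7; hence the
threshold 8 in the descent. -/
theorem height_lt_of_le {r s t : ℕ} (h₁ : 10 * r ^ 4 ≤ 131 * s) (h₂ : s ^ 2 ≤ 794 * t ^ 2)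
    (ht : 8 ≤ t) : r < t := by
  by_contra! hrt
  have h3 : t ^ 4 ≤ r ^ 4 := Nat.pow_le_pow_left hrt 4
  have h4 : (10 * t ^ 4) ^ 2 ≤ (131 * s) ^ 2 := Nat.pow_le_pow_left (by omega) 2
  have h5 : 8 ^ 6 ≤ t ^ 6 := Nat.pow_le_pow_left ht 6
  have h6 : 0 < t ^ 2 := by positivity
  nlinarith

theorem small_solutions : ∀ p < 8, ∀ q < 8, 0 < q →
    IsSquare (14 * p * q * (p ^ 2 + p * q + q ^ 2)) → p = 0 ∨ q = 2 * p ∨ p = 2 * q := by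
  intro p hp q hq hq0 h
  interval_cases p <;> interval_cases q <;> revert h <;> norm_num

theorem mem_closure_of_height_lt {P : curveD.Point} (hP : height P < 8) :
    P ∈ AddSubgroup.closure {pointP1, pointP2, pointP3} := by
  have hP1 : pointP1 ∈ AddSubgroup.closure {pointP1, pointP2, pointP3} :=
    AddSubgroup.subset_closure (by simp)
  have hP2 : pointP2 ∈ AddSubgroup.closure {pointP1, pointP2, pointP3} :=
    AddSubgroup.subset_closure (by simp)
  rcases P with _ | ⟨x, y, h⟩
  · exact zero_mem _
  have hx7 : ∀ {x y : ℚ} (h : curveD.Nonsingular x y), x = 7 →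
      Point.some x y h ∈ AddSubgroup.closure {pointP1, pointP2, pointP3} := by
    intro x y h hx
    have h' : curveD.Nonsingular 7 (-49) := nonsingular_of_sq (by norm_num) (by norm_num)
    rcases eq_or_eq_neg_of_x_eq (h := h) (h' := h') hx with h1 | h1
    · rw [h1]; exact hP2
    · rw [h1]; exact neg_mem hP2
  obtain ⟨p, q, hq, hpq, hx, hs⟩ := exists_eq_div (equation_iff.1 h.1)
  rw [height_some h hq hpq hx, max_lt_iff] at hP
  rcases small_solutions p hP.1 q hP.2 hq hs with rfl | rfl | rfl
  · rw [eq_pointP1_of_x_eq_zero h (by simp [hx])]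
    exact hP1
  · refine hx7 h ?_
    have : (p : ℚ) ≠ 0 := by
      rintro h0
      have : p = 0 := by exact_mod_cast h0
      omega
    rw [hx]; push_cast; field_simp; norm_num
  · have : (q : ℚ) ≠ 0 := by exact_mod_cast hq.ne'
    have hx28 : x = 28 := by
      rw [hx]; push_cast; field_simp; norm_num
    obtain ⟨y', h', hadd⟩ := add_pointP1 h (by rw [hx28]; norm_num)
    rw [← add_sub_cancel_right (Point.some x y h) pointP1, hadd]
    exact sub_mem (hx7 h' (by rw [hx28]; norm_num)) hP1

/-- Infinite descent on the height. Adding the 2-torsion point P₁ does not change the height, so it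
costs nothing in passing from S to S + e = 2R. -/
theorem closure_eq_top : AddSubgroup.closure {pointP1, pointP2, pointP3} = ⊤ := by
  rw [eq_top_iff]
  rintro P -
  have hP1 : pointP1 ∈ AddSubgroup.closure {pointP1, pointP2, pointP3} :=
    AddSubgroup.subset_closure (by simp)
  have hP2 : pointP2 ∈ AddSubgroup.closure {pointP1, pointP2, pointP3} :=
    AddSubgroup.subset_closure (by simp)
  have hP3 : pointP3 ∈ AddSubgroup.closure {pointP1, pointP2, pointP3} :=
    AddSubgroup.subset_closure (by simp)
  induction hn : height P using Nat.strong_induction_on generalizing P with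
  | _ n ih =>
    subst hn
    by_cases h8 : height P < 8
    · exact mem_closure_of_height_lt h8
    obtain ⟨T, hT, e, he, hs⟩ := exists_isSquare P
    have hTmem : T ∈ AddSubgroup.closure {pointP1, pointP2, pointP3} := by
      rcases hT with rfl | rfl | rfl | rfl
      · exact zero_mem _
      · exact hP2
      · exact hP3
      · exact sub_mem hP2 hP3
    have hemem : e ∈ AddSubgroup.closure {pointP1, pointP2, pointP3} := by
      rcases he with rfl | rfl
      · exact zero_mem _
      · exact hP1
    by_cases h0 : P = 0
    · rw [h0]; exact zero_mem _
    by_cases h1 : P = T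
    · rwa [h1]
    by_cases h2 : P = -T
    · rw [h2]; exact neg_mem hTmem
    obtain ⟨S, hS, hle⟩ := exists_height_sq_le hT h0 h1 h2
    have hPS : IsSquare (delta P * delta T * delta S) := by
      rcases hS with rfl | rfl
      · exact isSquare_delta_add P T
      · have := isSquare_delta_add P (-T)
        rwa [delta_neg, ← sub_eq_add_neg] at this
    -- Both P + T and P - T have the class of P times that of T, since negation does not change
    -- `delta`; so either choice of S works.
    have hSe : IsSquare (delta (S + e)) := by
      have h3 : IsSquare (delta S * delta e) :=
        isSquare_of_mul (mul_ne_zero (delta_ne_zero P) (delta_ne_zero T))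
          (by rwa [mul_comm]) hs
      have h4 := isSquare_of_mul (a := 1) (mul_ne_zero (delta_ne_zero S) (delta_ne_zero e))
        (by rwa [one_mul]) (isSquare_delta_add S e)
      rwa [one_mul] at h4
    obtain ⟨R, hR⟩ := exists_add_self_of_isSquare hSe
    have hheight : height (S + e) = height S := by
      rcases he with rfl | rfl
      · rw [add_zero]
      · exact height_add_pointP1 S
    have hlt : height R < height P := by
      refine height_lt_of_le ?_ hle (by omega)
      rw [← hheight, hR]
      exact height_pow_le R
    have hRmem := ih _ hlt rfl
    have hSmem : S ∈ AddSubgroup.closure {pointP1, pointP2, pointP3} := by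
      rw [eq_sub_of_add_eq hR]
      exact sub_mem (add_mem hRmem hRmem) hemem
    rcases hS with rfl | rfl
    · exact (add_mem_cancel_right hTmem).1 hSmem
    · rw [← sub_add_cancel P T]
      exact add_mem hSmem hTmem

/-! ### Independence -/

theorem isSquare_congr {F : Type*} [Field F] {a b : F} (h : IsSquare a) (e : a = b) :
    IsSquare b := e ▸ h

theorem isSquare_delta_add_self (R : curveD.Point) : IsSquare (delta (R + R)) := by
  refine isSquare_of_mul_mul_self (delta_ne_zero R) ?_
  exact isSquare_congr (isSquare_delta_add R R) (by ring)

theorem isSquare_delta_mul_delta_add (P R : curveD.Point) :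
    IsSquare (delta P * delta (P + (R + R))) := by
  have h := isSquare_delta_add P (R + R)
  have := isSquare_of_mul (a := 1) (delta_ne_zero (R + R)) (by
    rw [one_mul]; exact isSquare_delta_add_self R) (c := delta P * delta (P + (R + R)))
    (isSquare_congr h (by ring))
  rwa [one_mul] at this

/-- A number a + bω has rational square only if b = 0 or b = 2a, and (1 + 2ω)² = -3. -/
theorem sq_eq_or_of_isSquare_C {r : ℚ} (h : IsSquare (QuadraticAlgebra.C r : K)) :
    ∃ s, s ^ 2 = r ∨ s ^ 2 = -3 * r := by
  obtain ⟨⟨a, b⟩, hab⟩ := h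
  have h1 := congrArg QuadraticAlgebra.re hab
  have h2 := congrArg QuadraticAlgebra.im hab
  simp only [QuadraticAlgebra.re_mul, QuadraticAlgebra.im_mul, QuadraticAlgebra.re_C,
    QuadraticAlgebra.im_C] at h1 h2
  have h3 : b * (2 * a - b) = 0 := by linear_combination -h2
  rcases mul_eq_zero.1 h3 with rfl | h3
  · exact ⟨a, .inl (by linear_combination -h1)⟩
  · exact ⟨3 * a, .inr (by
      rw [← sub_eq_zero] at h1
      have hb : b = 2 * a := by linear_combination -h3
      rw [hb] at h1
      linear_combination 3 * h1)⟩

theorem not_isSquare_C {n : ℕ} (hn : ¬ IsSquare n) (hn0 : n ≠ 0) :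
    ¬ IsSquare (QuadraticAlgebra.C (n : ℚ) : K) := by
  intro h
  obtain ⟨s, h | h⟩ := sq_eq_or_of_isSquare_C h
  · exact not_sq_eq_mul_sq hn one_ne_zero (a := s) (by rw [h]; ring)
  · have : (0 : ℚ) < n := by positivity
    nlinarith [sq_nonneg s]

theorem not_isSquare_delta_pointP1 : ¬ IsSquare (delta pointP1) := by
  intro h
  refine not_isSquare_C (n := 42) (by norm_num) (by norm_num) ?_
  have := isSquare_of_mul (c := 1) (delta_ne_zero pointP1) isSquare_C_mul_delta_pointP1
    (by rwa [mul_one])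
  rw [mul_one] at this
  exact_mod_cast this

theorem not_isSquare_norm_of_seven {r : ℚ} (h : r ≠ 0) : ¬ IsSquare (7 * r ^ 2) := by
  rintro ⟨s, hs⟩
  exact not_sq_eq_mul_sq (n := 7) (by norm_num) h (a := s) (by push_cast; rw [hs, sq])

theorem norm_delta_pointP3 : QuadraticAlgebra.norm (delta pointP3) = 26 ^ 2 := by
  rw [pointP3, norm_delta_some]
  norm_num

theorem exists_norm_delta_eq {T : curveD.Point} (hT : T = 0 ∨ T = pointP1) :
    ∃ r : ℚ, r ≠ 0 ∧ QuadraticAlgebra.norm (delta T) = r ^ 2 := by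
  rcases hT with rfl | rfl
  · exact ⟨1, one_ne_zero, by rw [delta_zero, map_one, one_pow]⟩
  · exact ⟨14, by norm_num, by rw [pointP1, norm_delta_some]; norm_num⟩

/-- The classes involving P₂ have norm 7 up to squares. The remaining ones are the rational classes
2 and 2 · 42 = 84, nonsquares in ℚ(ω). -/
theorem not_isSquare_delta_mul {T : curveD.Point} (hT : T = 0 ∨ T = pointP1) :
    ¬ IsSquare (delta pointP2 * delta T) ∧ ¬ IsSquare (delta pointP3 * delta T) ∧
      ¬ IsSquare (delta (pointP2 + pointP3) * delta T) := by
  obtain ⟨r, hr0, hr⟩ := exists_norm_delta_eq hT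
  refine ⟨fun h => ?_, fun h => ?_, fun h => ?_⟩
  · have h1 := h.map QuadraticAlgebra.norm
    rw [map_mul, norm_delta_pointP2, hr] at h1
    refine not_isSquare_norm_of_seven (r := 7 * r) (by positivity) ?_
    exact isSquare_congr h1 (by ring)
  · have h1 := isSquare_of_mul (delta_ne_zero pointP3) isSquare_C_mul_delta_pointP3 h
    rcases hT with rfl | rfl
    · rw [delta_zero, mul_one] at h1
      exact not_isSquare_C (n := 2) (by norm_num) (by norm_num) (by exact_mod_cast h1)
    · have h2 := isSquare_of_mul (delta_ne_zero pointP1) h1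
        (by rw [mul_comm]; exact isSquare_C_mul_delta_pointP1)
      rw [← QuadraticAlgebra.C_mul] at h2
      refine not_isSquare_C (n := 84) (by norm_num) (by norm_num) ?_
      exact isSquare_congr h2 (by norm_num)
  · have h1 := isSquare_of_mul (delta_ne_zero (pointP2 + pointP3))
      (isSquare_delta_add pointP2 pointP3) h
    have h2 := h1.map QuadraticAlgebra.norm
    rw [map_mul, map_mul, norm_delta_pointP2, norm_delta_pointP3, hr] at h2
    refine not_isSquare_norm_of_seven (r := 7 * 26 * r) (by positivity) ?_
    exact isSquare_congr h2 (by ring)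

theorem eq_zero_or_eq_pointP1_of_add_self {S : curveD.Point} (h : S + S = 0) :
    S = 0 ∨ S = pointP1 := by
  rcases S with _ | ⟨x, y, hxy⟩
  · exact .inl rfl
  right
  by_cases hy : y = 0
  · apply eq_pointP1_of_x_eq_zero
    have h1 := equation_iff.1 hxy.1
    have h0 : x * (x ^ 2 + 14 * x + 196) = 0 := by
      rw [hy] at h1
      linear_combination -h1
    exact (mul_eq_zero.1 h0).resolve_right (norm_ne_zero x)
  · obtain ⟨y', h', hd⟩ := double_some hxy hy
    rw [hd] at h
    exact absurd h (Point.some_ne_zero _)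

/-- Allowing the value P₁ makes the induction close up: halving an even relation gives a point
killed by 2, which is 0 or P₁. -/
theorem eq_zero_of_zsmul_add_zsmul {m n : ℤ}
    (h : m • pointP2 + n • pointP3 = 0 ∨ m • pointP2 + n • pointP3 = pointP1) :
    m = 0 ∧ n = 0 := by
  induction hN : m.natAbs + n.natAbs using Nat.strong_induction_on generalizing m n with
  | _ N ih =>
    subst hN
    obtain ⟨h2, h3, h23⟩ := not_isSquare_delta_mul h
    rcases Int.even_or_odd' m with ⟨m, rfl | rfl⟩ <;> rcases Int.even_or_odd' n with ⟨n, rfl | rfl⟩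
    · obtain ⟨S, hS⟩ : ∃ S, S = m • pointP2 + n • pointP3 := ⟨_, rfl⟩
      have e : (2 * m) • pointP2 + (2 * n) • pointP3 = S + S := by rw [hS]; module
      rw [e] at h
      have h0 : S + S = 0 := h.resolve_right fun h1 =>
        not_isSquare_delta_pointP1 (h1 ▸ isSquare_delta_add_self S)
      by_cases hz : m.natAbs + n.natAbs = 0
      · omega
      · have := @ih (m.natAbs + n.natAbs) (by omega) m n
          (by rw [← hS]; exact eq_zero_or_eq_pointP1_of_add_self h0) rfl
        omega
    · refine (h3 ?_).elim
      convert isSquare_delta_mul_delta_add pointP3 (m • pointP2 + n • pointP3) using 3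
      module
    · refine (h2 ?_).elim
      convert isSquare_delta_mul_delta_add pointP2 (m • pointP2 + n • pointP3) using 3
      module
    · refine (h23 ?_).elim
      convert isSquare_delta_mul_delta_add (pointP2 + pointP3) (m • pointP2 + n • pointP3) using 3
      module

theorem linearIndependent : LinearIndependent ℤ ![pointP2, pointP3] :=
  LinearIndependent.pair_iff.2 fun _ _ h => eq_zero_of_zsmul_add_zsmul (.inl h)

theorem span_eq_top : Submodule.span ℤ {pointP1, pointP2, pointP3} = ⊤ := by
  rw [eq_top_iff]
  rintro P -
  have hP : P ∈ AddSubgroup.closure {pointP1, pointP2, pointP3} := by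
    rw [closure_eq_top]; trivial
  have hle : AddSubgroup.closure {pointP1, pointP2, pointP3} ≤
      (Submodule.span ℤ {pointP1, pointP2, pointP3}).toAddSubgroup :=
    (AddSubgroup.closure_le _).2 Submodule.subset_span
  exact hle hP

instance : Module.Finite ℤ curveD.Point :=
  ⟨Submodule.fg_def.2 ⟨_, Set.toFinite _, span_eq_top⟩⟩

/-- Dividing out the torsion point P₁ does not change the rank, and the quotient is generated by two
elements; independence gives the other inequality. -/
theorem finrank_eq_two : Module.finrank ℤ curveD.Point = 2 := by
  apply le_antisymm
  · have htors : Submodule.span ℤ {pointP1} ≤ Submodule.torsion ℤ curveD.Point := by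
      rw [Submodule.span_singleton_le_iff_mem]
      refine ⟨⟨2, mem_nonZeroDivisors_of_ne_zero two_ne_zero⟩, ?_⟩
      change (2 : ℤ) • pointP1 = 0
      rw [two_zsmul, pointP1_add_self]
    rw [← finrank_quotient_eq_of_le_torsion htors]
    have := finrank_le_of_span_eq_top (R := ℤ)
      (v := ![(Submodule.span ℤ {pointP1}).mkQ pointP2, (Submodule.span ℤ {pointP1}).mkQ pointP3]) ?_
    · simpa using this
    rw [eq_top_iff, ← (Submodule.span ℤ {pointP1}).range_mkQ, LinearMap.range_eq_map,
      ← span_eq_top, Submodule.map_span, Submodule.span_le]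
    rintro _ ⟨P, hP, rfl⟩
    rcases hP with rfl | rfl | rfl
    · have h0 : (Submodule.span ℤ {pointP1}).mkQ pointP1 = 0 :=
        (Submodule.Quotient.mk_eq_zero _).2 (Submodule.mem_span_singleton_self pointP1)
      rw [h0]
      exact zero_mem _
    · exact Submodule.subset_span ⟨0, rfl⟩
    · exact Submodule.subset_span ⟨1, rfl⟩
  · simpa using linearIndependent.fintype_card_le_finrank

end CurveD
end

theorem mainTheorem6 :
    (addOrderOf pointP1 = 2 ∧
      LinearIndependent ℤ ![pointP2, pointP3] ∧
      AddSubgroup.closure {pointP1, pointP2, pointP3} = ⊤ ∧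
      Module.finrank ℤ curveD.Point = 2) ∧
    (Module.finrank (IntermediateField.adjoin ℚ {sFunction}) curveD.FunctionField = 4 ∧
      ∀ s : ℚ, (sFiber s).encard ≤ 4) ∧
    (∃ C : ℕ → GenusTwoCurve ℚ,
      (∀ i j, i ≠ j → ¬ (C i).IsIsomorphic (C j)) ∧
      ∀ i, ∃ P : (C i).JacobianPoints, addOrderOf P = 48) := by
  exact ⟨⟨CurveD.addOrderOf_pointP1, CurveD.linearIndependent, CurveD.closure_eq_top,
      CurveD.finrank_eq_two⟩,
    ⟨CurveD.finrank_adjoin_sFunction, CurveD.encard_sFiber_le⟩,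
    GenusTwoCurve.exists_seq_addOrderOf_eq_48⟩
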